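/- Let $(\mathbf X,\mathcal B(\mathbf X))$ be a standard Borel space, $T_0\in\mathbb R$, $T_0<T_1\le+\infty$. A $Q$-function is a function $q(x,t,B)$ ($x\in\mathbf X$, $t\in[T_0,T_1[$, $B\in\mathcal B(\mathbf X)$), measurable in $(x,t)$ for each $B$, such that $q(x,t,\cdot)$ is a finite signed measure with $q(x,t,\mathbf X)\le 0$ and $q(x,t,B\setminus\{x\})\ge 0$ for all $B$; it is conservative if $q(x,t,\mathbf X)=0$ for all $x,t$. Put $q(x,t):=q(x,t,\mathbf X\setminus\{x\})$. Let $\Omega$ be the set of sequences $\omega=(x_0,t_1,x_1,t_2,\dots)$ with $x_0\in\mathbf X$, $x_n\in\mathbf X\cup\{x_\infty\}$ and $t_n\in\,]T_0,T_1]$ for $n\ge1$ (where $x_\infty\notin\mathbf X$ is an isolated point) such that for all $n\ge 1$: if $t_n<T_1$, then $t_n<t_{n+1}$ and $x_n\in\mathbf X$; if $t_n=T_1$, then $t_{n+1}=T_1$ and $x_n=x_\infty$. Let $\mathcal F$ be the product $\sigma$-field on $\Omega$, let $t_0:=T_0$, $t_\infty:=\lim_n t_n$, and let $\mathcal F_t$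 be generated by $x_0$ and the events $\{x_n\in B,\ t_n\le s\}$, $n\ge1$, $s\le t$, $B\in\mathcal B(\mathbf X)$. For $t\in[T_0,T_1[$ let $\mathbb X_t:=x_n$ if $t_n\le t<t_{n+1}$, and $\mathbb X_t:=x_\infty$ if $t\ge t_\infty$. **Theorem.** Let $\gamma$ be a probability measure on $\mathbf X$ and $q$ a conservative $Q$-function with $\int_{T_0}^s q(x,t)\,dt<\infty$ for all $x\in\mathbf X$ and $s\in\,]T_0,T_1[$. There is a unique probability measure $\mathbb P$ on $(\Omega,\mathcal F)$ such that $\mathbb P(x_0\in B)=\gamma(B)$ for $B\in\mathcal B(\mathbf X)$ and the random measure $$\nu(\omega;[T_0,t],B)=\int_{T_0}^t\sum_{n\ge0}I\{t_n<s\le t_{n+1}\}\,q(x_n,s,B\setminus\{x_n\})\,ds$$ is the compensator, with respect to $(\mathcal F_t)$ and $\mathbb P$, of the random measure $\sum_{n\ge1}I\{t_n<T_1\}\,\delta_{(t_n,x_n)}$ (that is, $\nu$ is predictable and both random measures give the same expected integral to each non-negative predictable function of $(t,\omega,x)$). Under this $\mathbb P$, the process $(\mathbb X_t)_{t\in[T_0,T_1[}$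 is a (possibly explosive) jump Markov process, that is: 1. It is a jump process: $(\mathcal F_t)$ is right-continuous, each $t_n$ ($n\ge 1$) is a stopping time, $x_n$ is $\mathcal F_{t_n}$-measurable, and $x_0$ is $\mathcal F_{T_0}$-measurable. 2. It is Markov: it is adapted to $(\mathcal F_t)$, and $\mathbb P(\mathbb X_t\in B\mid\mathcal F_u)=\mathbb P(\mathbb X_t\in B\mid\mathbb X_u)$ a.s. for all $T_0\le u<t<T_1$ and measurable $B\subseteq\mathbf X\cup\{x_\infty\}$. Its transition function is Feller's $$\bar P(u,x;t,B)=\sum_{n\ge0}\bar P^{(n)}(u,x;t,B),\qquad \bar P^{(0)}(u,x;t,B)=I\{x\in B\}e^{-\int_u^tq(x,s)ds},$$ $$\bar P^{(n)}(u,x;t,B)=\int_u^t\int_{\mathbf X}e^{-\int_u^wq(x,\theta)d\theta}\,q(x,w,dy\setminus\{x\})\,\bar P^{(n-1)}(w,y;t,B)\,dw,\quad n\ge1.$$ That is, for $T_0\le u<t<T_1$, $\bar P(u,x;t,B)$ has values in $[0,1]$, is a measure in $B\in\mathcal B(\mathbf X)$, is measurable in $(u,x,t)$ and satisfies $\bar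 P(u,x;t,B)=\int_{\mathbf X}\bar P(s,y;t,B)\,\bar P(u,x;s,dy)$ for $u<s<t$; and $\mathbb P(\mathbb X_t\in B\mid\mathbb X_u)=\bar P(u,\mathbb X_u;t,B)$ a.s. for $B\in\mathcal B(\mathbf X)$, where $\bar P(u,x_\infty;t,B):=0$. -/

import Mathlib

open MeasureTheory ProbabilityTheory
open scoped ENNReal

namespace JumpMarkov

noncomputable section

/-! ### Time axis and state spaces -/

/-- The time interval `[T₀, T₁[`, where `T₀` is real and `T₁` may be `+∞`. -/
def timeInterval (T₀ : ℝ) (T₁ : EReal) : Set ℝ := {t | T₀ ≤ t ∧ (t : EReal) < T₁}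

instance (T₀ : ℝ) (T₁ : EReal) : (timeInterval T₀ T₁).OrdConnected :=
  ⟨fun _ hx _ hy _ hz =>
    ⟨hx.1.trans hz.1, (EReal.coe_le_coe_iff.2 hz.2).trans_lt hy.2⟩⟩

/-- The type of times `t ∈ [T₀, T₁[`. A random time with values in `[T₀, T₁]` is a variable with
values in `WithTop (Time T₀ T₁)`, the point `⊤` being `T₁`. -/
abbrev Time (T₀ : ℝ) (T₁ : EReal) : Type := timeInterval T₀ T₁

/-- Lebesgue measure on `[T₀, T₁[`. -/
instance (T₀ : ℝ) (T₁ : EReal) : MeasureSpace (Time T₀ T₁) := Measure.Subtype.measureSpace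

/-- The least time `⊥` is `T₀`. -/
instance (T₀ : ℝ) (T₁ : EReal) [h : Fact ((T₀ : EReal) < T₁)] : OrderBot (Time T₀ T₁) where
  bot := ⟨T₀, le_rfl, h.out⟩
  bot_le t := t.2.1

/-- The extended state space `X ∪ {x_∞}` with the σ-algebra generated by that of `X` and the
isolated point `x_∞`. -/
abbrev Ext (X : Type*) := X ⊕ Unit

/-- The isolated point `x_∞`. -/
def xInfty {X : Type*} : Ext X := Sum.inr ()

/-! ### Processes: Markov processes, transition functions, jump processes -/

section Processes

variable {T₀ : ℝ} {T₁ : EReal} {X S Ω : Type*} [MeasurableSpace X] [MeasurableSpace S]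
  {mΩ : MeasurableSpace Ω}

/-- A function `p(u, x; t, B)`, considered for `u < t` and measurable `B`, is a transition function
if it takes values in `[0, 1]`, is a measure in `B`, is jointly measurable in `(u, x, t)` and
satisfies the Chapman-Kolmogorov equation. -/
structure IsTransitionFunction (p : Time T₀ T₁ → X → Time T₀ T₁ → Set X → ℝ≥0∞) : Prop where
  le_one : ∀ u x t, u < t → ∀ B, MeasurableSet B → p u x t B ≤ 1
  isMeasure : ∀ u x t, u < t → ∃ m : Measure X, ∀ B, MeasurableSet B → m B = p u x t B
  measurable : ∀ B, MeasurableSet B →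
    Measurable fun z : {z : Time T₀ T₁ × X × Time T₀ T₁ // z.1 < z.2.2} =>
      p z.1.1 z.1.2.1 z.1.2.2 B
  chapmanKolmogorov : ∀ u s t, u < s → s < t → ∀ x B, MeasurableSet B →
    ∀ m : Measure X, (∀ C, MeasurableSet C → m C = p u x s C) →
      p u x t B = ∫⁻ y, p s y t B ∂m

/-- The process `Y` is Markov on `(Ω, 𝓕, P)` with respect to the right-continuous filtration `F`. -/
structure IsMarkovProcess (P : Measure Ω) (F : Filtration (Time T₀ T₁) mΩ)
    (Y : Time T₀ T₁ → Ω → S) : Prop where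
  rightContinuous : F.IsRightContinuous
  adapted : Adapted F Y
  markov : ∀ u t, u < t → ∀ B, MeasurableSet B →
    P⟦Y t ⁻¹' B | F u⟧ =ᵐ[P] P⟦Y t ⁻¹' B | MeasurableSpace.comap (Y u) inferInstance⟧

/-- The process `Y` with values in `X ∪ {x_∞}` has the transition function `p` on `X`: almost surely
`P(Y t ∈ B | Y u) = p(u, Y u; t, B)` for measurable `B ⊆ X`, where `p(u, x_∞; t, B) := 0`. -/
structure HasTransitionFunction (P : Measure Ω) (Y : Time T₀ T₁ → Ω → Ext X)
    (p : Time T₀ T₁ → X → Time T₀ T₁ → Set X → ℝ≥0∞) : Prop where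
  isTransitionFunction : IsTransitionFunction p
  condProb_eq : ∀ u t, u < t → ∀ B : Set X, MeasurableSet B →
    P⟦Y t ⁻¹' (Sum.inl '' B) | MeasurableSpace.comap (Y u) inferInstance⟧ =ᵐ[P]
      fun ω => Sum.elim (fun x => (p u x t B).toReal) (fun _ => 0) (Y u ω)

variable [Fact ((T₀ : EReal) < T₁)]

/-- `(t n, x n)`, `n = 1, 2, …`, is a multivariate point process with respect to the right-continuous
filtration `F`. (The entries with index `0` are not used.) -/
structure IsMultivariatePointProcess (F : Filtration (Time T₀ T₁) mΩ)
    (t : ℕ → Ω → WithTop (Time T₀ T₁)) (x : ℕ → Ω → Ext X) : Prop where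
  rightContinuous : F.IsRightContinuous
  pos : ∀ n ≥ 1, ∀ ω, ((⊥ : Time T₀ T₁) : WithTop (Time T₀ T₁)) < t n ω
  measurable_mark : ∀ n ≥ 1, ∃ h : IsStoppingTime F (t n), Measurable[h.measurableSpace] (x n)
  of_lt_top : ∀ n ≥ 1, ∀ ω, t n ω < ⊤ → t n ω < t (n + 1) ω ∧ x n ω ∈ Set.range Sum.inl
  of_eq_top : ∀ n ≥ 1, ∀ ω, t n ω = ⊤ → x n ω = xInfty ∧ t (n + 1) ω = ⊤

/-- `Y` is the jump process of the sequences `t` and `x`: `Y s = x n` for `s ∈ [t n, t (n + 1)[`,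
and `Y s = x_∞` for `s ≥ lim t n` (that is, if `t n ≤ s` for all `n`), where `t 0 = T₀`, the variable
`x 0` has values in `X` and is measurable at time `T₀`, and the sequence `(t n, x n)`, `n ≥ 1`, is a
multivariate point process. -/
structure IsJumpProcess (F : Filtration (Time T₀ T₁) mΩ) (t : ℕ → Ω → WithTop (Time T₀ T₁))
    (x : ℕ → Ω → Ext X) (Y : Time T₀ T₁ → Ω → Ext X) : Prop where
  time_zero : ∀ ω, t 0 ω = ((⊥ : Time T₀ T₁) : WithTop (Time T₀ T₁))
  mark_zero : ∀ ω, x 0 ω ∈ Set.range Sum.inl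
  measurable_mark_zero : Measurable[F ⊥] (x 0)
  isMultivariatePointProcess : IsMultivariatePointProcess F t x
  eq_mark : ∀ (s : Time T₀ T₁) (ω : Ω) (n : ℕ), t n ω ≤ s → s < t (n + 1) ω → Y s ω = x n ω
  eq_xInfty : ∀ (s : Time T₀ T₁) (ω : Ω), (∀ n, t n ω ≤ s) → Y s ω = xInfty

/-- A jump Markov process is a Markov process which is also a jump process. -/
def IsJumpMarkovProcess (P : Measure Ω) (F : Filtration (Time T₀ T₁) mΩ)
    (t : ℕ → Ω → WithTop (Time T₀ T₁)) (x : ℕ → Ω → Ext X)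
    (Y : Time T₀ T₁ → Ω → Ext X) : Prop :=
  IsMarkovProcess P F Y ∧ IsJumpProcess F t x Y

/-! ### Compensators of random measures -/

/-- The random measure `ν` on `[T₀, T₁[ × X` is predictable: for every measurable `B ⊆ X` the
process `t ↦ ν([T₀, t] × B)` is predictable. -/
def IsPredictableRandomMeasure (F : Filtration (Time T₀ T₁) mΩ)
    (ν : Ω → Measure (Time T₀ T₁ × X)) : Prop :=
  ∀ B, MeasurableSet B →
    Measurable[F.predictable] fun z : Time T₀ T₁ × Ω => ν z.2 (Set.Iic z.1 ×ˢ B)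

/-- `ν` is the compensator (dual predictable projection) of the random measure `μ` under `P`:
it is predictable, and `E ∫ W dμ = E ∫ W dν` for every non-negative predictable function
`W(t, ω, x)`. -/
structure IsCompensator (P : Measure Ω) (F : Filtration (Time T₀ T₁) mΩ)
    (μ ν : Ω → Measure (Time T₀ T₁ × X)) : Prop where
  predictable : IsPredictableRandomMeasure F ν
  lintegral_eq : ∀ W : (Time T₀ T₁ × Ω) × X → ℝ≥0∞,
    Measurable[F.predictable.prod inferInstance] W →
      ∫⁻ ω, ∫⁻ z, W ((z.1, ω), z.2) ∂(μ ω) ∂P = ∫⁻ ω, ∫⁻ z, W ((z.1, ω), z.2) ∂(ν ω) ∂P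

end Processes

/-! ### Q-functions -/

/-- A Q-function `q(x, t, B)`. -/
structure QFunction (X : Type*) [MeasurableSpace X] (T₀ : ℝ) (T₁ : EReal) where
  toFun : X → Time T₀ T₁ → SignedMeasure X
  total_nonpos : ∀ x t, toFun x t Set.univ ≤ 0
  offDiag_nonneg : ∀ x t B, MeasurableSet B → 0 ≤ toFun x t (B \ {x})
  measurable : ∀ B, MeasurableSet B → Measurable fun z : X × Time T₀ T₁ => toFun z.1 z.2 B

namespace QFunction

variable {X : Type*} [MeasurableSpace X] {T₀ : ℝ} {T₁ : EReal} (q : QFunction X T₀ T₁)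

/-- A Q-function is conservative if `q(x, t, X) = 0`. -/
def IsConservative : Prop := ∀ x t, q.toFun x t Set.univ = 0

/-- The jump rate `q(x, t) := q(x, t, X \ {x})`. -/
def rate (x : X) (t : Time T₀ T₁) : ℝ := q.toFun x t (Set.univ \ {x})

/-- Locally integrable jump rates: `∫_{T₀}^s q(x, t) dt < ∞` for all `x ∈ X`, `s ∈ ]T₀, T₁[`. -/
def HasLocallyIntegrableRates : Prop :=
  ∀ (x : X) (s : Time T₀ T₁), IntegrableOn (fun t => q.rate x t) (Set.Iic s)

variable [MeasurableSingletonClass X]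

theorem zero_le_restrict (x : X) (t : Time T₀ T₁) :
    VectorMeasure.restrict 0 {x}ᶜ ≤ VectorMeasure.restrict (q.toFun x t) {x}ᶜ := by
  intro B hB
  rw [VectorMeasure.restrict_apply _ (measurableSet_singleton x).compl hB,
    VectorMeasure.restrict_apply _ (measurableSet_singleton x).compl hB]
  simpa [Set.sdiff_eq] using q.offDiag_nonneg x t B hB

/-- The measure `q⁺(x, t, B) := q(x, t, B \ {x})` on `X`. -/
def jumpMeasure (x : X) (t : Time T₀ T₁) : Measure X :=
  (q.toFun x t).toMeasureOfZeroLE {x}ᶜ (measurableSet_singleton x).compl (q.zero_le_restrict x t)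

theorem jumpMeasure_apply (x : X) (t : Time T₀ T₁) {B : Set X} (hB : MeasurableSet B) :
    q.jumpMeasure x t B = ENNReal.ofReal (q.toFun x t (B \ {x})) := by
  have h : {x}ᶜ ∩ B = B \ {x} := by ext y; simp [and_comm]
  rw [jumpMeasure, SignedMeasure.toMeasureOfZeroLE_apply _ _ _ hB,
    ENNReal.ofReal_eq_coe_nnreal (q.offDiag_nonneg x t B hB)]
  simp only [h]

theorem measurable_jumpMeasure (x : X) : Measurable (q.jumpMeasure x) := by
  refine Measure.measurable_of_measurable_coe _ fun B hB => ?_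
  simp only [q.jumpMeasure_apply x _ hB]
  exact ((q.measurable _ (hB.diff (measurableSet_singleton x))).comp
    measurable_prodMk_left).ennreal_ofReal

theorem measurable_map_jumpMeasure (x : X) :
    Measurable fun s : Time T₀ T₁ => (q.jumpMeasure x s).map (Prod.mk s) := by
  refine Measure.measurable_of_measurable_coe _ fun C hC => ?_
  have hf : ∀ s, IsFiniteMeasure (q.jumpMeasure x s) := fun s => by
    unfold QFunction.jumpMeasure; infer_instance
  have key : ∀ B, MeasurableSet B → Measurable fun s => q.jumpMeasure x s B := fun B hB =>
    (Measure.measurable_coe hB).comp (q.measurable_jumpMeasure x)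
  induction C, hC using MeasurableSpace.induction_on_inter
    generateFrom_prod.symm isPiSystem_prod with
  | empty => simp
  | basic C hC =>
    obtain ⟨A, hA, B, hB, rfl⟩ := hC
    have : ∀ s, ((q.jumpMeasure x s).map (Prod.mk s)) (A ×ˢ B) = A.indicator (fun s => q.jumpMeasure x s B) s := by
      intro s
      rw [Measure.map_apply measurable_prodMk_left (MeasurableSet.prod (show MeasurableSet A from hA) hB)]
      by_cases h : s ∈ A <;> simp [h, Set.mk_preimage_prod_right, Set.mk_preimage_prod_right_eq_empty]
    simp_rw [this]
    exact (key B hB).indicator hA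
  | compl C hC ih =>
    have : ∀ s, ((q.jumpMeasure x s).map (Prod.mk s)) Cᶜ = q.jumpMeasure x s Set.univ - ((q.jumpMeasure x s).map (Prod.mk s)) C := by
      intro s
      rw [measure_compl hC (measure_ne_top _ _), Measure.map_apply measurable_prodMk_left MeasurableSet.univ]; simp
    simp_rw [this]
    exact (key _ MeasurableSet.univ).sub ih
  | iUnion f hd hm ih =>
    simp_rw [measure_iUnion hd hm]
    exact Measurable.tsum ih

/-- Feller's functions `P̄⁽ⁿ⁾(u, x; t, B)`. -/
def fellerTerm : ℕ → Time T₀ T₁ → X → Time T₀ T₁ → Set X → ℝ≥0∞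
  | 0, u, x, t, B =>
      B.indicator 1 x * ENNReal.ofReal (Real.exp (-∫ s in Set.Ioc u t, q.rate x s))
  | n + 1, u, x, t, B =>
      ∫⁻ w in Set.Ioo u t, ∫⁻ y,
        ENNReal.ofReal (Real.exp (-∫ s in Set.Ioc u w, q.rate x s)) * fellerTerm n w y t B
          ∂(q.jumpMeasure x w)

/-- Feller's function `P̄(u, x; t, B) := ∑ₙ P̄⁽ⁿ⁾(u, x; t, B)`. -/
def feller (u : Time T₀ T₁) (x : X) (t : Time T₀ T₁) (B : Set X) : ℝ≥0∞ :=
  ∑' n, q.fellerTerm n u x t B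

end QFunction

/-! ### The canonical multivariate point process and its jump process -/

section Canonical

variable (X : Type*) [MeasurableSpace X] (T₀ : ℝ) (T₁ : EReal) [Fact ((T₀ : EReal) < T₁)]

/-- The set of sequences `ω = (x₀, t₁, x₁, t₂, …)` with `x₀ ∈ X`, with `t_n ∈ ]T₀, T₁]` for
`n ≥ 1`, and such that for `n ≥ 1`, if `t_n < T₁`, then `t_n < t_{n+1}` and `x_n ∈ X`, and if
`t_n = T₁`, then `t_{n+1} = T₁` and `x_n = x_∞`. The `n`-th entry of the sequence is
`(x_n, t_{n+1})`. -/
def sampleSet : Set (ℕ → Ext X × WithTop (Time T₀ T₁)) :=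
  {ω | (ω 0).1 ∈ Set.range Sum.inl ∧
    ∀ n, ((⊥ : Time T₀ T₁) : WithTop (Time T₀ T₁)) < (ω n).2 ∧
      ((ω n).2 < ⊤ → (ω n).2 < (ω (n + 1)).2 ∧ (ω (n + 1)).1 ∈ Set.range Sum.inl) ∧
      ((ω n).2 = ⊤ → (ω (n + 1)).2 = ⊤ ∧ (ω (n + 1)).1 = xInfty)}

/-- The canonical sample space, with the σ-algebra induced by the product σ-algebra. -/
abbrev Sample : Type _ := sampleSet X T₀ T₁

variable {X T₀ T₁}

/-- The coordinate `x_n`, `n ≥ 0`. -/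
def state (n : ℕ) (ω : Sample X T₀ T₁) : Ext X := (ω.1 n).1

/-- The time `t_n`, `n ≥ 0`, with `t_0 = T₀`. -/
def jumpTime : ℕ → Sample X T₀ T₁ → WithTop (Time T₀ T₁)
  | 0, _ => ((⊥ : Time T₀ T₁) : WithTop (Time T₀ T₁))
  | n + 1, ω => (ω.1 n).2

theorem measurable_state (n : ℕ) : Measurable (state n : Sample X T₀ T₁ → Ext X) :=
  measurable_fst.comp ((measurable_pi_apply n).comp measurable_subtype_coe)

theorem measurable_jumpTime (n : ℕ) :
    Measurable (jumpTime n : Sample X T₀ T₁ → WithTop (Time T₀ T₁)) := by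
  cases n with
  | zero => exact measurable_const
  | succ n => exact measurable_snd.comp ((measurable_pi_apply n).comp measurable_subtype_coe)

/-- The filtration `𝓕_t = σ(x₀) ∨ 𝓖_t`, where `𝓖_t` is generated by the events
`{x_n ∈ B, t_n ≤ s}` with `n ≥ 1`, `s ≤ t` and measurable `B ⊆ X`. -/
def canonicalFiltration :
    Filtration (Time T₀ T₁) (inferInstance : MeasurableSpace (Sample X T₀ T₁)) where
  seq t := MeasurableSpace.comap (state 0) inferInstance ⊔
    MeasurableSpace.generateFrom
      {A | ∃ n ≥ 1, ∃ s ≤ t, ∃ B : Set X, MeasurableSet B ∧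
        A = {ω | state n ω ∈ Sum.inl '' B ∧ jumpTime n ω ≤ s}}
  mono' s t hst := by
    refine sup_le_sup le_rfl (MeasurableSpace.generateFrom_mono ?_)
    rintro A ⟨n, hn, r, hr, B, hB, rfl⟩
    exact ⟨n, hn, r, hr.trans hst, B, hB, rfl⟩
  le' t := by
    refine sup_le (measurable_state 0).comap_le (MeasurableSpace.generateFrom_le ?_)
    rintro A ⟨n, -, s, -, B, hB, rfl⟩
    exact (measurable_state n hB.inl_image).inter (measurable_jumpTime n measurableSet_Iic)

open scoped Classical in
/-- The jump process: `x_n` on `[t_n, t_{n+1}[`, and `x_∞` from the time `t_∞ = lim t_n` on. -/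
def jumpProcess (s : Time T₀ T₁) (ω : Sample X T₀ T₁) : Ext X :=
  if h : ∃ n, jumpTime n ω ≤ s ∧ s < jumpTime (n + 1) ω then state (Nat.find h) ω else xInfty

open scoped Classical in
/-- The random measure `∑_{n ≥ 1} 1{t_n < T₁} δ_{(t_n, x_n)}` of the multivariate point process. -/
def pointMeasure (ω : Sample X T₀ T₁) : Measure (Time T₀ T₁ × X) :=
  Measure.sum fun n : ℕ =>
    if h : jumpTime (n + 1) ω = ⊤ then 0
    else Sum.elim (fun y => Measure.dirac ((jumpTime (n + 1) ω).untop h, y)) (fun _ => 0)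
      (state (n + 1) ω)

variable [MeasurableSingletonClass X]

/-- The random measure `ν(ω; ds, dy) = ∑_{n ≥ 0} 1{t_n < s ≤ t_{n+1}} q(x_n, s, dy \ {x_n}) ds`. -/
def compensator (q : QFunction X T₀ T₁) (ω : Sample X T₀ T₁) : Measure (Time T₀ T₁ × X) :=
  Measure.sum fun n : ℕ =>
    Sum.elim
      (fun x => (volume.restrict
          {s : Time T₀ T₁ | jumpTime n ω < s ∧ s ≤ jumpTime (n + 1) ω}).bind
        fun s => (q.jumpMeasure x s).map (Prod.mk s))
      (fun _ => 0) (state n ω)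

/-- The defining formula for `ν(ω; [T₀, t], B)`. -/
theorem compensator_Iic_prod (q : QFunction X T₀ T₁) (ω : Sample X T₀ T₁) (t : Time T₀ T₁) (B : Set X)
    (hB : MeasurableSet B) :
    compensator q ω (Set.Iic t ×ˢ B) = ∑' n, Sum.elim
      (fun x => ∫⁻ s in Set.Iic t,
        Set.indicator {s : Time T₀ T₁ | jumpTime n ω < s ∧ s ≤ jumpTime (n + 1) ω}
          (fun s => q.jumpMeasure x s B) s)
      (fun _ => 0) (state n ω) := by
  have hm : MeasurableSet (Set.Iic t ×ˢ B) := measurableSet_Iic.prod hB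
  rw [compensator, Measure.sum_apply _ hm]
  congr 1; ext n
  have hS : MeasurableSet {s : Time T₀ T₁ | jumpTime n ω < s ∧ s ≤ jumpTime (n + 1) ω} := 
    (WithTop.measurable_coe measurableSet_Ioi).inter (WithTop.measurable_coe measurableSet_Iic)
  cases h : state n ω with
  | inr _ => simp
  | inl x =>
    simp only [Sum.elim_inl]
    rw [Measure.bind_apply hm (q.measurable_map_jumpMeasure x).aemeasurable, ← lintegral_indicator hS]
    rw [← lintegral_indicator measurableSet_Iic]
    congr 1; ext s
    by_cases h2 : s ∈ {s : Time T₀ T₁ | jumpTime n ω < s ∧ s ≤ jumpTime (n + 1) ω}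
    · by_cases h1 : s ∈ Set.Iic t
      · rw [Set.indicator_of_mem h2, Set.indicator_of_mem h1, Set.indicator_of_mem h2, Measure.map_apply measurable_prodMk_left hm, Set.mk_preimage_prod_right h1]
      · rw [Set.indicator_of_mem h2, Set.indicator_of_notMem h1, Measure.map_apply measurable_prodMk_left hm, Set.mk_preimage_prod_right_eq_empty h1, measure_empty]
    · rw [Set.indicator_of_notMem h2]
      by_cases h1 : s ∈ Set.Iic t
      · rw [Set.indicator_of_mem h1, Set.indicator_of_notMem h2]
      · rw [Set.indicator_of_notMem h1]

/-- `P` is a probability measure on the canonical space such that `x₀` has the law `γ` and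
`compensator q` is the compensator of the random measure of the multivariate point process. -/
structure IsCanonicalLaw (q : QFunction X T₀ T₁) (γ : Measure X)
    (P : Measure (Sample X T₀ T₁)) : Prop where
  isProbabilityMeasure : IsProbabilityMeasure P
  initial : ∀ B, MeasurableSet B → P {ω | state 0 ω ∈ Sum.inl '' B} = γ B
  isCompensator : IsCompensator P canonicalFiltration pointMeasure (compensator q)

end Canonical

end

end JumpMarkov

/-! ### The fundamental theorem of calculus for exponentials of integrals -/

/-! A path is determined by its marks `(t_n, x_n)`, so a law on paths is determined by the law of
`x_0` and the conditional law of each mark given the history `truncate n`. The proof shows that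
prescribing the compensator is the same as prescribing these conditional laws: given the history,
the next jump has the subprobability law `nextJump`, with density `exp(-∫_{t_n}^s q(x_n, θ) dθ)
q(x_n, s, dy) ds`, and the missing mass is the probability that no further jump occurs before `T₁`.

The bridge is a description of predictability. A jointly measurable function of `(s, ω)` is
predictable exactly when it depends on `ω` only through `stopBefore s ω`
(`predictable_apply_stopBefore`, `measurable_predictable_of_stopBefore`). On `]t_n, t_{n+1}]` that
stopped path is `truncate n ω`, so the compensator identity splits into one identity for each `n`,
`HasIntensity`. It still involves the unknown time `t_{n+1}`, through the integral over the waiting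
interval. Testing it with the function `s ↦ exp(-∫_s^t q(x_n, θ) dθ)` on times before `t` makes that
integral telescope path by path, and this gives the conditional probability that the next jump is
not before `t` (`HasIntensity.hasSurvival_Iio`), with no integral equation to solve. By Tonelli the
random waiting interval can then be replaced by its conditional survival probability, which turns
`HasIntensity` into `HasJumpLaw` and back (`hasIntensity_iff_hasJumpLaw`).

Uniqueness follows by induction on the number of marks (`HasJumpLaw.ext`). For existence, the
Ionescu-Tulcea construction is applied to the Markov chain of marks (`exists_hasJumpLaw`).

For the Markov property, Feller's recursion is read as conditioning on the first jump. Given the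
state `x` at time `u`, the term with index `k` is the probability of exactly `k` jumps in `]u, t]`
and a final state in `B`. The exponential form of the survival probability allows a restart at `u`
even though the last jump happened earlier (`QFunction.setLIntegral_nextJump_Ioi`,
`HasJumpLaw.lintegral_alive_mul_alive_add`). Summing over the number of jumps up to `u` and the
number between `u` and `t` gives the conditional probabilities given `𝓕_u` as a function of the
present state; exploded paths contribute nothing. The Chapman-Kolmogorov equation comes from the
same splitting of the jumps at an intermediate time (`QFunction.chapmanKolmogorov_fellerTerm`). -/

theorem AbsolutelyContinuousOnInterval.lipschitzOnWith_comp {f φ : ℝ → ℝ} {a b : ℝ} {s : Set ℝ}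
    {K : NNReal} (hf : AbsolutelyContinuousOnInterval f a b) (hφ : LipschitzOnWith K φ s)
    (hs : Set.MapsTo f (Set.uIcc a b) s) : AbsolutelyContinuousOnInterval (φ ∘ f) a b := by
  rw [absolutelyContinuousOnInterval_iff] at hf ⊢
  intro ε hε
  obtain ⟨δ, hδ, h⟩ := hf (ε / (K + 1)) (by positivity)
  refine ⟨δ, hδ, fun E hE hEδ => ?_⟩
  calc ∑ i ∈ Finset.range E.1, dist ((φ ∘ f) (E.2 i).1) ((φ ∘ f) (E.2 i).2)
      ≤ ∑ i ∈ Finset.range E.1, K * dist (f (E.2 i).1) (f (E.2 i).2) :=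
        Finset.sum_le_sum fun i hi =>
          hφ.dist_le_mul _ (hs (hE.1 i hi).1) _ (hs (hE.1 i hi).2)
    _ = K * ∑ i ∈ Finset.range E.1, dist (f (E.2 i).1) (f (E.2 i).2) := by rw [Finset.mul_sum]
    _ ≤ K * (ε / (K + 1)) := by gcongr; exact (h E hE hEδ).le
    _ < ε := by
      rw [← mul_div_assoc, div_lt_iff₀ (by positivity)]
      nlinarith [K.coe_nonneg]

/-- The rate is only integrable, so the integrand need not be a derivative everywhere. The primitive
of `f` is absolutely continuous with bounded range, `exp` is Lipschitz on that range, hence the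
composition is absolutely continuous and is the integral of its almost everywhere derivative. -/
theorem intervalIntegral_mul_exp_integral {f : ℝ → ℝ} {a b : ℝ}
    (hf : IntervalIntegrable f volume a b) (c : ℝ) :
    IntervalIntegrable (fun x => c * f x * Real.exp (c * ∫ t in a..x, f t)) volume a b ∧
    ∫ x in a..b, c * f x * Real.exp (c * ∫ t in a..x, f t) =
      Real.exp (c * ∫ t in a..b, f t) - 1 := by
  have hg : AbsolutelyContinuousOnInterval (fun x => c * ∫ t in a..x, f t) a b :=
    (hf.absolutelyContinuousOnInterval_intervalIntegral (c := a) (by simp)).const_mul c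
  obtain ⟨C, hC⟩ := hg.exists_bound
  obtain ⟨K, hK⟩ := (Real.contDiff_exp (n := 1)).contDiffOn.exists_lipschitzOnWith (by simp)
    (convex_Icc (-C) C) isCompact_Icc
  have hE := hg.lipschitzOnWith_comp hK fun x hx => abs_le.1 (hC x hx)
  constructor
  · exact (hf.const_mul c).mul_continuousOn hE.continuousOn
  have h := hE.integral_deriv_eq_sub
  simp only [Function.comp_apply, intervalIntegral.integral_same, mul_zero, Real.exp_zero] at h
  rw [← h]
  apply intervalIntegral.integral_congr_ae
  filter_upwards [hf.ae_hasDerivAt_integral] with x hx hxab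
  have := ((hx (Set.uIoc_subset_uIcc hxab) a (by simp)).const_mul c).exp
  rw [show Real.exp ∘ (fun x => c * ∫ t in a..x, f t) =
    fun x => Real.exp (c * ∫ t in a..x, f t) from rfl, this.deriv]
  ring

namespace JumpMarkov

noncomputable section

/-! ### The time axis -/

section Time

variable {T₀ : ℝ} {T₁ : EReal}

theorem measurableSet_timeInterval (T₀ : ℝ) (T₁ : EReal) : MeasurableSet (timeInterval T₀ T₁) :=
  Set.OrdConnected.measurableSet inferInstance

theorem measurableEmbedding_coe_time :
    MeasurableEmbedding (Subtype.val : Time T₀ T₁ → ℝ) :=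
  MeasurableEmbedding.subtype_coe (measurableSet_timeInterval T₀ T₁)

theorem map_coe_volume_time :
    (volume : Measure (Time T₀ T₁)).map Subtype.val = volume.restrict (timeInterval T₀ T₁) :=
  map_comap_subtype_coe (measurableSet_timeInterval T₀ T₁) volume

instance : SigmaFinite (volume : Measure (Time T₀ T₁)) :=
  SigmaFinite.of_map _ measurable_subtype_coe.aemeasurable
    (by rw [map_coe_volume_time]; infer_instance)

instance : NullSingletonClass (volume : Measure (Time T₀ T₁)) := by
  refine ⟨fun t => ?_⟩
  have := measurableEmbedding_coe_time.map_apply (volume : Measure (Time T₀ T₁)) {(t : ℝ)}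
  rw [map_coe_volume_time] at this
  rw [show ({t} : Set (Time T₀ T₁)) = Subtype.val ⁻¹' {(t : ℝ)} by ext; simp [Subtype.ext_iff],
    ← this]
  simp

instance : NoMaxOrder (Time T₀ T₁) := by
  refine ⟨fun t => ?_⟩
  obtain ⟨r, hr, hr'⟩ := EReal.lt_iff_exists_real_btwn.1 t.2.2
  have h : (t : ℝ) < r := EReal.coe_lt_coe_iff.1 hr
  exact ⟨⟨r, t.2.1.trans h.le, hr'⟩, h⟩

theorem coe_image_Ioc (u t : Time T₀ T₁) :
    Set.Ioc (u : ℝ) t ⊆ timeInterval T₀ T₁ := fun _ hx =>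
  Set.OrdConnected.out (inferInstance : (timeInterval T₀ T₁).OrdConnected) u.2 t.2
    ⟨hx.1.le, hx.2⟩

theorem map_coe_restrict_Ioc (u t : Time T₀ T₁) :
    ((volume : Measure (Time T₀ T₁)).restrict (Set.Ioc u t)).map Subtype.val =
      volume.restrict (Set.Ioc (u : ℝ) t) := by
  rw [show Set.Ioc u t = Subtype.val ⁻¹' (Set.Ioc (u : ℝ) t) from rfl,
    ← measurableEmbedding_coe_time.restrict_map, map_coe_volume_time,
    Measure.restrict_restrict measurableSet_Ioc, Set.inter_eq_left.2 (coe_image_Ioc u t)]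

theorem setIntegral_Ioc_eq_intervalIntegral (f : ℝ → ℝ) {u t : Time T₀ T₁} (hut : u ≤ t) :
    ∫ s in Set.Ioc u t, f s = ∫ s in (u : ℝ)..t, f s := by
  rw [intervalIntegral.integral_of_le hut, ← map_coe_restrict_Ioc,
    measurableEmbedding_coe_time.integral_map]

theorem integral_mul_exp_integral_time {f : Time T₀ T₁ → ℝ} {u t : Time T₀ T₁} (hut : u ≤ t)
    (hf : IntegrableOn f (Set.Ioc u t)) (c : ℝ) :
    IntegrableOn (fun s => c * f s * Real.exp (c * ∫ r in Set.Ioc u s, f r)) (Set.Ioc u t) ∧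
    ∫ s in Set.Ioc u t, c * f s * Real.exp (c * ∫ r in Set.Ioc u s, f r) =
      Real.exp (c * ∫ r in Set.Ioc u t, f r) - 1 := by
  -- The interval integrals live on `ℝ`. The value `0` outside the time axis is never seen, because
  -- `]u, t]` lies in the time axis.
  set F : ℝ → ℝ := Function.extend Subtype.val f 0 with hF
  have hFf : ∀ s : Time T₀ T₁, F s = f s := fun s => Subtype.val_injective.extend_apply f 0 s
  have h1 : ∀ s, u ≤ s → ∫ r in Set.Ioc u s, f r = ∫ r in (u : ℝ)..s, F r := fun s hs => by
    rw [← setIntegral_Ioc_eq_intervalIntegral F hs]; simp [hFf]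
  have hFi : IntervalIntegrable F volume u t := by
    rw [intervalIntegrable_iff_integrableOn_Ioc_of_le hut, IntegrableOn, ← map_coe_restrict_Ioc,
      measurableEmbedding_coe_time.integrable_map_iff]
    exact hf.congr (Filter.Eventually.of_forall fun s => (hFf s).symm)
  obtain ⟨hi, he⟩ := intervalIntegral_mul_exp_integral hFi c
  have hcongr : Set.EqOn (fun s : Time T₀ T₁ => c * F s * Real.exp (c * ∫ r in (u : ℝ)..s, F r))
      (fun s => c * f s * Real.exp (c * ∫ r in Set.Ioc u s, f r)) (Set.Ioc u t) := fun s hs => by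
    simp only [hFf, h1 s hs.1.le]
  constructor
  · rw [intervalIntegrable_iff_integrableOn_Ioc_of_le hut, IntegrableOn, ← map_coe_restrict_Ioc,
      measurableEmbedding_coe_time.integrable_map_iff] at hi
    exact IntegrableOn.congr_fun hi hcongr measurableSet_Ioc
  · rw [h1 t hut, ← he, ← setIntegral_Ioc_eq_intervalIntegral _ hut]
    exact (setIntegral_congr_fun measurableSet_Ioc hcongr).symm

/-- For a rate `f`, the exponential density `exp(-∫_u^s f) f(s)` integrates to
`1 - exp(-∫_u^t f)` over `]u, t]`. -/
theorem lintegral_exp_neg_integral {f : Time T₀ T₁ → ℝ} (hf0 : ∀ s, 0 ≤ f s) {u t : Time T₀ T₁}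
    (hut : u ≤ t) (hf : IntegrableOn f (Set.Ioc u t)) :
    (∫⁻ s in Set.Ioc u t,
      ENNReal.ofReal (Real.exp (-∫ r in Set.Ioc u s, f r)) * ENNReal.ofReal (f s)) +
      ENNReal.ofReal (Real.exp (-∫ r in Set.Ioc u t, f r)) = 1 := by
  obtain ⟨hi, he⟩ := integral_mul_exp_integral_time hut hf (-1)
  have hi' := hi.neg
  have h0 : ∀ s, 0 ≤ f s * Real.exp (-∫ r in Set.Ioc u s, f r) := fun s =>
    mul_nonneg (hf0 s) (Real.exp_pos _).le
  have he' : ∫ s in Set.Ioc u t, f s * Real.exp (-∫ r in Set.Ioc u s, f r) =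
      1 - Real.exp (-∫ r in Set.Ioc u t, f r) := by
    simp only [neg_mul, one_mul, integral_neg] at he
    linarith
  have hi'' : IntegrableOn (fun s => f s * Real.exp (-∫ r in Set.Ioc u s, f r)) (Set.Ioc u t) := by
    refine hi'.congr (Filter.Eventually.of_forall fun s => ?_)
    simp
  have : ∫⁻ s in Set.Ioc u t,
      ENNReal.ofReal (Real.exp (-∫ r in Set.Ioc u s, f r)) * ENNReal.ofReal (f s) =
      ENNReal.ofReal (1 - Real.exp (-∫ r in Set.Ioc u t, f r)) := by
    rw [← he', ofReal_integral_eq_lintegral_ofReal hi'' (Filter.Eventually.of_forall h0)]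
    refine lintegral_congr fun s => ?_
    rw [mul_comm, ENNReal.ofReal_mul (hf0 s)]
  rw [this, ← ENNReal.ofReal_add _ (Real.exp_pos _).le]
  · simp
  · rw [← he']
    exact setIntegral_nonneg measurableSet_Ioc fun s _ => h0 s

theorem setIntegral_Ioc_add {f : Time T₀ T₁ → ℝ} {a b c : Time T₀ T₁} (hab : a ≤ b) (hbc : b ≤ c)
    (hf : IntegrableOn f (Set.Ioc a c)) :
    ∫ r in Set.Ioc a c, f r = (∫ r in Set.Ioc a b, f r) + ∫ r in Set.Ioc b c, f r := by
  rw [← Set.Ioc_union_Ioc_eq_Ioc hab hbc]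
  rw [← Set.Ioc_union_Ioc_eq_Ioc hab hbc] at hf
  exact setIntegral_union (Set.Ioc_disjoint_Ioc_of_le le_rfl) measurableSet_Ioc
    (hf.mono_set Set.subset_union_left) (hf.mono_set Set.subset_union_right)

/-- The backward version of `lintegral_exp_neg_integral`. -/
theorem lintegral_exp_neg_integral_backward {f : Time T₀ T₁ → ℝ} (hf0 : ∀ s, 0 ≤ f s)
    {a b t : Time T₀ T₁} (hab : a ≤ b) (hbt : b ≤ t) (hf : IntegrableOn f (Set.Ioc a t)) :
    (∫⁻ s in Set.Ioc a b,
      ENNReal.ofReal (Real.exp (-∫ r in Set.Ioc s t, f r)) * ENNReal.ofReal (f s)) +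
      ENNReal.ofReal (Real.exp (-∫ r in Set.Ioc a t, f r)) =
      ENNReal.ofReal (Real.exp (-∫ r in Set.Ioc b t, f r)) := by
  have hfab := hf.mono_set (Set.Ioc_subset_Ioc_right hbt : Set.Ioc a b ⊆ Set.Ioc a t)
  obtain ⟨hi, he⟩ := integral_mul_exp_integral_time hab hfab 1
  simp only [one_mul] at hi he
  -- Writing `∫_s^t` as `∫_a^t - ∫_a^s` puts the variable at the upper limit, so that the forward
  -- formula with `c = 1` applies; the factor `exp(-∫_a^t f)` is constant in `s`.
  have hsplit : ∀ s ∈ Set.Icc a b, Real.exp (-∫ r in Set.Ioc s t, f r) =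
      Real.exp (∫ r in Set.Ioc a s, f r) * Real.exp (-∫ r in Set.Ioc a t, f r) := fun s hs => by
    rw [setIntegral_Ioc_add hs.1 (hs.2.trans hbt) hf, ← Real.exp_add]; congr 1; ring
  have h0 : ∀ s, 0 ≤ f s * Real.exp (∫ r in Set.Ioc a s, f r) := fun s =>
    mul_nonneg (hf0 s) (Real.exp_pos _).le
  have : ∫⁻ s in Set.Ioc a b,
      ENNReal.ofReal (Real.exp (-∫ r in Set.Ioc s t, f r)) * ENNReal.ofReal (f s) =
      ENNReal.ofReal (Real.exp (∫ r in Set.Ioc a b, f r) - 1) *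
        ENNReal.ofReal (Real.exp (-∫ r in Set.Ioc a t, f r)) := by
    rw [← he, ofReal_integral_eq_lintegral_ofReal hi (Filter.Eventually.of_forall h0),
      ← lintegral_mul_const' _ _ ENNReal.ofReal_ne_top]
    refine setLIntegral_congr_fun measurableSet_Ioc fun s hs => ?_
    rw [hsplit s ⟨hs.1.le, hs.2⟩, ← ENNReal.ofReal_mul (h0 s),
      ← ENNReal.ofReal_mul (by positivity)]
    congr 1; ring
  have h1 : 0 ≤ Real.exp (∫ r in Set.Ioc a b, f r) - 1 := by
    rw [← he]
    exact setIntegral_nonneg measurableSet_Ioc fun s _ => h0 s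
  rw [this, ← ENNReal.ofReal_mul h1, ← ENNReal.ofReal_add (by positivity) (Real.exp_pos _).le,
    hsplit b ⟨hab, le_rfl⟩]
  congr 1; ring

end Time

namespace QFunction

variable {X : Type*} [MeasurableSpace X] {T₀ : ℝ} {T₁ : EReal} (q : QFunction X T₀ T₁)

/-! ### The jump kernel -/

theorem rate_nonneg (x : X) (t : Time T₀ T₁) : 0 ≤ q.rate x t :=
  q.offDiag_nonneg x t _ MeasurableSet.univ

/-- Measurability of `q` is assumed for a fixed set only, while the sets `B \ {x}` move with `x`.
They are the sections of a measurable subset of `X × X`, to which a π-λ argument applies. Since the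
values are signed, complements are handled by subtraction and unions by limits of partial sums. -/
theorem measurable_toFun_section {C : Set (X × X)} (hC : MeasurableSet C) :
    Measurable fun z : X × Time T₀ T₁ => q.toFun z.1 z.2 (Prod.mk z.1 ⁻¹' C) := by
  induction C, hC using MeasurableSpace.induction_on_inter
    generateFrom_prod.symm isPiSystem_prod with
  | empty => simp
  | basic C hC =>
    obtain ⟨A, hA, B, hB, rfl⟩ := hC
    have : ∀ z : X × Time T₀ T₁, q.toFun z.1 z.2 (Prod.mk z.1 ⁻¹' (A ×ˢ B)) =
        Set.indicator (Prod.fst ⁻¹' A) (fun z => q.toFun z.1 z.2 B) z := fun z => by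
      by_cases h : z.1 ∈ A <;> simp [h, Set.indicator, Set.mk_preimage_prod_right,
        Set.mk_preimage_prod_right_eq_empty]
    simp_rw [this]
    exact (q.measurable B hB).indicator (measurable_fst hA)
  | compl C hC ih =>
    have : ∀ z : X × Time T₀ T₁, q.toFun z.1 z.2 (Prod.mk z.1 ⁻¹' Cᶜ) =
        q.toFun z.1 z.2 Set.univ - q.toFun z.1 z.2 (Prod.mk z.1 ⁻¹' C) := fun z => by
      have := (q.toFun z.1 z.2).of_add_of_sdiff (measurable_prodMk_left hC) MeasurableSet.univ
        (Set.subset_univ (Prod.mk z.1 ⁻¹' C))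
      rw [Set.preimage_compl, Set.compl_eq_univ_sdiff, ← this]
      ring
    simp_rw [this]
    exact (q.measurable _ MeasurableSet.univ).sub ih
  | iUnion f hd hm ih =>
    have : ∀ z : X × Time T₀ T₁, HasSum (fun i => q.toFun z.1 z.2 (Prod.mk z.1 ⁻¹' f i))
        (q.toFun z.1 z.2 (Prod.mk z.1 ⁻¹' ⋃ i, f i)) := fun z => by
      rw [Set.preimage_iUnion]
      exact (q.toFun z.1 z.2).m_iUnion (fun i => measurable_prodMk_left (hm i))
        fun i j hij => (hd hij).preimage _
    refine measurable_of_tendsto_metrizable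
      (f := fun n z => ∑ i ∈ Finset.range n, q.toFun z.1 z.2 (Prod.mk z.1 ⁻¹' f i))
      (fun n => Finset.measurable_fun_sum _ fun i _ => ih i) ?_
    rw [tendsto_pi_nhds]
    exact fun z => (this z).tendsto_sum_nat

section

variable [StandardBorelSpace X]

theorem measurable_toFun_diff {B : Set X} (hB : MeasurableSet B) :
    Measurable fun z : X × Time T₀ T₁ => q.toFun z.1 z.2 (B \ {z.1}) := by
  have hC : MeasurableSet ((Prod.snd ⁻¹' B) \ {p : X × X | p.1 = p.2}) :=
    (measurable_snd hB).diff (measurableSet_eq_fun measurable_fst measurable_snd)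
  convert! q.measurable_toFun_section hC using 3 with z
  ext y
  simp [eq_comm]

theorem measurable_rate : Measurable fun z : X × Time T₀ T₁ => q.rate z.1 z.2 :=
  q.measurable_toFun_diff MeasurableSet.univ

theorem jumpMeasure_univ (x : X) (t : Time T₀ T₁) :
    q.jumpMeasure x t Set.univ = ENNReal.ofReal (q.rate x t) :=
  q.jumpMeasure_apply x t MeasurableSet.univ

/-- The kernel `(t, x) ↦ q(x, t, · \ {x})`. -/
def jumpKernel : Kernel (Time T₀ T₁ × X) X where
  toFun z := q.jumpMeasure z.2 z.1
  measurable' := by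
    refine Measure.measurable_of_measurable_coe _ fun B hB => ?_
    simp only [q.jumpMeasure_apply _ _ hB]
    exact ((q.measurable_toFun_diff hB).comp measurable_swap).ennreal_ofReal

theorem jumpKernel_apply (z : Time T₀ T₁ × X) : q.jumpKernel z = q.jumpMeasure z.2 z.1 := rfl

/-- The rates are finite but may be unbounded; cutting along the level sets of the integer part of
the rate gives countably many finite kernels. -/
instance : IsSFiniteKernel q.jumpKernel := by
  classical
  have hr : Measurable fun z : Time T₀ T₁ × X => ⌊q.rate z.2 z.1⌋₊ :=
    Nat.measurable_floor.comp (q.measurable_rate.comp measurable_swap)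
  have hs : ∀ n : ℕ, MeasurableSet {z : Time T₀ T₁ × X | ⌊q.rate z.2 z.1⌋₊ = n} := fun n =>
    hr (measurableSet_singleton n)
  set κ : ℕ → Kernel (Time T₀ T₁ × X) X := fun n => Kernel.piecewise (hs n) q.jumpKernel 0
  have hfin : ∀ n, IsFiniteKernel (κ n) := fun n => by
    refine ⟨⟨ENNReal.ofReal (n + 1), ENNReal.ofReal_lt_top, fun z => ?_⟩⟩
    rw [Kernel.piecewise_apply]
    split_ifs with h
    · rw [jumpKernel_apply, jumpMeasure_univ]
      refine ENNReal.ofReal_le_ofReal ?_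
      rw [← show ⌊q.rate z.2 z.1⌋₊ = n from h]
      exact (Nat.lt_floor_add_one _).le
    · simp
  have hsum : q.jumpKernel = Kernel.sum κ := by
    ext z B hB
    rw [Kernel.sum_apply, Measure.sum_apply _ hB, tsum_eq_single ⌊q.rate z.2 z.1⌋₊]
    · simp [κ, Kernel.piecewise_apply]
    · intro n hn
      simp [κ, Kernel.piecewise_apply, hn.symm]
  rw [hsum]
  infer_instance

/-! ### Survival probabilities and the law of the next jump -/

end

/-- The probability `exp(-∫_u^t q(x, s) ds)` of no jump in `]u, t]` from the state `x`. -/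
def survival (x : X) (u t : Time T₀ T₁) : ℝ≥0∞ :=
  ENNReal.ofReal (Real.exp (-∫ s in Set.Ioc u t, q.rate x s))

theorem survival_ne_top (x : X) (u t : Time T₀ T₁) : q.survival x u t ≠ ∞ := ENNReal.ofReal_ne_top

theorem survival_of_le (x : X) {u t : Time T₀ T₁} (h : t ≤ u) : q.survival x u t = 1 := by
  simp [survival, Set.Ioc_eq_empty_of_le h]

theorem survival_le_one (x : X) (u t : Time T₀ T₁) : q.survival x u t ≤ 1 := by
  rw [survival, ENNReal.ofReal_le_one, Real.exp_le_one_iff, neg_nonpos]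
  exact setIntegral_nonneg measurableSet_Ioc fun s _ => q.rate_nonneg x s

variable {q}

theorem HasLocallyIntegrableRates.integrableOn_Ioc (hL : q.HasLocallyIntegrableRates) (x : X)
    (u t : Time T₀ T₁) : IntegrableOn (fun s => q.rate x s) (Set.Ioc u t) :=
  (hL x t).mono_set Set.Ioc_subset_Iic_self

theorem survival_mul_survival (hL : q.HasLocallyIntegrableRates) (x : X) {u s t : Time T₀ T₁}
    (hus : u ≤ s) (hst : s ≤ t) : q.survival x u s * q.survival x s t = q.survival x u t := by
  rw [survival, survival, survival, ← ENNReal.ofReal_mul (Real.exp_pos _).le, ← Real.exp_add,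
    setIntegral_Ioc_add hus hst (hL.integrableOn_Ioc x u t), neg_add]

theorem lintegral_survival_mul_rate (hL : q.HasLocallyIntegrableRates) (x : X)
    {u t : Time T₀ T₁} (hut : u ≤ t) :
    (∫⁻ s in Set.Ioc u t, q.survival x u s * ENNReal.ofReal (q.rate x s)) + q.survival x u t =
      1 :=
  lintegral_exp_neg_integral (q.rate_nonneg x) hut (hL.integrableOn_Ioc x u t)

theorem lintegral_survival_mul_rate_backward (hL : q.HasLocallyIntegrableRates) (x : X)
    {a b t : Time T₀ T₁} (hab : a ≤ b) (hbt : b ≤ t) :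
    (∫⁻ s in Set.Ioc a b, q.survival x s t * ENNReal.ofReal (q.rate x s)) + q.survival x a t =
      q.survival x b t :=
  lintegral_exp_neg_integral_backward (q.rate_nonneg x) hab hbt (hL.integrableOn_Ioc x a t)

variable (q) [StandardBorelSpace X]

theorem measurable_survival :
    Measurable fun p : X × Time T₀ T₁ × Time T₀ T₁ => q.survival p.1 p.2.1 p.2.2 := by
  have hs : MeasurableSet {z : (X × Time T₀ T₁ × Time T₀ T₁) × Time T₀ T₁ |
      z.1.2.1 < z.2 ∧ z.2 ≤ z.1.2.2} :=
    (measurableSet_lt (by fun_prop) (by fun_prop)).inter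
      (measurableSet_le (by fun_prop) (by fun_prop))
  have hm : Measurable fun z : (X × Time T₀ T₁ × Time T₀ T₁) × Time T₀ T₁ =>
      Set.indicator {z : (X × Time T₀ T₁ × Time T₀ T₁) × Time T₀ T₁ |
        z.1.2.1 < z.2 ∧ z.2 ≤ z.1.2.2} (fun z => q.rate z.1.1 z.2) z :=
    (q.measurable_rate.comp (by fun_prop : Measurable
      fun z : (X × Time T₀ T₁ × Time T₀ T₁) × Time T₀ T₁ => (z.1.1, z.2))).indicator hs
  have hI := (hm.stronglyMeasurable.integral_prod_right' (ν := volume)).measurable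
  have : ∀ p : X × Time T₀ T₁ × Time T₀ T₁, q.survival p.1 p.2.1 p.2.2 =
      ENNReal.ofReal (Real.exp (-∫ s, Set.indicator
        {z : (X × Time T₀ T₁ × Time T₀ T₁) × Time T₀ T₁ | z.1.2.1 < z.2 ∧ z.2 ≤ z.1.2.2}
          (fun z => q.rate z.1.1 z.2) (p, s))) := fun p => by
    rw [survival, ← integral_indicator measurableSet_Ioc]
    rfl
  simp_rw [this]
  exact (Real.measurable_exp.comp hI.neg).ennreal_ofReal

@[fun_prop]
theorem _root_.Measurable.survival {Θ : Type*} [MeasurableSpace Θ] {x : Θ → X}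
    {u t : Θ → Time T₀ T₁} (hx : Measurable x) (hu : Measurable u) (ht : Measurable t) :
    Measurable fun θ => q.survival (x θ) (u θ) (t θ) :=
  q.measurable_survival.comp (hx.prodMk (hu.prodMk ht))

/-- The density `1{u < s} exp(-∫_u^s q(x, θ) dθ)`. -/
def nextJumpDensity (z : Time T₀ T₁ × X) (s : Time T₀ T₁) : ℝ≥0∞ :=
  {p : (Time T₀ T₁ × X) × Time T₀ T₁ | p.1.1 < p.2}.indicator
    (fun p => q.survival p.1.2 p.1.1 p.2) (z, s)

theorem measurable_nextJumpDensity : Measurable (Function.uncurry q.nextJumpDensity) :=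
  Measurable.indicator (by fun_prop) (measurableSet_lt (by fun_prop) (by fun_prop))

/-- The law (on finite times) of the time and the place of the first jump after the time `u`, given
the state `x` at time `u`, as a kernel in `(u, x)`. -/
def nextJump : Kernel (Time T₀ T₁ × X) (Time T₀ T₁ × X) :=
  ((Kernel.const (Time T₀ T₁ × X) (volume : Measure (Time T₀ T₁))).withDensity q.nextJumpDensity) ⊗ₖ
    (q.jumpKernel.comap (fun p : (Time T₀ T₁ × X) × Time T₀ T₁ => (p.2, p.1.2)) (by fun_prop))

instance : IsSFiniteKernel
    ((Kernel.const (Time T₀ T₁ × X) (volume : Measure (Time T₀ T₁))).withDensity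
      q.nextJumpDensity) := by
  refine Kernel.IsSFiniteKernel.withDensity _ fun z s => ?_
  unfold nextJumpDensity Set.indicator
  split_ifs <;> simp [survival_ne_top]

theorem lintegral_nextJump (z : Time T₀ T₁ × X) {f : Time T₀ T₁ × X → ℝ≥0∞} (hf : Measurable f) :
    ∫⁻ p, f p ∂(q.nextJump z) =
      ∫⁻ s in Set.Ioi z.1, q.survival z.2 z.1 s * ∫⁻ y, f (s, y) ∂(q.jumpMeasure z.2 s) := by
  have hm : Measurable fun s => ∫⁻ y, f (s, y) ∂(q.jumpMeasure z.2 s) :=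
    Measurable.lintegral_kernel_prod_right' (κ := q.jumpKernel.comap (fun s => (s, z.2))
      (by fun_prop)) (f := fun p => f p) (by fun_prop)
  rw [nextJump, Kernel.lintegral_compProd _ _ _ hf]
  simp only [Kernel.comap_apply, jumpKernel_apply]
  rw [Kernel.lintegral_withDensity _ q.measurable_nextJumpDensity z hm, Kernel.const_apply,
    ← lintegral_indicator measurableSet_Ioi]
  refine lintegral_congr fun s => ?_
  simp only [nextJumpDensity, Set.indicator, Set.mem_ofPred_eq, Set.mem_Ioi]
  split_ifs <;> simp

variable {q}

/-- Integrating out the place of the jump leaves the density `survival * rate`, whose integral is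
given by the fundamental theorem of calculus. The version with `Iio` agrees because Lebesgue measure
has no atoms. -/
theorem nextJump_Iic_prod_add (hL : q.HasLocallyIntegrableRates) (z : Time T₀ T₁ × X)
    {t : Time T₀ T₁} (h : z.1 ≤ t) :
    q.nextJump z (Set.Iic t ×ˢ Set.univ) + q.survival z.2 z.1 t = 1 := by
  have hm : MeasurableSet (Set.Iic t ×ˢ (Set.univ : Set X)) := measurableSet_Iic.prod .univ
  rw [← lintegral_indicator_one hm, lintegral_nextJump q z (measurable_one.indicator hm),
    ← lintegral_survival_mul_rate hL z.2 h]
  congr 1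
  rw [← lintegral_indicator measurableSet_Ioi, ← lintegral_indicator measurableSet_Ioc]
  refine lintegral_congr fun s => ?_
  by_cases h1 : z.1 < s <;> by_cases h2 : s ≤ t <;>
    simp [Set.indicator, h1, h2, jumpMeasure_univ]

theorem nextJump_Iio_prod_add (hL : q.HasLocallyIntegrableRates) (z : Time T₀ T₁ × X)
    {t : Time T₀ T₁} (h : z.1 ≤ t) :
    q.nextJump z (Set.Iio t ×ˢ Set.univ) + q.survival z.2 z.1 t = 1 := by
  have hm : MeasurableSet (Set.Iio t ×ˢ (Set.univ : Set X)) := measurableSet_Iio.prod .univ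
  rw [← lintegral_indicator_one hm, lintegral_nextJump q z (measurable_one.indicator hm),
    ← lintegral_survival_mul_rate hL z.2 h, ← setLIntegral_congr Ioo_ae_eq_Ioc]
  congr 1
  rw [← lintegral_indicator measurableSet_Ioi, ← lintegral_indicator measurableSet_Ioo]
  refine lintegral_congr fun s => ?_
  by_cases h1 : z.1 < s <;> by_cases h2 : s < t <;>
    simp [Set.indicator, h1, h2, jumpMeasure_univ]

theorem nextJump_Iic_fst (z : Time T₀ T₁ × X) :
    q.nextJump z (Set.Iic z.1 ×ˢ Set.univ) = 0 := by
  have hm : MeasurableSet (Set.Iic z.1 ×ˢ (Set.univ : Set X)) := measurableSet_Iic.prod .univ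
  rw [← lintegral_indicator_one hm, lintegral_nextJump q z (measurable_one.indicator hm),
    ← lintegral_indicator measurableSet_Ioi, lintegral_eq_zero_of_ae_eq_zero]
  refine Filter.Eventually.of_forall fun s => ?_
  by_cases h1 : z.1 < s <;> simp [Set.indicator, h1, not_le.2]

/-- The times exhaust the axis monotonically, and up to each time the mass is one minus a survival
probability. The defect is the probability that no further jump happens before `T₁`. -/
theorem nextJump_univ_le_one (hL : q.HasLocallyIntegrableRates) (z : Time T₀ T₁ × X) :
    q.nextJump z Set.univ ≤ 1 := by
  have hU : (Set.univ : Set (Time T₀ T₁ × X)) =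
      ⋃ t : Time T₀ T₁, Set.Iic t ×ˢ (Set.univ : Set X) := by
    ext p; simpa using ⟨p.1.1, p.1.2, le_rfl⟩
  have hdir : Monotone fun t : Time T₀ T₁ => Set.Iic t ×ˢ (Set.univ : Set X) :=
    fun s t hst => Set.prod_mono_left (Set.Iic_subset_Iic.2 hst)
  rw [hU, hdir.measure_iUnion]
  refine iSup_le fun t => ?_
  refine (measure_mono (hdir (le_max_right z.1 t))).trans ?_
  rw [← nextJump_Iic_prod_add hL z (le_max_left z.1 t)]
  exact le_self_add

end QFunction

namespace QFunction

variable {X : Type*} [MeasurableSpace X] [StandardBorelSpace X] {T₀ : ℝ} {T₁ : EReal}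
  {q : QFunction X T₀ T₁}

instance : IsSFiniteKernel q.nextJump := by
  unfold nextJump; infer_instance

/-! ### Feller's transition function -/

theorem fellerTerm_zero (u : Time T₀ T₁) (x : X) (t : Time T₀ T₁) (B : Set X) :
    q.fellerTerm 0 u x t B = B.indicator 1 x * q.survival x u t := rfl

/-- Feller's recursion is conditioning on the time and place of the first jump. Measurability is a
hypothesis here because `measurable_fellerTerm` uses this form in its own induction step. -/
theorem fellerTerm_succ_of_measurable {n : ℕ} {t : Time T₀ T₁} {B : Set X}
    (hm : Measurable fun z : Time T₀ T₁ × X => q.fellerTerm n z.1 z.2 t B)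
    (u : Time T₀ T₁) (x : X) :
    q.fellerTerm (n + 1) u x t B =
      ∫⁻ z in Set.Iio t ×ˢ Set.univ, q.fellerTerm n z.1 z.2 t B ∂(q.nextJump (u, x)) := by
  have hS : MeasurableSet (Set.Iio t ×ˢ (Set.univ : Set X)) := measurableSet_Iio.prod .univ
  rw [← lintegral_indicator hS, lintegral_nextJump q _ (hm.indicator hS), fellerTerm,
    ← lintegral_indicator measurableSet_Ioi, ← lintegral_indicator measurableSet_Ioo]
  refine lintegral_congr fun s => ?_
  by_cases h1 : u < s <;> by_cases h2 : s < t <;> simp [Set.indicator, h1, h2]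
  exact lintegral_const_mul _ (hm.comp measurable_prodMk_left)

theorem measurable_fellerTerm (n : ℕ) {B : Set X} (hB : MeasurableSet B) :
    Measurable fun p : Time T₀ T₁ × X × Time T₀ T₁ => q.fellerTerm n p.1 p.2.1 p.2.2 B := by
  induction n with
  | zero =>
    simp only [fellerTerm_zero]
    exact ((measurable_one.indicator hB).comp (by fun_prop)).mul (by fun_prop)
  | succ n ih =>
    have h : ∀ p : Time T₀ T₁ × X × Time T₀ T₁, q.fellerTerm (n + 1) p.1 p.2.1 p.2.2 B =
        ∫⁻ z, {r : (Time T₀ T₁ × X × Time T₀ T₁) × Time T₀ T₁ × X | r.2.1 < r.1.2.2}.indicator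
          (fun r => q.fellerTerm n r.2.1 r.2.2 r.1.2.2 B) (p, z)
          ∂(q.nextJump.comap (fun p : Time T₀ T₁ × X × Time T₀ T₁ => (p.1, p.2.1))
            (by fun_prop) p) := fun p => by
      rw [fellerTerm_succ_of_measurable
        (ih.comp (by fun_prop : Measurable fun z : Time T₀ T₁ × X => (z.1, z.2, p.2.2))),
        ← lintegral_indicator (measurableSet_Iio.prod .univ), Kernel.comap_apply]
      refine lintegral_congr fun z => ?_
      simp [Set.indicator]
    simp_rw [h]
    refine Measurable.lintegral_kernel_prod_right' (Measurable.indicator ?_ ?_)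
    · exact ih.comp (by fun_prop : Measurable
        fun r : (Time T₀ T₁ × X × Time T₀ T₁) × Time T₀ T₁ × X => (r.2.1, r.2.2, r.1.2.2))
    · exact measurableSet_lt (by fun_prop) (by fun_prop)

theorem measurable_fellerTerm_left (n : ℕ) (t : Time T₀ T₁) {B : Set X} (hB : MeasurableSet B) :
    Measurable fun z : Time T₀ T₁ × X => q.fellerTerm n z.1 z.2 t B :=
  (measurable_fellerTerm n hB).comp
    (by fun_prop : Measurable fun z : Time T₀ T₁ × X => (z.1, z.2, t))

theorem fellerTerm_succ (n : ℕ) (u : Time T₀ T₁) (x : X) (t : Time T₀ T₁) {B : Set X}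
    (hB : MeasurableSet B) :
    q.fellerTerm (n + 1) u x t B =
      ∫⁻ z in Set.Iio t ×ˢ Set.univ, q.fellerTerm n z.1 z.2 t B ∂(q.nextJump (u, x)) :=
  fellerTerm_succ_of_measurable (measurable_fellerTerm_left n t hB) u x

theorem measurable_feller {B : Set X} (hB : MeasurableSet B) :
    Measurable fun p : Time T₀ T₁ × X × Time T₀ T₁ => q.feller p.1 p.2.1 p.2.2 B :=
  Measurable.tsum fun n => measurable_fellerTerm n hB

/-- The number of jumps and the state at time `t`, as a kernel in the initial time and state. -/
def fellerKernel (q : QFunction X T₀ T₁) (t : Time T₀ T₁) : ℕ → Kernel (Time T₀ T₁ × X) X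
  | 0 => (Kernel.deterministic Prod.snd measurable_snd).withDensity
      fun z _ => q.survival z.2 z.1 t
  | n + 1 => fellerKernel q t n ∘ₖ q.nextJump.restrict (measurableSet_Iio.prod .univ :
      MeasurableSet (Set.Iio t ×ˢ (Set.univ : Set X)))

theorem fellerKernel_apply (t : Time T₀ T₁) (n : ℕ) (z : Time T₀ T₁ × X) {B : Set X}
    (hB : MeasurableSet B) : fellerKernel q t n z B = q.fellerTerm n z.1 z.2 t B := by
  induction n generalizing z with
  | zero =>
    rw [fellerKernel, Kernel.withDensity_apply' _ (by fun_prop), lintegral_const,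
      Kernel.deterministic_apply, Measure.restrict_apply_univ, Measure.dirac_apply' _ hB,
      fellerTerm_zero, mul_comm]
  | succ n ih =>
    rw [fellerKernel, Kernel.comp_apply' _ _ _ hB, Kernel.restrict_apply, fellerTerm_succ _ _ _ _ hB]
    simp_rw [ih]

theorem lintegral_fellerKernel_zero (t : Time T₀ T₁) (z : Time T₀ T₁ × X) {f : X → ℝ≥0∞}
    (hf : Measurable f) : ∫⁻ y, f y ∂(fellerKernel q t 0 z) = q.survival z.2 z.1 t * f z.2 := by
  rw [fellerKernel, Kernel.lintegral_withDensity _ (by fun_prop) _ hf, Kernel.deterministic_apply,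
    lintegral_dirac' _ (by fun_prop)]

theorem lintegral_fellerKernel_succ (t : Time T₀ T₁) (n : ℕ) (z : Time T₀ T₁ × X) {f : X → ℝ≥0∞}
    (hf : Measurable f) : ∫⁻ y, f y ∂(fellerKernel q t (n + 1) z) =
      ∫⁻ p in Set.Iio t ×ˢ Set.univ, ∫⁻ y, f y ∂(fellerKernel q t n p) ∂(q.nextJump z) := by
  rw [fellerKernel, Kernel.lintegral_comp _ _ _ hf, Kernel.restrict_apply]

theorem feller_eq_sum (t : Time T₀ T₁) (z : Time T₀ T₁ × X) {B : Set X} (hB : MeasurableSet B) :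
    Measure.sum (fun n => fellerKernel q t n z) B = q.feller z.1 z.2 t B := by
  simp_rw [Measure.sum_apply _ hB, fellerKernel_apply _ _ _ hB]
  rfl

/-- The law of the next jump after `s` is the law of the next jump after `u` on later times,
weighted by the probability of no jump in `]u, s]`. -/
theorem setLIntegral_nextJump_Ioi (hL : q.HasLocallyIntegrableRates) (x : X) {u s : Time T₀ T₁}
    (hus : u ≤ s) {f : Time T₀ T₁ × X → ℝ≥0∞} (hf : Measurable f) :
    ∫⁻ z in Set.Ioi s ×ˢ Set.univ, f z ∂(q.nextJump (u, x)) =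
      q.survival x u s * ∫⁻ z, f z ∂(q.nextJump (s, x)) := by
  have hS : MeasurableSet (Set.Ioi s ×ˢ (Set.univ : Set X)) := measurableSet_Ioi.prod .univ
  rw [← lintegral_indicator hS, lintegral_nextJump q _ (hf.indicator hS), lintegral_nextJump q _ hf,
    ← lintegral_const_mul' _ _ (q.survival_ne_top _ _ _), ← lintegral_indicator measurableSet_Ioi,
    ← lintegral_indicator measurableSet_Ioi]
  refine lintegral_congr fun r => ?_
  by_cases h : s < r
  · simp [Set.indicator, h, hus.trans_lt h, ← mul_assoc, survival_mul_survival hL x hus h.le]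
  · simp [Set.indicator, h]

/-- With `n` jumps in all, `k` of them happen up to time `s` and `n - k` afterwards. The induction
conditions on the first jump: if it comes before `s`, the remaining `n - 1` jumps are split by the
induction hypothesis; if it comes after `s`, the process restarts at `s` from the initial state,
which is the summand `k = 0`. -/
theorem chapmanKolmogorov_fellerTerm (hL : q.HasLocallyIntegrableRates) {s t : Time T₀ T₁}
    (hst : s < t) {B : Set X} (hB : MeasurableSet B) (n : ℕ) (z : Time T₀ T₁ × X) (hz : z.1 ≤ s) :
    q.fellerTerm n z.1 z.2 t B =
      ∑ k ∈ Finset.range (n + 1),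
        ∫⁻ y, q.fellerTerm (n - k) s y t B ∂(fellerKernel q s k z) := by
  have hm : ∀ n, Measurable fun y => q.fellerTerm n s y t B := fun n =>
    (measurable_fellerTerm_left n t hB).comp measurable_prodMk_left
  induction n generalizing z with
  | zero =>
    simp only [zero_add, Finset.range_one, Finset.sum_singleton, Nat.sub_zero]
    rw [lintegral_fellerKernel_zero _ _ (hm 0), fellerTerm_zero, fellerTerm_zero,
      ← survival_mul_survival hL z.2 hz hst.le]
    ring
  | succ n ih =>
    rw [Finset.sum_range_succ']
    simp only [Nat.sub_zero, Nat.reduceSubDiff]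
    rw [lintegral_fellerKernel_zero _ _ (hm _), fellerTerm_succ _ _ _ _ hB,
      fellerTerm_succ _ _ _ _ hB]
    simp_rw [lintegral_fellerKernel_succ s _ z (hm _)]
    have hmk : ∀ k, Measurable fun p =>
        ∫⁻ y, q.fellerTerm (n - k) s y t B ∂(fellerKernel q s k p) := fun k =>
      (hm (n - k)).lintegral_kernel
    have hT : MeasurableSet (Set.Iio t ×ˢ (Set.univ : Set X)) := measurableSet_Iio.prod .univ
    have hF := measurable_fellerTerm_left (q := q) n t hB
    rw [← lintegral_finsetSum _ fun k _ => hmk k,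
      ← lintegral_indicator hT, ← lintegral_indicator hT,
      ← setLIntegral_nextJump_Ioi hL z.2 hz (hF.indicator hT)]
    have hS : MeasurableSet (Set.Iic s ×ˢ (Set.univ : Set X)) := measurableSet_Iic.prod .univ
    have hc : (Set.Iic s ×ˢ (Set.univ : Set X))ᶜ = Set.Ioi s ×ˢ Set.univ := by
      ext p; simp
    rw [← lintegral_add_compl _ hS, hc]
    congr 1
    -- A first jump exactly at time `s` has probability zero: both sets complete the same survival
    -- probability to `1`.
    have hae : Set.Iio s ×ˢ (Set.univ : Set X) =ᵐ[q.nextJump z] Set.Iic s ×ˢ Set.univ := by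
      have h1 := nextJump_Iio_prod_add hL z hz
      have h2 := nextJump_Iic_prod_add hL z hz
      refine ae_eq_of_subset_of_measure_ge (Set.prod_mono_left Set.Iio_subset_Iic_self) ?_
        (measurableSet_Iio.prod .univ).nullMeasurableSet ?_
      · exact (WithTop.add_right_cancel (q.survival_ne_top _ _ _) (h2.trans h1.symm)).le
      · exact ((measure_mono (Set.subset_univ _)).trans_lt
          ((nextJump_univ_le_one hL z).trans_lt ENNReal.one_lt_top)).ne
    rw [← setLIntegral_congr hae]
    refine setLIntegral_congr_fun (measurableSet_Iio.prod .univ) fun p hp => ?_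
    have hp' : p.1 < s := hp.1
    simp only [Set.indicator, Set.mem_prod, Set.mem_Iio, hp'.trans hst, Set.mem_univ, and_self,
      if_true]
    exact ih p hp'.le

/-- This sum bounds the probability of fewer than `n` jumps. If it is at most `1` after the first
jump, then the total is at most the mass of a jump before `t` plus the survival probability, that is
`1`. -/
theorem sum_fellerTerm_univ_le_one (hL : q.HasLocallyIntegrableRates) (t : Time T₀ T₁) (n : ℕ)
    (z : Time T₀ T₁ × X) (hz : z.1 ≤ t) :
    ∑ k ∈ Finset.range n, q.fellerTerm k z.1 z.2 t Set.univ ≤ 1 := by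
  induction n generalizing z with
  | zero => simp
  | succ n ih =>
    rw [Finset.sum_range_succ', fellerTerm_zero]
    simp only [fellerTerm_succ _ _ _ _ MeasurableSet.univ]
    rw [← lintegral_finsetSum _ fun k _ => measurable_fellerTerm_left k t .univ,
      ← nextJump_Iio_prod_add hL z hz, ← setLIntegral_one]
    refine add_le_add ?_ (by simp)
    exact setLIntegral_mono measurable_const fun p hp => ih p (le_of_lt hp.1)

theorem isTransitionFunction_feller (hL : q.HasLocallyIntegrableRates) :
    IsTransitionFunction q.feller where
  le_one u x t hut B hB := by
    refine le_trans ?_ (ENNReal.tsum_le_of_sum_range_le fun n =>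
      sum_fellerTerm_univ_le_one hL t n (u, x) hut.le)
    refine ENNReal.tsum_le_tsum fun n => ?_
    rw [← fellerKernel_apply t n (u, x) hB, ← fellerKernel_apply t n (u, x) .univ]
    exact measure_mono (Set.subset_univ _)
  isMeasure u x t _ := ⟨Measure.sum fun n => fellerKernel q t n (u, x), fun B hB =>
    feller_eq_sum t (u, x) hB⟩
  measurable B hB := (measurable_feller hB).comp measurable_subtype_coe
  chapmanKolmogorov u s t hus hst x B hB m hm := by
    have hm' : m = Measure.sum fun n => fellerKernel q s n (u, x) :=
      Measure.ext fun C hC => (hm C hC).trans (feller_eq_sum s (u, x) hC).symm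
    have hF : ∀ n, Measurable fun y => q.fellerTerm n s y t B := fun n =>
      (measurable_fellerTerm_left n t hB).comp measurable_prodMk_left
    rw [hm', lintegral_sum_measure]
    simp only [feller]
    simp_rw [lintegral_tsum fun n => (hF n).aemeasurable]
    -- The double series over the numbers of jumps before and after `s` is regrouped along
    -- antidiagonals, by the total number of jumps.
    rw [← ENNReal.tsum_prod (f := fun i j =>
        ∫⁻ y, q.fellerTerm j s y t B ∂(fellerKernel q s i (u, x))),
      ← Finset.HasAntidiagonal.sigmaAntidiagonalEquivProd.tsum_eq, ENNReal.tsum_sigma']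
    refine tsum_congr fun n => ?_
    rw [chapmanKolmogorov_fellerTerm hL hst hB n (u, x) hus.le, tsum_fintype,
      ← Finset.Nat.sum_antidiagonal_eq_sum_range_succ
        (fun i j => ∫⁻ y, q.fellerTerm j s y t B ∂(fellerKernel q s i (u, x))), ← Finset.sum_coe_sort]
    rfl

end QFunction

/-! ### Sequences of marks -/

section Marks

variable {X : Type*} {T₀ : ℝ} {T₁ : EReal}

/-- The time of a mark, which is `T₁` for the mark `inr ()` of a jump that does not happen. -/
def timeOf : (Time T₀ T₁ × X) ⊕ Unit → WithTop (Time T₀ T₁) :=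
  Sum.elim (fun z => (z.1 : WithTop (Time T₀ T₁))) fun _ => ⊤

/-- The state of a mark, which is `x_∞` for a jump that does not happen. -/
def stateOf : (Time T₀ T₁ × X) ⊕ Unit → Ext X := Sum.elim (fun z => Sum.inl z.2) fun _ => xInfty

@[simp] theorem timeOf_inl (z : Time T₀ T₁ × X) : timeOf (Sum.inl z) = (z.1 : WithTop _) := rfl
@[simp] theorem timeOf_inr (a : Unit) :
    timeOf (Sum.inr a : (Time T₀ T₁ × X) ⊕ Unit) = ⊤ := rfl
@[simp] theorem stateOf_inl (z : Time T₀ T₁ × X) : stateOf (Sum.inl z) = Sum.inl z.2 := rfl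
@[simp] theorem stateOf_inr (a : Unit) :
    stateOf (Sum.inr a : (Time T₀ T₁ × X) ⊕ Unit) = xInfty := rfl

theorem measurable_timeOf [MeasurableSpace X] :
    Measurable (timeOf : (Time T₀ T₁ × X) ⊕ Unit → _) :=
  Measurable.sumElim measurable_fst.withTop_coe measurable_const

theorem measurable_stateOf [MeasurableSpace X] :
    Measurable (stateOf : (Time T₀ T₁ × X) ⊕ Unit → _) :=
  Measurable.sumElim (measurable_inl.comp measurable_snd) measurable_const

variable [Fact ((T₀ : EReal) < T₁)]

/-- The filtration only provides the events that a mark has time at most `s` and state in `B`. These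
rectangles form a π-system generating the σ-algebra of finite marks, and the absence of a jump is
the complement of a countable union of such events. -/
theorem measurable_of_Iic_prod [MeasurableSpace X] {Θ : Type*} {mΘ : MeasurableSpace Θ}
    {g : Θ → (Time T₀ T₁ × X) ⊕ Unit}
    (h : ∀ (s : Time T₀ T₁) (B : Set X), MeasurableSet B →
      MeasurableSet (g ⁻¹' (Sum.inl '' (Set.Iic s ×ˢ B)))) : Measurable g := by
  set π : Set (Set (Time T₀ T₁ × X)) :=
    Set.image2 (· ×ˢ ·) (Set.range Set.Iic) {B | MeasurableSet B} with hπ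
  obtain ⟨v, hv⟩ := Filter.exists_seq_tendsto (Filter.atTop : Filter (Time T₀ T₁))
  have hgen : (inferInstance : MeasurableSpace (Time T₀ T₁ × X)) = .generateFrom π := by
    refine (generateFrom_eq_prod ?_ MeasurableSpace.generateFrom_measurableSet ?_ ?_).symm
    · exact (borel_eq_generateFrom_Iic _).symm.trans (BorelSpace.measurable_eq).symm
    · refine ⟨fun n => Set.Iic (v n), fun n => ⟨_, rfl⟩, Set.eq_univ_of_forall fun t => ?_⟩
      obtain ⟨n, hn⟩ := (hv.eventually_ge_atTop t).exists
      exact Set.mem_iUnion.2 ⟨n, hn⟩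
    · exact ⟨fun _ => Set.univ, fun _ => MeasurableSet.univ, Set.iUnion_const _⟩
  have hpi : IsPiSystem π := isPiSystem_Iic.prod MeasurableSpace.isPiSystem_measurableSet
  have hU : MeasurableSet (g ⁻¹' (Set.range Sum.inl)) := by
    have : g ⁻¹' (Set.range Sum.inl) =
        ⋃ n, g ⁻¹' (Sum.inl '' (Set.Iic (v n) ×ˢ (Set.univ : Set X))) := by
      rw [← Set.preimage_iUnion, ← Set.image_iUnion, ← Set.image_univ]
      congr 2
      refine (Set.eq_univ_of_forall fun z => ?_).symm
      obtain ⟨n, hn⟩ := (hv.eventually_ge_atTop z.1).exists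
      exact Set.mem_iUnion.2 ⟨n, hn, trivial⟩
    rw [this]
    exact MeasurableSet.iUnion fun n => h _ _ .univ
  have hinl : ∀ C : Set (Time T₀ T₁ × X), MeasurableSet C →
      MeasurableSet (g ⁻¹' (Sum.inl '' C)) := by
    intro C hC
    induction C, hC using MeasurableSpace.induction_on_inter hgen hpi with
    | empty => simp
    | basic C hC =>
      obtain ⟨_, ⟨s, rfl⟩, B, hB, rfl⟩ := hC
      exact h s B hB
    | compl C hC ih =>
      rw [← Set.range_sdiff_image Sum.inl_injective]
      exact hU.diff ih
    | iUnion f _ _ ih =>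
      rw [Set.image_iUnion, Set.preimage_iUnion]
      exact MeasurableSet.iUnion ih
  intro C hC
  have h1 := hinl _ (measurable_inl hC)
  have hdec : g ⁻¹' C = g ⁻¹' (Sum.inl '' (Sum.inl ⁻¹' C)) ∪
      (g ⁻¹' (Set.range Sum.inl))ᶜ ∩ {_θ | Sum.inr () ∈ C} := by
    ext θ
    rcases hθ : g θ with z | ⟨⟩ <;> simp [hθ]
  rw [hdec]
  exact h1.union (hU.compl.inter (MeasurableSet.const _))

/-- The sequences `((T₀, x₀), (t₁, x₁), …)` of marks of the points of the sample space. -/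
def IsMarkSeq (m : ℕ → (Time T₀ T₁ × X) ⊕ Unit) : Prop :=
  (∃ x, m 0 = Sum.inl (⊥, x)) ∧ ∀ n, timeOf (m n) < timeOf (m (n + 1)) ∨ m (n + 1) = Sum.inr ()

end Marks

variable {X : Type*} {T₀ : ℝ} {T₁ : EReal} [Fact ((T₀ : EReal) < T₁)]

/-- The point of the sample space with a given sequence of marks. -/
def ofMarks (m : ℕ → (Time T₀ T₁ × X) ⊕ Unit) (hm : IsMarkSeq m) : Sample X T₀ T₁ :=
  ⟨fun n => (stateOf (m n), timeOf (m (n + 1))), by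
    obtain ⟨⟨x, hx⟩, h⟩ := hm
    refine ⟨⟨x, by simp [hx]⟩, fun n => ⟨?_, ?_, ?_⟩⟩
    · rcases h n with h | h
      · refine lt_of_le_of_lt ?_ h
        rcases m n with z | a
        · exact WithTop.coe_le_coe.2 bot_le
        · exact le_top
      · simp [h]
    · intro hn
      rcases hmn : m (n + 1) with z | a
      · refine ⟨?_, z.2, by simp [hmn]⟩
        rcases h (n + 1) with h | h
        · exact h
        · simp [h, hmn]
      · simp [hmn] at hn
    · intro hn
      rcases hmn : m (n + 1) with z | a
      · simp [hmn] at hn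
      · rcases h (n + 1) with h | h
        · simp [hmn] at h
        · simp [h, hmn]⟩

open scoped Classical in
/-- The mark `(t_n, x_n)` of the `n`-th jump, which is `inr ()` if `t_n = T₁`. -/
def mark (n : ℕ) (ω : Sample X T₀ T₁) : (Time T₀ T₁ × X) ⊕ Unit :=
  if jumpTime n ω = ⊤ then Sum.inr ()
  else Sum.map (fun x => ((jumpTime n ω).untopD ⊥, x)) id (state n ω)

theorem mark_cases (n : ℕ) (ω : Sample X T₀ T₁) :
    (∃ z : Time T₀ T₁ × X, jumpTime n ω = (z.1 : WithTop _) ∧ state n ω = Sum.inl z.2 ∧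
      mark n ω = Sum.inl z) ∨
    (jumpTime n ω = ⊤ ∧ state n ω = xInfty ∧ mark n ω = Sum.inr ()) := by
  obtain ⟨⟨x, hx⟩, h⟩ := ω.2
  cases n with
  | zero =>
    left
    refine ⟨(⊥, x), rfl, hx.symm, ?_⟩
    have h1 : state 0 ω = Sum.inl x := hx.symm
    have h2 : jumpTime 0 ω = ((⊥ : Time T₀ T₁) : WithTop (Time T₀ T₁)) := rfl
    simp [mark, h1, h2]
  | succ n =>
    rcases eq_or_ne (jumpTime (n + 1) ω) ⊤ with ht | ht
    · exact Or.inr ⟨ht, ((h n).2.2 ht).2, by simp [mark, ht]⟩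
    · left
      obtain ⟨y, hy⟩ := ((h n).2.1 (lt_top_iff_ne_top.2 ht)).2
      obtain ⟨t, ht'⟩ := WithTop.ne_top_iff_exists.1 ht
      refine ⟨(t, y), ht'.symm, hy.symm, ?_⟩
      have h1 : state (n + 1) ω = Sum.inl y := hy.symm
      simp [mark, ← ht', h1]

@[simp] theorem timeOf_mark (n : ℕ) (ω : Sample X T₀ T₁) : timeOf (mark n ω) = jumpTime n ω := by
  rcases mark_cases n ω with ⟨z, h1, h2, h3⟩ | ⟨h1, h2, h3⟩ <;> simp [h1, h3]

@[simp] theorem stateOf_mark (n : ℕ) (ω : Sample X T₀ T₁) : stateOf (mark n ω) = state n ω := by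
  rcases mark_cases n ω with ⟨z, h1, h2, h3⟩ | ⟨h1, h2, h3⟩ <;> simp [h2, h3]

theorem jumpTime_eq_of_mark {n : ℕ} {ω : Sample X T₀ T₁} {z : Time T₀ T₁ × X}
    (h : mark n ω = Sum.inl z) : jumpTime n ω = (z.1 : WithTop _) := by
  rw [← timeOf_mark, h, timeOf_inl]

theorem state_eq_of_mark {n : ℕ} {ω : Sample X T₀ T₁} {z : Time T₀ T₁ × X}
    (h : mark n ω = Sum.inl z) : state n ω = Sum.inl z.2 := by
  rw [← stateOf_mark, h, stateOf_inl]

theorem mark_eq_inr_iff {n : ℕ} {ω : Sample X T₀ T₁} :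
    mark n ω = Sum.inr () ↔ jumpTime n ω = ⊤ := by
  rcases mark_cases n ω with ⟨z, h1, h2, h3⟩ | ⟨h1, h2, h3⟩ <;> simp [h1, h3]

theorem jumpTime_zero (ω : Sample X T₀ T₁) :
    jumpTime 0 ω = ((⊥ : Time T₀ T₁) : WithTop (Time T₀ T₁)) := rfl

theorem exists_mark_zero (ω : Sample X T₀ T₁) : ∃ x, mark 0 ω = Sum.inl (⊥, x) := by
  rcases mark_cases 0 ω with ⟨z, h1, h2, h3⟩ | ⟨h1, h2, h3⟩
  · rw [jumpTime_zero, WithTop.coe_inj] at h1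
    exact ⟨z.2, by rw [h3, h1]⟩
  · simp [jumpTime_zero] at h1

theorem jumpTime_lt_succ (n : ℕ) (ω : Sample X T₀ T₁) :
    jumpTime n ω < jumpTime (n + 1) ω ∨ jumpTime (n + 1) ω = ⊤ := by
  cases n with
  | zero => exact Or.inl (ω.2.2 0).1
  | succ n =>
    rcases eq_or_ne (jumpTime (n + 1) ω) ⊤ with h | h
    · exact Or.inr ((ω.2.2 n).2.2 h).1
    · exact Or.inl ((ω.2.2 n).2.1 (lt_top_iff_ne_top.2 h)).1

theorem isMarkSeq_mark (ω : Sample X T₀ T₁) : IsMarkSeq fun n => mark n ω := by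
  refine ⟨exists_mark_zero ω, fun n => ?_⟩
  rw [timeOf_mark, timeOf_mark, mark_eq_inr_iff]
  exact jumpTime_lt_succ n ω

theorem monotone_jumpTime (ω : Sample X T₀ T₁) : Monotone fun n => jumpTime n ω :=
  monotone_nat_of_le_succ fun n => (jumpTime_lt_succ n ω).elim le_of_lt fun h => h ▸ le_top

/-- This is what makes it possible to compare paths mark by mark, without carrying the constraints
of `sampleSet` along. -/
theorem ext_mark {ω ω' : Sample X T₀ T₁} (h : ∀ n, mark n ω = mark n ω') : ω = ω' := by
  refine Subtype.ext (funext fun n => Prod.ext ?_ ?_)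
  · exact (stateOf_mark n ω).symm.trans ((congrArg stateOf (h n)).trans (stateOf_mark n ω'))
  · exact (timeOf_mark (n + 1) ω).symm.trans
      ((congrArg timeOf (h (n + 1))).trans (timeOf_mark (n + 1) ω'))

@[simp] theorem mark_ofMarks (m : ℕ → (Time T₀ T₁ × X) ⊕ Unit) (hm : IsMarkSeq m) (n : ℕ) :
    mark n (ofMarks m hm) = m n := by
  have h1 : state n (ofMarks m hm) = stateOf (m n) := rfl
  have h2 : jumpTime n (ofMarks m hm) = timeOf (m n) := by
    cases n with
    | zero =>
      obtain ⟨x, hx⟩ := hm.1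
      rw [hx]; rfl
    | succ n => rfl
  rcases hmn : m n with z | a <;> simp [mark, h1, h2, hmn]

/-! ### Measurability in terms of marks -/

theorem measurable_mark [MeasurableSpace X] (n : ℕ) : Measurable (mark n : Sample X T₀ T₁ → _) := by
  classical
  -- The formula below needs a default state; for empty `X` there are no paths.
  rcases isEmpty_or_nonempty X with hX | ⟨⟨x₀⟩⟩
  · have : IsEmpty (Sample X T₀ T₁) := ⟨fun ω => hX.elim (exists_mark_zero ω).choose⟩
    exact measurable_of_empty _
  have : (mark n : Sample X T₀ T₁ → _) = fun ω => if jumpTime n ω = ⊤ then Sum.inr () else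
      Sum.inl ((jumpTime n ω).untopD ⊥, Sum.elim id (fun _ => x₀) (state n ω)) := by
    ext1 ω
    rcases mark_cases n ω with ⟨z, h1, h2, h3⟩ | ⟨h1, h2, h3⟩ <;> simp [h1, h2, h3]
  rw [this]
  have hj := measurable_jumpTime (X := X) (T₀ := T₀) (T₁ := T₁) n
  refine Measurable.ite (hj (measurableSet_singleton ⊤)) measurable_const ?_
  exact measurable_inl.comp ((hj.untopD ⊥).prodMk
    ((measurable_id.sumElim measurable_const).comp (measurable_state n)))

theorem measurable_of_measurable_mark [MeasurableSpace X] {Θ : Type*} {mΘ : MeasurableSpace Θ} {f : Θ → Sample X T₀ T₁}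
    (h : ∀ n, Measurable fun θ => mark n (f θ)) : Measurable f := by
  refine Measurable.subtype_mk (measurable_pi_lambda _ fun n => ?_) (h := fun θ => (f θ).2)
  have h1 := measurable_stateOf.comp (h n)
  have h2 := measurable_timeOf.comp (h (n + 1))
  have : (fun θ => (f θ).1 n) = fun θ => (stateOf (mark n (f θ)), timeOf (mark (n + 1) (f θ))) := by
    ext1 θ
    rw [stateOf_mark, timeOf_mark]
    rfl
  rw [this]
  exact h1.prodMk h2

/-! ### Cutting off marks -/

section Cut

open scoped Classical

/-- Keep the marks with the indices that satisfy `p` and remove all others. -/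
def cut (p : ℕ → Prop) (h0 : p 0) (hp : ∀ n, p (n + 1) → p n) (ω : Sample X T₀ T₁) :
    Sample X T₀ T₁ :=
  ofMarks (fun n => if p n then mark n ω else Sum.inr ()) (by
    refine ⟨by simpa [h0] using exists_mark_zero ω, fun n => ?_⟩
    by_cases h : p (n + 1)
    · simpa [h, hp n h] using (isMarkSeq_mark ω).2 n
    · simp [h])

theorem mark_cut (p : ℕ → Prop) (h0 : p 0) (hp : ∀ n, p (n + 1) → p n) (ω : Sample X T₀ T₁)
    (n : ℕ) : mark n (cut p h0 hp ω) = if p n then mark n ω else Sum.inr () :=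
  mark_ofMarks _ _ n

/-- The history up to the `n`-th jump. -/
def truncate (n : ℕ) (ω : Sample X T₀ T₁) : Sample X T₀ T₁ :=
  cut (fun k => k ≤ n) n.zero_le (fun _ h => (Nat.le_succ _).trans h) ω

theorem mark_truncate (n k : ℕ) (ω : Sample X T₀ T₁) :
    mark k (truncate n ω) = if k ≤ n then mark k ω else Sum.inr () :=
  (mark_cut _ _ _ _ _).trans (by congr)

theorem mark_truncate_of_le {n k : ℕ} (h : k ≤ n) (ω : Sample X T₀ T₁) :
    mark k (truncate n ω) = mark k ω := by rw [mark_truncate, if_pos h]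

theorem truncate_truncate_of_le {n k : ℕ} (h : k ≤ n) (ω : Sample X T₀ T₁) :
    truncate k (truncate n ω) = truncate k ω := by
  refine ext_mark fun i => ?_
  simp only [mark_truncate]
  split_ifs with h1 h2 <;> first | rfl | omega

theorem measurable_truncate [MeasurableSpace X] (n : ℕ) : Measurable (truncate n : Sample X T₀ T₁ → _) := by
  refine measurable_of_measurable_mark fun k => ?_
  simp only [mark_truncate]
  split_ifs
  · exact measurable_mark k
  · exact measurable_const

/-- The path stopped at time `t`: the marks with `t_n ≤ t`. -/
def stopAt (t : Time T₀ T₁) (ω : Sample X T₀ T₁) : Sample X T₀ T₁ :=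
  cut (fun k => jumpTime k ω ≤ t) (WithTop.coe_le_coe.2 bot_le)
    (fun n h => (monotone_jumpTime ω n.le_succ).trans h) ω

theorem mark_stopAt (t : Time T₀ T₁) (n : ℕ) (ω : Sample X T₀ T₁) :
    mark n (stopAt t ω) = if jumpTime n ω ≤ t then mark n ω else Sum.inr () :=
  (mark_cut _ _ _ _ _).trans (by congr)

/-- The path stopped just before time `t`: the marks with `n = 0` or `t_n < t`. -/
def stopBefore (t : Time T₀ T₁) (ω : Sample X T₀ T₁) : Sample X T₀ T₁ :=
  cut (fun k => k = 0 ∨ jumpTime k ω < t) (Or.inl rfl)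
    (fun n h => Or.inr ((monotone_jumpTime ω n.le_succ).trans_lt (h.resolve_left n.succ_ne_zero))) ω

theorem mark_stopBefore (t : Time T₀ T₁) (n : ℕ) (ω : Sample X T₀ T₁) :
    mark n (stopBefore t ω) = if n = 0 ∨ jumpTime n ω < t then mark n ω else Sum.inr () :=
  (mark_cut _ _ _ _ _).trans (by congr)

/-- On `[t_n, t_{n+1}[` the information available at time `t` is the history up to the `n`-th jump.
The companion for `stopBefore` holds on `]t_n, t_{n+1}]`; this shift of endpoints is the difference
between adapted and predictable. -/
theorem stopAt_eq_truncate {t : Time T₀ T₁} {n : ℕ} {ω : Sample X T₀ T₁} (h1 : jumpTime n ω ≤ t)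
    (h2 : t < jumpTime (n + 1) ω) : stopAt t ω = truncate n ω := by
  refine ext_mark fun k => ?_
  rw [mark_stopAt, mark_truncate]
  by_cases hk : k ≤ n
  · rw [if_pos hk, if_pos ((monotone_jumpTime ω hk).trans h1)]
  · rw [if_neg hk, if_neg]
    exact not_le.2 (h2.trans_le (monotone_jumpTime ω (by omega : n + 1 ≤ k)))

theorem stopBefore_eq_truncate {t : Time T₀ T₁} {n : ℕ} {ω : Sample X T₀ T₁}
    (h1 : jumpTime n ω < t) (h2 : t ≤ jumpTime (n + 1) ω) : stopBefore t ω = truncate n ω := by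
  refine ext_mark fun k => ?_
  rw [mark_stopBefore, mark_truncate]
  by_cases hk : k ≤ n
  · rw [if_pos hk, if_pos (Or.inr ((monotone_jumpTime ω hk).trans_lt h1))]
  · rw [if_neg hk, if_neg]
    rintro (h | h)
    · omega
    · exact absurd h (not_lt.2 (h2.trans (monotone_jumpTime ω (by omega : n + 1 ≤ k))))

theorem mem_image_Iic_prod_iff {n : ℕ} {ω : Sample X T₀ T₁} {s : Time T₀ T₁} {B : Set X} :
    mark n ω ∈ Sum.inl '' (Set.Iic s ×ˢ B) ↔ state n ω ∈ Sum.inl '' B ∧ jumpTime n ω ≤ s := by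
  rcases mark_cases n ω with ⟨z, h1, h2, h3⟩ | ⟨h1, h2, h3⟩
  · simp [h1, h2, h3, and_comm]
  · simp [h1, h2, h3]

/-! ### Locating a time among the jump times. -/

theorem jumpTime_stopBefore (t : Time T₀ T₁) (n : ℕ) (ω : Sample X T₀ T₁) :
    jumpTime n (stopBefore t ω) = if n = 0 ∨ jumpTime n ω < t then jumpTime n ω else ⊤ := by
  rw [← timeOf_mark, mark_stopBefore]
  split_ifs <;> simp

theorem exists_jumpTime_le_lt_or (t : Time T₀ T₁) (ω : Sample X T₀ T₁) :
    (∃ n, jumpTime n ω ≤ t ∧ t < jumpTime (n + 1) ω) ∨ ∀ n, jumpTime n ω ≤ t := by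
  by_contra! h
  obtain ⟨h, n, hn⟩ := h
  refine absurd (?_ : jumpTime n ω ≤ t) (not_le.2 hn)
  induction n with
  | zero => exact WithTop.coe_le_coe.2 bot_le
  | succ n ih => exact absurd hn (not_lt.2 (h n (by by_contra! h'; exact absurd (ih h') (not_le.2 h'))))

theorem jumpTime_interval_unique {t : Time T₀ T₁} {ω : Sample X T₀ T₁} {m n : ℕ}
    (hm : jumpTime m ω ≤ t) (hm' : t < jumpTime (m + 1) ω)
    (hn : jumpTime n ω ≤ t) (hn' : t < jumpTime (n + 1) ω) : m = n := by
  by_contra! h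
  rcases lt_or_gt_of_ne h with h | h
  · exact absurd hn (not_le.2 (hm'.trans_le (monotone_jumpTime ω h)))
  · exact absurd hm (not_le.2 (hn'.trans_le (monotone_jumpTime ω h)))

theorem jumpProcess_eq_state {t : Time T₀ T₁} {ω : Sample X T₀ T₁} {n : ℕ}
    (h1 : jumpTime n ω ≤ t) (h2 : t < jumpTime (n + 1) ω) : jumpProcess t ω = state n ω := by
  classical
  have h : ∃ n, jumpTime n ω ≤ t ∧ t < jumpTime (n + 1) ω := ⟨n, h1, h2⟩
  rw [jumpProcess, dif_pos h,
    jumpTime_interval_unique (Nat.find_spec h).1 (Nat.find_spec h).2 h1 h2]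

theorem jumpProcess_eq_xInfty {t : Time T₀ T₁} {ω : Sample X T₀ T₁}
    (h : ∀ n, jumpTime n ω ≤ t) : jumpProcess t ω = xInfty := by
  rw [jumpProcess, dif_neg]
  rintro ⟨n, -, hn⟩
  exact absurd (h (n + 1)) (not_le.2 hn)

/-- The alternative `s = ⊥` also works when `t = ⊥`: the mark with index `0` is always kept, and all
other marks have times strictly after `⊥`. -/
theorem stopAt_stopBefore {s t : Time T₀ T₁} (h : s < t ∨ s = ⊥) (ω : Sample X T₀ T₁) :
    stopAt s (stopBefore t ω) = stopAt s ω := by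
  refine ext_mark fun n => ?_
  rw [mark_stopAt, mark_stopAt, jumpTime_stopBefore, mark_stopBefore]
  rcases Nat.eq_zero_or_pos n with rfl | hn
  · simp
  by_cases hs : jumpTime n ω ≤ s
  · rcases h with h | rfl
    · simp [hs.trans_lt (WithTop.coe_lt_coe.2 h)]
    · obtain ⟨k, rfl⟩ := Nat.exists_eq_add_of_le' hn
      exact absurd hs (not_le.2 (ω.2.2 k).1)
  · by_cases hc : n = 0 ∨ jumpTime n ω < t <;> simp [hs, hc]

theorem jumpProcess_preimage_eq (t : Time T₀ T₁) (C : Set (Ext X)) :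
    (jumpProcess t ⁻¹' C : Set (Sample X T₀ T₁)) =
      (⋃ n, (mark n ⁻¹' (Sum.inl '' (Set.Iic t ×ˢ (Sum.inl ⁻¹' C)))) \
        {ω | jumpTime (n + 1) ω ≤ t}) ∪ ((⋂ n, {ω | jumpTime n ω ≤ t}) ∩ {_ω | xInfty ∈ C}) := by
  ext ω
  simp only [Set.mem_union, Set.mem_iUnion, Set.mem_sdiff, Set.mem_preimage,
    mem_image_Iic_prod_iff, Set.mem_ofPred_eq, not_le, Set.mem_inter_iff, Set.mem_iInter]
  rcases exists_jumpTime_le_lt_or t ω with ⟨n, h1, h2⟩ | h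
  · rw [jumpProcess_eq_state h1 h2]
    have hnot : ¬ ∀ n, jumpTime n ω ≤ t := fun h => absurd (h (n + 1)) (not_le.2 h2)
    simp only [hnot, false_and, or_false]
    rcases mark_cases n ω with ⟨z, h1', h2', -⟩ | ⟨h1', -⟩
    · constructor
      · exact fun hC => ⟨n, ⟨⟨z.2, by rwa [h2'] at hC, h2'.symm⟩, h1⟩, h2⟩
      · rintro ⟨m, ⟨⟨x, hx, hx'⟩, hm1⟩, hm2⟩
        rwa [jumpTime_interval_unique h1 h2 hm1 hm2, ← hx']
    · simp [h1'] at h1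
  · rw [jumpProcess_eq_xInfty h]
    simp [h, not_lt.2 (h _)]

theorem stopBefore_mem_interval_iff {n : ℕ} {s : Time T₀ T₁} {ω : Sample X T₀ T₁} :
    (jumpTime n (stopBefore s ω) < s ∧ s ≤ jumpTime (n + 1) (stopBefore s ω)) ↔
      (jumpTime n ω < s ∧ s ≤ jumpTime (n + 1) ω) := by
  rw [jumpTime_stopBefore, jumpTime_stopBefore]
  by_cases h1 : jumpTime n ω < s <;> by_cases h2 : jumpTime (n + 1) ω < s
  · simp [h1, h2]
  · simp [h1, h2, not_lt.1 h2]
  · exact absurd ((monotone_jumpTime ω n.le_succ).trans_lt h2) h1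
  · have h3 : ¬ (jumpTime n ω < s ∧ s ≤ jumpTime (n + 1) ω) := fun h => h1 h.1
    refine iff_of_false (fun h => ?_) h3
    rcases Nat.eq_zero_or_pos n with rfl | hn
    · exact h1 (by simpa using h.1)
    · simp [h1, hn.ne'] at h

theorem jumpTime_interval_unique' {s : Time T₀ T₁} {ω : Sample X T₀ T₁} {m n : ℕ}
    (hm : jumpTime m ω < s) (hm' : s ≤ jumpTime (m + 1) ω)
    (hn : jumpTime n ω < s) (hn' : s ≤ jumpTime (n + 1) ω) : m = n := by
  by_contra! h
  rcases lt_or_gt_of_ne h with h | h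
  · exact absurd hn (not_lt.2 (hm'.trans (monotone_jumpTime ω h)))
  · exact absurd hm (not_lt.2 (hn'.trans (monotone_jumpTime ω h)))

theorem jumpTime_lt_of_mark {n : ℕ} {ω : Sample X T₀ T₁} {z : Time T₀ T₁ × X}
    (h : mark (n + 1) ω = Sum.inl z) : jumpTime n ω < (z.1 : WithTop (Time T₀ T₁)) := by
  rw [← jumpTime_eq_of_mark h]
  refine (jumpTime_lt_succ n ω).resolve_right ?_
  rw [jumpTime_eq_of_mark h]
  exact WithTop.coe_ne_top

end Cut

variable {X : Type*} [MeasurableSpace X] {T₀ : ℝ} {T₁ : EReal} [Fact ((T₀ : EReal) < T₁)]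

/-! ### The canonical filtration -/

theorem measurable_mark_zero (t : Time T₀ T₁) :
    Measurable[canonicalFiltration t] (mark 0 : Sample X T₀ T₁ → _) := by
  have h : (mark 0 : Sample X T₀ T₁ → _) =
      (Sum.elim (fun x => Sum.inl (⊥, x)) fun _ : Unit => Sum.inr ()) ∘ state 0 := by
    ext1 ω
    obtain ⟨x, hx⟩ := exists_mark_zero ω
    simp [hx, state_eq_of_mark hx]
  have hg : Measurable (Sum.elim (fun x => Sum.inl (⊥, x)) fun _ => Sum.inr () :
      X ⊕ Unit → (Time T₀ T₁ × X) ⊕ Unit) := Measurable.sumElim (by fun_prop) measurable_const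
  rw [h]
  exact hg.comp ((comap_measurable (state 0)).mono le_sup_left le_rfl)

theorem measurableSet_mark (n : ℕ) {s t : Time T₀ T₁} (hst : s ≤ t) {B : Set X}
    (hB : MeasurableSet B) : MeasurableSet[canonicalFiltration t]
      ((mark n : Sample X T₀ T₁ → _) ⁻¹' (Sum.inl '' (Set.Iic s ×ˢ B))) := by
  rcases Nat.eq_zero_or_pos n with rfl | hn
  · exact measurable_mark_zero t (measurableSet_Iic.prod hB).inl_image
  · refine (le_sup_right : _ ≤ canonicalFiltration t) _
      (MeasurableSpace.measurableSet_generateFrom ⟨n, hn, s, hst, B, hB, ?_⟩)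
    ext ω
    exact mem_image_Iic_prod_iff

theorem isStoppingTime_jumpTime (n : ℕ) :
    IsStoppingTime canonicalFiltration (jumpTime n : Sample X T₀ T₁ → _) := by
  intro t
  convert! measurableSet_mark n (le_refl t) (MeasurableSet.univ (α := X)) using 1
  ext ω
  rw [Set.mem_preimage, mem_image_Iic_prod_iff]
  rcases mark_cases n ω with ⟨z, h1, h2, h3⟩ | ⟨h1, h2, h3⟩ <;> simp [h1, h2]

theorem measurable_stopAt (t : Time T₀ T₁) :
    Measurable[canonicalFiltration t] (stopAt t : Sample X T₀ T₁ → _) := by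
  refine measurable_of_measurable_mark fun n => measurable_of_Iic_prod fun s B hB => ?_
  convert! measurableSet_mark n (min_le_right s t) hB using 1
  ext ω
  rw [Set.mem_preimage, Set.mem_preimage, mark_stopAt]
  rcases mark_cases n ω with ⟨z, h1, h2, h3⟩ | ⟨h1, h2, h3⟩
  · by_cases h : z.1 ≤ t <;> simp [h1, h3, h]
  · simp [h1, h3]

/-- Knowing the past up to `t` is the same as knowing the path stopped at `t`. The generating events
are invariant under stopping, and conversely `stopAt t` is itself measurable at time `t`, so an
invariant event is the preimage of a measurable one. -/
theorem measurableSet_canonicalFiltration_iff {t : Time T₀ T₁} {A : Set (Sample X T₀ T₁)} :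
    MeasurableSet[canonicalFiltration t] A ↔ MeasurableSet A ∧ stopAt t ⁻¹' A = A := by
  refine ⟨fun h => ?_, fun ⟨h1, h2⟩ => h2 ▸ measurable_stopAt t h1⟩
  refine (?_ : canonicalFiltration t ≤ MeasurableSpace.invariants (stopAt t)) A h
  refine sup_le ?_ (MeasurableSpace.generateFrom_le ?_)
  · rintro _ ⟨C, hC, rfl⟩
    refine ⟨measurable_state 0 hC, ?_⟩
    ext ω
    rw [Set.mem_preimage, Set.mem_preimage, Set.mem_preimage, ← stateOf_mark, mark_stopAt,
      if_pos, stateOf_mark]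
    exact WithTop.coe_le_coe.2 bot_le
  · rintro _ ⟨n, -, s, hst, B, hB, rfl⟩
    refine ⟨(measurable_state n hB.inl_image).inter (measurable_jumpTime n measurableSet_Iic), ?_⟩
    ext ω
    rw [Set.mem_preimage, Set.mem_ofPred_eq, Set.mem_ofPred_eq, ← mem_image_Iic_prod_iff,
      ← mem_image_Iic_prod_iff, mark_stopAt]
    rcases mark_cases n ω with ⟨z, h1, h2, h3⟩ | ⟨h1, h2, h3⟩
    · by_cases h : z.1 ≤ t
      · simp [h1, h3, h]
      · simpa [h1, h3, h] using fun h' : z.1 ≤ s => (h (h'.trans hst)).elim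
    · simp [h1, h3]

/-- Every path is without jumps for some time after `t`, so stopping it at `t` or at some later `s`,
depending on the path, gives the same result. An event in all `𝓕_s`, `s > t`, is invariant under all
these stoppings, hence under `stopAt t`. -/
theorem isRightContinuous_canonicalFiltration :
    (canonicalFiltration (X := X) (T₀ := T₀) (T₁ := T₁)).IsRightContinuous := by
  refine ⟨fun t A hA => ?_⟩
  rw [Filtration.rightCont_eq] at hA
  have hA' : ∀ s > t, MeasurableSet[canonicalFiltration s] A := fun s hs =>
    (iInf₂_le s hs : _ ≤ canonicalFiltration s) A hA
  have key : ∀ ω : Sample X T₀ T₁, ∃ s > t, stopAt s ω = stopAt t ω := by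
    intro ω
    -- Either there is room before the next jump, or all jump times are at most `t` already and any
    -- later `s` will do.
    rcases exists_jumpTime_le_lt_or t ω with ⟨n, h1, h2⟩ | h
    · obtain ⟨s, hs, hs'⟩ : ∃ s : Time T₀ T₁, t < s ∧ (s : WithTop _) < jumpTime (n + 1) ω := by
        rcases hj : jumpTime (n + 1) ω with _ | r
        · obtain ⟨s, hs⟩ := exists_gt t
          exact ⟨s, hs, WithTop.coe_lt_top s⟩
        · rw [hj] at h2
          obtain ⟨s, hs⟩ := exists_between (WithTop.coe_lt_coe.1 h2)
          exact ⟨s, hs.1, WithTop.coe_lt_coe.2 hs.2⟩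
      refine ⟨s, hs, ?_⟩
      rw [stopAt_eq_truncate h1 h2,
        stopAt_eq_truncate (h1.trans (WithTop.coe_le_coe.2 (le_of_lt hs))) hs']
    · obtain ⟨s, hs⟩ := exists_gt t
      refine ⟨s, hs, ext_mark fun n => ?_⟩
      rw [mark_stopAt, mark_stopAt, if_pos (h n),
        if_pos ((h n).trans (WithTop.coe_le_coe.2 hs.le))]
  obtain ⟨s, hs⟩ := exists_gt t
  refine measurableSet_canonicalFiltration_iff.2
    ⟨(measurableSet_canonicalFiltration_iff.1 (hA' s hs)).1, ?_⟩
  ext ω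
  obtain ⟨s, hs, hω⟩ := key ω
  rw [Set.mem_preimage, ← hω, ← Set.mem_preimage,
    (measurableSet_canonicalFiltration_iff.1 (hA' s hs)).2]

theorem measurable_state_stoppingTime (n : ℕ) :
    Measurable[(isStoppingTime_jumpTime n).measurableSpace]
      (state n : Sample X T₀ T₁ → Ext X) := by
  intro C hC
  -- As `t_n` may be `⊤`, the σ-algebra at `t_n` asks for measurability with respect to the supremum
  -- of the filtration in addition to the conditions at each finite time.
  refine ⟨?_, fun t => ?_⟩
  · have hm : Measurable[⨆ t : Time T₀ T₁,
        canonicalFiltration (X := X) t] (mark n : Sample X T₀ T₁ → _) :=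
      measurable_of_Iic_prod fun s B hB =>
        (le_iSup (fun t : Time T₀ T₁ =>
          (canonicalFiltration t : MeasurableSpace (Sample X T₀ T₁))) s) _
          (measurableSet_mark n (le_refl s) hB)
    have : (state n : Sample X T₀ T₁ → _) ⁻¹' C = mark n ⁻¹' (stateOf ⁻¹' C) := by
      ext ω; simp
    rw [this]
    exact hm (measurable_stateOf hC)
  · convert! measurableSet_mark n (le_refl t) (measurable_inl hC) using 1
    ext ω
    rw [Set.mem_preimage, mem_image_Iic_prod_iff]
    rcases mark_cases n ω with ⟨z, h1, h2, h3⟩ | ⟨h1, h2, h3⟩ <;> simp [h1, h2]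

/-! ### The jump process -/

theorem adapted_jumpProcess :
    Adapted canonicalFiltration (jumpProcess : Time T₀ T₁ → Sample X T₀ T₁ → Ext X) := by
  intro t C hC
  rw [jumpProcess_preimage_eq]
  refine MeasurableSet.union (MeasurableSet.iUnion fun n => ?_) (MeasurableSet.inter ?_ ?_)
  · exact (measurableSet_mark n (le_refl t) (measurable_inl hC)).diff (isStoppingTime_jumpTime _ t)
  · exact MeasurableSet.iInter fun n => isStoppingTime_jumpTime n t
  · exact MeasurableSet.const _

theorem measurable_jumpProcess (t : Time T₀ T₁) :
    Measurable (jumpProcess t : Sample X T₀ T₁ → Ext X) :=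
  (adapted_jumpProcess t).mono (canonicalFiltration.le t) le_rfl

theorem isJumpProcess_jumpProcess :
    IsJumpProcess canonicalFiltration jumpTime state
      (jumpProcess : Time T₀ T₁ → Sample X T₀ T₁ → Ext X) where
  time_zero ω := rfl
  mark_zero ω := ω.2.1
  measurable_mark_zero := (comap_measurable (state 0)).mono le_sup_left le_rfl
  isMultivariatePointProcess :=
    { rightContinuous := isRightContinuous_canonicalFiltration
      pos := fun n hn ω => by
        obtain ⟨k, rfl⟩ := Nat.exists_eq_add_of_le' hn
        exact (ω.2.2 k).1
      measurable_mark := fun n _ => ⟨isStoppingTime_jumpTime n, measurable_state_stoppingTime n⟩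
      of_lt_top := fun n hn ω h => by
        obtain ⟨k, rfl⟩ := Nat.exists_eq_add_of_le' hn
        exact (ω.2.2 k).2.1 h
      of_eq_top := fun n hn ω h => by
        obtain ⟨k, rfl⟩ := Nat.exists_eq_add_of_le' hn
        exact ((ω.2.2 k).2.2 h).symm }
  eq_mark _ _ _ h1 h2 := jumpProcess_eq_state h1 h2
  eq_xInfty _ _ h := jumpProcess_eq_xInfty h

/-! ### Predictable functions -/

theorem predictable_le_prod : (canonicalFiltration (X := X) (T₀ := T₀) (T₁ := T₁)).predictable ≤
    (inferInstance : MeasurableSpace (Time T₀ T₁ × Sample X T₀ T₁)) :=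
  measurableSpace_le_predictable_of_measurableSet
    (fun A hA => (measurableSet_singleton _).prod (canonicalFiltration.le _ A hA))
    (fun _ A hA => measurableSet_Ioi.prod (canonicalFiltration.le _ A hA))

theorem measurable_fst_predictable :
    Measurable[(canonicalFiltration (X := X) (T₀ := T₀) (T₁ := T₁)).predictable]
      (Prod.fst : Time T₀ T₁ × Sample X T₀ T₁ → Time T₀ T₁) := by
  refine measurable_of_Ioi fun t => ?_
  rw [← Set.prod_univ]
  exact measurableSet_predictable_Ioi_prod MeasurableSet.univ

/-- Dropping the marks at time `s` itself makes the stopped path left-continuous information; this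
is one half of the description of predictable functions by `stopBefore`. -/
theorem measurable_stopBefore_predictable :
    Measurable[(canonicalFiltration (X := X) (T₀ := T₀) (T₁ := T₁)).predictable]
      fun z : Time T₀ T₁ × Sample X T₀ T₁ => stopBefore z.1 z.2 := by
  refine measurable_of_measurable_mark fun n => ?_
  rcases n with _ | n
  · intro C hC
    have : (fun z : Time T₀ T₁ × Sample X T₀ T₁ => mark 0 (stopBefore z.1 z.2)) ⁻¹' C =
        {⊥} ×ˢ (mark 0 ⁻¹' C) ∪ Set.Ioi ⊥ ×ˢ (mark 0 ⁻¹' C) := by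
      ext ⟨s, ω⟩
      simp [mark_stopBefore, ← or_and_right, eq_or_ne, bot_lt_iff_ne_bot]
    rw [this]
    exact (measurableSet_predictable_singleton_bot_prod (measurable_mark_zero _ hC)).union
      (measurableSet_predictable_Ioi_prod (measurable_mark_zero _ hC))
  · refine measurable_of_Iic_prod fun r B hB => ?_
    -- A jump before `s` is a jump up to some `v < s` with `v` in a countable dense set, so the
    -- event is a countable union of generators `]v, ∞[ × A` with `A` in `𝓕_v`.
    obtain ⟨D, hDc, hD⟩ := TopologicalSpace.exists_countable_dense (Time T₀ T₁)
    have : (fun z : Time T₀ T₁ × Sample X T₀ T₁ => mark (n + 1) (stopBefore z.1 z.2)) ⁻¹'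
        (Sum.inl '' (Set.Iic r ×ˢ B)) =
        ⋃ v ∈ D, Set.Ioi v ×ˢ (mark (n + 1) ⁻¹' (Sum.inl '' (Set.Iic (min r v) ×ˢ B))) := by
      ext ⟨s, ω⟩
      simp only [Set.mem_preimage, mark_stopBefore, Set.mem_iUnion, Set.mem_prod, Set.mem_Ioi,
        exists_prop]
      rcases mark_cases (n + 1) ω with ⟨z, h1, h2, h3⟩ | ⟨h1, h2, h3⟩
      · simp only [h1, h3]
        by_cases h : z.1 < s
        · simp only [Nat.succ_ne_zero, WithTop.coe_lt_coe, h, or_true, if_true]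
          constructor
          · rintro ⟨z', ⟨hz1, hz2⟩, hz⟩
            obtain rfl := Sum.inl_injective hz
            obtain ⟨v, hv, hv1, hv2⟩ := hD.exists_between h
            exact ⟨v, hv, hv2, z', ⟨le_min hz1 hv1.le, hz2⟩, rfl⟩
          · rintro ⟨v, hv, hv2, z', ⟨hz1, hz2⟩, hz⟩
            exact ⟨z', ⟨(le_min_iff.1 (Set.mem_Iic.1 hz1)).1, hz2⟩, hz⟩
        · simp only [Nat.succ_ne_zero, WithTop.coe_lt_coe, h, or_self, if_false]
          constructor
          · rintro ⟨z', -, hz⟩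
            simp at hz
          · rintro ⟨v, hv, hv2, z', ⟨hz1, hz2⟩, hz⟩
            obtain rfl := Sum.inl_injective hz
            exact absurd (lt_of_le_of_lt (le_min_iff.1 (Set.mem_Iic.1 hz1)).2 hv2) h
      · simp [h1, h3]
    rw [this]
    exact MeasurableSet.biUnion hDc fun v _ =>
      measurableSet_predictable_Ioi_prod (measurableSet_mark _ (min_le_right _ _) hB)

/-- On a generator `]i, ∞[ × A` with `A` in `𝓕_i`, a time `s > i` comes too late to change the path
stopped at `i`. -/
theorem predictable_le_invariants :
    (canonicalFiltration (X := X) (T₀ := T₀) (T₁ := T₁)).predictable ≤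
      MeasurableSpace.invariants fun z : Time T₀ T₁ × Sample X T₀ T₁ =>
        (z.1, stopBefore z.1 z.2) := by
  refine measurableSpace_le_predictable_of_measurableSet (fun A hA => ?_) (fun i A hA => ?_)
  · refine ⟨(measurableSet_singleton _).prod (canonicalFiltration.le _ A hA), ?_⟩
    obtain ⟨-, hA'⟩ := measurableSet_canonicalFiltration_iff.1 hA
    ext ⟨s, ω⟩
    simp only [Set.mem_preimage, Set.mem_prod, Set.mem_singleton_iff, and_congr_right_iff]
    rintro rfl
    rw [← hA', Set.mem_preimage, stopAt_stopBefore (Or.inr rfl), ← Set.mem_preimage]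
  · refine ⟨measurableSet_Ioi.prod (canonicalFiltration.le _ A hA), ?_⟩
    obtain ⟨-, hA'⟩ := measurableSet_canonicalFiltration_iff.1 hA
    ext ⟨s, ω⟩
    simp only [Set.mem_preimage, Set.mem_prod, Set.mem_Ioi, and_congr_right_iff]
    intro hs
    rw [← hA', Set.mem_preimage, stopAt_stopBefore (Or.inl hs), ← Set.mem_preimage]

theorem predictable_apply_stopBefore {Y : Type*} [MeasurableSpace Y]
    {W : (Time T₀ T₁ × Sample X T₀ T₁) × Y → ℝ≥0∞}
    (hW : Measurable[canonicalFiltration.predictable.prod inferInstance] W)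
    (s : Time T₀ T₁) (ω : Sample X T₀ T₁) (y : Y) :
    W ((s, stopBefore s ω), y) = W ((s, ω), y) := by
  have h1 : Measurable[canonicalFiltration.predictable] fun z => W (z, y) :=
    hW.comp (@measurable_prodMk_right _ _ canonicalFiltration.predictable _ y)
  have h2 := h1.mono predictable_le_invariants le_rfl
  exact congrFun (MeasurableSpace.comp_eq_of_measurable_invariants h2) (s, ω)

theorem measurable_stopBefore_predictable_prodMk :
    Measurable[(canonicalFiltration (X := X) (T₀ := T₀) (T₁ := T₁)).predictable]
      fun z : Time T₀ T₁ × Sample X T₀ T₁ => (z.1, stopBefore z.1 z.2) :=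
  measurable_fst_predictable.prodMk measurable_stopBefore_predictable

/-- The converse of `predictable_le_invariants`: an invariant function factors through the
predictable map `(s, ω) ↦ (s, stopBefore s ω)`. All predictability claims below are reduced to a
pathwise equation in this way. -/
theorem measurable_predictable_of_stopBefore {Y : Type*} [MeasurableSpace Y]
    {W : Time T₀ T₁ × Sample X T₀ T₁ → Y} (hW : Measurable W)
    (h : ∀ s ω, W (s, stopBefore s ω) = W (s, ω)) :
    Measurable[canonicalFiltration.predictable] W := by
  have h1 : W = W ∘ fun z : Time T₀ T₁ × Sample X T₀ T₁ => (z.1, stopBefore z.1 z.2) := by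
    ext1 ⟨s, ω⟩; exact (h s ω).symm
  rw [h1]
  exact hW.comp measurable_stopBefore_predictable_prodMk

theorem measurable_predictable_prod_of_stopBefore {Y Y' : Type*} [MeasurableSpace Y]
    [MeasurableSpace Y'] {W : (Time T₀ T₁ × Sample X T₀ T₁) × Y → Y'} (hW : Measurable W)
    (h : ∀ s ω y, W ((s, stopBefore s ω), y) = W ((s, ω), y)) :
    Measurable[canonicalFiltration.predictable.prod inferInstance] W := by
  have h1 : W = W ∘ fun z : (Time T₀ T₁ × Sample X T₀ T₁) × Y =>
      ((z.1.1, stopBefore z.1.1 z.1.2), z.2) := by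
    ext1 ⟨⟨s, ω⟩, y⟩; exact (h s ω y).symm
  have hfst := @measurable_fst _ Y (canonicalFiltration (X := X) (T₀ := T₀) (T₁ := T₁)).predictable
    inferInstance
  rw [h1]
  exact hW.comp ((measurable_stopBefore_predictable_prodMk.comp hfst).prodMk
    (@measurable_snd _ Y canonicalFiltration.predictable inferInstance))

/-! ### Functions of a mark that vanish if the jump does not happen -/

section OnJump

variable {Z : Type*}

/-- Extend a function of a mark by `0` to the mark `inr ()` of a jump that does not happen. -/
def onJump (f : Z → ℝ≥0∞) : Z ⊕ Unit → ℝ≥0∞ := Sum.elim f fun _ => 0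

@[simp] theorem onJump_inl (f : Z → ℝ≥0∞) (z : Z) : onJump f (Sum.inl z) = f z := rfl
@[simp] theorem onJump_inr (f : Z → ℝ≥0∞) (a : Unit) : onJump f (Sum.inr a) = 0 := rfl

theorem measurable_onJump {Θ : Type*} [MeasurableSpace Θ] [MeasurableSpace Z]
    {F : Θ → Z → ℝ≥0∞} (hF : Measurable (Function.uncurry F)) {g : Θ → Z ⊕ Unit}
    (hg : Measurable g) : Measurable fun θ => onJump (F θ) (g θ) := by
  have h : Measurable (Sum.elim (Function.uncurry F) (fun _ => 0) :
      (Θ × Z) ⊕ (Θ × Unit) → ℝ≥0∞) := hF.sumElim measurable_const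
  convert! (h.comp (MeasurableEquiv.prodSumDistrib Θ Z Unit).measurable).comp
    (measurable_id.prodMk hg) using 1
  ext θ
  simp only [Function.comp_apply, id_eq]
  rcases g θ with z | a <;> rfl

end OnJump

/-! ### Integrals over the waiting interval up to the next jump. -/

section Wait

variable {T₀ : ℝ} {T₁ : EReal}

/-- The times `s` with `t < s ≤ τ`. -/
def waitInterval (t : Time T₀ T₁) (τ : WithTop (Time T₀ T₁)) : Set (Time T₀ T₁) :=
  {s | t < s ∧ s ≤ τ}

theorem measurableSet_waitInterval (t : Time T₀ T₁) (τ : WithTop (Time T₀ T₁)) :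
    MeasurableSet (waitInterval t τ) :=
  measurableSet_Ioi.inter (WithTop.measurable_coe measurableSet_Iic)

theorem measurable_lintegral_waitInterval {Θ : Type*} [MeasurableSpace Θ] {t : Θ → Time T₀ T₁}
    {τ : Θ → WithTop (Time T₀ T₁)} (ht : Measurable t) (hτ : Measurable τ)
    {F : Θ → Time T₀ T₁ → ℝ≥0∞} (hF : Measurable (Function.uncurry F)) :
    Measurable fun θ => ∫⁻ s in waitInterval (t θ) (τ θ), F θ s := by
  simp_rw [← lintegral_indicator (measurableSet_waitInterval _ _)]
  have hS : MeasurableSet {p : Θ × Time T₀ T₁ | t p.1 < p.2 ∧ p.2 ≤ τ p.1} :=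
    (measurableSet_lt (by fun_prop) (by fun_prop)).inter
      (measurableSet_le (by fun_prop) (hτ.comp measurable_fst))
  exact (hF.indicator hS).lintegral_prod_right'

theorem measurable_lintegral_jumpMeasure {X : Type*} [MeasurableSpace X] [StandardBorelSpace X]
    (q : QFunction X T₀ T₁) {Θ : Type*} [MeasurableSpace Θ]
    {F : Θ → X → ℝ≥0∞} (hF : Measurable (Function.uncurry F)) {t : Θ → Time T₀ T₁} {x : Θ → X}
    (ht : Measurable t) (hx : Measurable x) :
    Measurable fun θ => ∫⁻ y, F θ y ∂(q.jumpMeasure (x θ) (t θ)) :=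
  Measurable.lintegral_kernel_prod_right (κ := q.jumpKernel.comap (fun θ => (t θ, x θ))
      (ht.prodMk hx)) hF

variable {X : Type*} [Fact ((T₀ : EReal) < T₁)]

/-- Stopping before `s` alters `t_{n+1}` only when it is at least `s`, and then replaces it by `⊤`;
the part of the waiting interval up to `s` is the same. -/
theorem setLIntegral_waitInterval_stopBefore (n : ℕ) (s u : Time T₀ T₁) (ω : Sample X T₀ T₁)
    (f : Time T₀ T₁ → ℝ≥0∞) :
    ∫⁻ r in waitInterval u (jumpTime (n + 1) (stopBefore s ω)), (Set.Iic s).indicator f r =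
      ∫⁻ r in waitInterval u (jumpTime (n + 1) ω), (Set.Iic s).indicator f r := by
  rw [setLIntegral_indicator measurableSet_Iic, setLIntegral_indicator measurableSet_Iic]
  congr 2
  ext r
  refine and_congr_right fun hr : r ≤ s => and_congr_right fun _ => ?_
  rw [jumpTime_stopBefore]
  by_cases h : jumpTime (n + 1) ω < s
  · rw [if_pos (Or.inr h)]
  · rw [if_neg (by simpa using h)]
    simpa using (WithTop.coe_le_coe.2 hr).trans (not_lt.1 h)

end Wait

variable {X : Type*} [MeasurableSpace X] {T₀ : ℝ} {T₁ : EReal} [Fact ((T₀ : EReal) < T₁)]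

/-! ### Integrals with respect to the point process and its compensator -/

theorem lintegral_pointMeasure (ω : Sample X T₀ T₁) {g : Time T₀ T₁ × X → ℝ≥0∞}
    (hg : Measurable g) :
    ∫⁻ z, g z ∂(pointMeasure ω) = ∑' n, onJump g (mark (n + 1) ω) := by
  rw [pointMeasure, lintegral_sum_measure]
  refine tsum_congr fun n => ?_
  rcases mark_cases (n + 1) ω with ⟨z, h1, h2, h3⟩ | ⟨h1, h2, h3⟩
  · rw [dif_neg (by simp [h1])]
    simp only [h1, h2, h3, Sum.elim_inl, WithTop.untop_coe, onJump_inl]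
    exact lintegral_dirac' _ hg
  · simp [h1, h3]

theorem measurableSet_interval (n : ℕ) :
    MeasurableSet {p : Time T₀ T₁ × Sample X T₀ T₁ |
      jumpTime n p.2 < p.1 ∧ p.1 ≤ jumpTime (n + 1) p.2} :=
  (measurableSet_lt ((measurable_jumpTime n).comp measurable_snd)
    (WithTop.measurable_coe.comp measurable_fst)).inter
    (measurableSet_le (WithTop.measurable_coe.comp measurable_fst)
      ((measurable_jumpTime (n + 1)).comp measurable_snd))

section Compensator

variable [StandardBorelSpace X] (q : QFunction X T₀ T₁)

theorem lintegral_compensator (ω : Sample X T₀ T₁) {g : Time T₀ T₁ × X → ℝ≥0∞}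
    (hg : Measurable g) :
    ∫⁻ z, g z ∂(compensator q ω) =
      ∑' n, onJump (fun z => ∫⁻ s in waitInterval z.1 (jumpTime (n + 1) ω),
        ∫⁻ y, g (s, y) ∂(q.jumpMeasure z.2 s)) (mark n ω) := by
  rw [compensator, lintegral_sum_measure]
  refine tsum_congr fun n => ?_
  rcases mark_cases n ω with ⟨z, h1, h2, h3⟩ | ⟨h1, h2, h3⟩
  · rw [h1, h2, h3]
    simp only [Sum.elim_inl, WithTop.coe_lt_coe, onJump_inl, waitInterval]
    rw [Measure.lintegral_bind (q.measurable_map_jumpMeasure z.2).aemeasurable hg.aemeasurable]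
    refine lintegral_congr fun s => ?_
    rw [lintegral_map hg measurable_prodMk_left]
  · rw [h2, h3]
    simp [xInfty]

/-- The law of the next jump given the past: its density is `q(x_n, s, dy) ds`, as long as the
jump has not happened. -/
def HasIntensity (P : Measure (Sample X T₀ T₁)) : Prop :=
  ∀ (n : ℕ) (F : Sample X T₀ T₁ × Time T₀ T₁ × X → ℝ≥0∞), Measurable F →
    ∫⁻ ω, onJump (fun z => F (truncate n ω, z)) (mark (n + 1) ω) ∂P =
      ∫⁻ ω, onJump (fun z => ∫⁻ s in waitInterval z.1 (jumpTime (n + 1) ω),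
        ∫⁻ y, F (truncate n ω, s, y) ∂(q.jumpMeasure z.2 s)) (mark n ω) ∂P

variable {q} {P : Measure (Sample X T₀ T₁)}

/-- The compensator identity is tested with `F(truncate n ω, s, y)` restricted to `]t_n, t_{n+1}]`.
This is predictable because there `truncate n ω` is the path stopped before `s`, and the
disjointness of these intervals leaves only the summand with index `n` on both sides. -/
theorem HasIntensity.of_isCompensator
    (h : IsCompensator P canonicalFiltration pointMeasure (compensator q)) :
    HasIntensity q P := by
  intro n F hF
  set S : Set (Time T₀ T₁ × Sample X T₀ T₁) :=
    {p | jumpTime n p.2 < p.1 ∧ p.1 ≤ jumpTime (n + 1) p.2} with hS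
  set W : (Time T₀ T₁ × Sample X T₀ T₁) × X → ℝ≥0∞ :=
    (Prod.fst ⁻¹' S).indicator fun p => F (truncate n p.1.2, p.1.1, p.2) with hW
  have hWm : Measurable W := by
    refine Measurable.indicator ?_ (measurable_fst (measurableSet_interval n))
    exact hF.comp (((measurable_truncate n).comp (by fun_prop)).prodMk (by fun_prop))
  have hW1 : ∀ s ω y, (s, ω) ∈ S → W ((s, ω), y) = F (truncate n ω, s, y) := fun s ω y h =>
    Set.indicator_of_mem (s := Prod.fst ⁻¹' S) h _
  have hW0 : ∀ s ω y, (s, ω) ∉ S → W ((s, ω), y) = 0 := fun s ω y h =>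
    Set.indicator_of_notMem (s := Prod.fst ⁻¹' S) h _
  have hWp := measurable_predictable_prod_of_stopBefore hWm fun s ω y => by
    by_cases hs : (s, ω) ∈ S
    · have hs' : (s, stopBefore s ω) ∈ S := stopBefore_mem_interval_iff.2 hs
      have htr : truncate n (stopBefore s ω) = truncate n ω := by
        rw [stopBefore_eq_truncate hs.1 hs.2, truncate_truncate_of_le le_rfl]
      rw [hW1 _ _ _ hs, hW1 _ _ _ hs', htr]
    · have hs' : (s, stopBefore s ω) ∉ S := fun h => hs (stopBefore_mem_interval_iff.1 h)
      rw [hW0 _ _ _ hs, hW0 _ _ _ hs']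
  have hsec : ∀ ω, Measurable fun z : Time T₀ T₁ × X => W ((z.1, ω), z.2) := fun ω =>
    hWm.comp (by fun_prop)
  have key := h.lintegral_eq W hWp
  simp_rw [lintegral_pointMeasure _ (hsec _), lintegral_compensator q _ (hsec _)] at key
  refine (lintegral_congr fun ω => ?_).trans (key.trans (lintegral_congr fun ω => ?_))
  · rw [tsum_eq_single n]
    · rcases hm : mark (n + 1) ω with z | a
      · have hz : (z.1, ω) ∈ S := ⟨jumpTime_lt_of_mark hm, (jumpTime_eq_of_mark hm).ge⟩
        rw [onJump_inl, onJump_inl, hW1 _ _ _ hz]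
      · simp
    · intro k hk
      rcases hm : mark (k + 1) ω with z | a
      · rw [onJump_inl, hW0]
        intro hz
        exact hk (jumpTime_interval_unique' (jumpTime_lt_of_mark hm) (jumpTime_eq_of_mark hm).ge
          hz.1 hz.2)
      · simp
  · rw [tsum_eq_single n]
    · rcases hm : mark n ω with z | a
      · rw [onJump_inl, onJump_inl]
        refine setLIntegral_congr_fun (measurableSet_waitInterval _ _) fun s hs => ?_
        refine lintegral_congr fun y => ?_
        have hz : (s, ω) ∈ S := ⟨by
          change jumpTime n ω < s
          rw [jumpTime_eq_of_mark hm]; exact WithTop.coe_lt_coe.2 hs.1, hs.2⟩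
        rw [hW1 _ _ _ hz]
      · simp
    · intro k hk
      rcases hm : mark k ω with z | a
      · rw [onJump_inl]
        refine (setLIntegral_congr_fun (measurableSet_waitInterval _ _) fun s hs => ?_).trans
          (lintegral_zero (μ := volume.restrict _))
        refine (lintegral_congr fun y => ?_).trans lintegral_zero
        rw [hW0]
        intro hz
        refine hk (jumpTime_interval_unique' ?_ hs.2 hz.1 hz.2)
        rw [jumpTime_eq_of_mark hm]
        exact WithTop.coe_lt_coe.2 hs.1
      · simp

theorem compensator_Iic_prod_eq_tsum (q : QFunction X T₀ T₁) (s : Time T₀ T₁)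
    (ω : Sample X T₀ T₁) {B : Set X} (hB : MeasurableSet B) :
    compensator q ω (Set.Iic s ×ˢ B) =
      ∑' n, onJump (fun z => ∫⁻ r in waitInterval z.1 (jumpTime (n + 1) ω),
        (Set.Iic s).indicator (fun r => q.jumpMeasure z.2 r B) r) (mark n ω) := by
  have hm : MeasurableSet (Set.Iic s ×ˢ B) := measurableSet_Iic.prod hB
  rw [← lintegral_indicator_one hm, lintegral_compensator q _ (measurable_one.indicator hm)]
  refine tsum_congr fun n => ?_
  congr 1
  ext z
  refine lintegral_congr fun r => ?_
  by_cases hr : r ≤ s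
  · rw [Set.indicator_of_mem (Set.mem_Iic.2 hr), ← lintegral_indicator_one hB]
    refine lintegral_congr fun y => ?_
    by_cases hy : y ∈ B
    · rw [Set.indicator_of_mem hy, Set.indicator_of_mem (show (r, y) ∈ Set.Iic s ×ˢ B from ⟨hr, hy⟩)]; rfl
    · rw [Set.indicator_of_notMem hy, Set.indicator_of_notMem fun h => hy h.2]
  · rw [Set.indicator_of_notMem (by simpa using hr)]
    refine (lintegral_congr fun y => ?_).trans lintegral_zero
    rw [Set.indicator_of_notMem fun h => hr h.1]

/-- Up to time `s` the compensator uses only marks before `s`: a mark removed by `stopBefore s`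
opens a waiting interval that begins at or after `s`. -/
theorem isPredictableRandomMeasure_compensator (q : QFunction X T₀ T₁) :
    IsPredictableRandomMeasure canonicalFiltration
      (compensator q : Sample X T₀ T₁ → Measure (Time T₀ T₁ × X)) := by
  intro B hB
  refine measurable_predictable_of_stopBefore ?_ fun s ω => ?_
  · simp_rw [compensator_Iic_prod_eq_tsum q _ _ hB]
    refine Measurable.tsum fun n => measurable_onJump ?_ ((measurable_mark n).comp (by fun_prop))
    refine measurable_lintegral_waitInterval (by fun_prop)
      ((measurable_jumpTime (n + 1)).comp (by fun_prop)) ?_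
    have hS : MeasurableSet {r : ((Time T₀ T₁ × Sample X T₀ T₁) × Time T₀ T₁ × X) × Time T₀ T₁ |
        r.2 ≤ r.1.1.1} := measurableSet_le (by fun_prop) (by fun_prop)
    exact ((q.jumpKernel.measurable_coe hB).comp
      (measurable_snd.prodMk (measurable_snd.comp (measurable_snd.comp measurable_fst)))).indicator
        hS
  · simp only [compensator_Iic_prod_eq_tsum q _ _ hB, setLIntegral_waitInterval_stopBefore]
    refine tsum_congr fun n => ?_
    rw [mark_stopBefore]
    split_ifs with hc
    · rfl
    · rcases mark_cases n ω with ⟨z, h1, h2, h3⟩ | ⟨h1, h2, h3⟩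
      · push Not at hc
        rw [h1, WithTop.coe_le_coe] at hc
        rw [h3, onJump_inr, onJump_inl]
        symm
        refine (setLIntegral_congr_fun (measurableSet_waitInterval _ _) fun r hr => ?_).trans
          (lintegral_zero (μ := volume.restrict _))
        rw [Set.indicator_of_notMem]
        exact fun hr' => absurd hr.1 (not_lt.2 (le_trans hr' hc.2))
      · rw [h3, onJump_inr]

/-- A predictable function on `]t_n, t_{n+1}]` depends on the path only through `truncate n ω`, so
it is an admissible test function for the `n`-th intensity identity, and the identities are added
up. -/
theorem HasIntensity.isCompensator (h : HasIntensity q P) :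
    IsCompensator P canonicalFiltration pointMeasure (compensator q) where
  predictable := isPredictableRandomMeasure_compensator q
  lintegral_eq W hW := by
    have hWm : Measurable W := hW.mono
      (sup_le_sup (MeasurableSpace.comap_mono predictable_le_prod) le_rfl) le_rfl
    have hsec : ∀ ω, Measurable fun z : Time T₀ T₁ × X => W ((z.1, ω), z.2) := fun ω =>
      hWm.comp (by fun_prop)
    have hF : Measurable fun p : Sample X T₀ T₁ × Time T₀ T₁ × X => W ((p.2.1, p.1), p.2.2) :=
      hWm.comp (by fun_prop)
    have hcut : ∀ (n : ℕ) (s : Time T₀ T₁) (ω : Sample X T₀ T₁) (y : X), jumpTime n ω < s →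
        s ≤ jumpTime (n + 1) ω → W ((s, ω), y) = W ((s, truncate n ω), y) := by
      intro n s ω y h1 h2
      rw [← stopBefore_eq_truncate h1 h2, predictable_apply_stopBefore hW]
    simp_rw [lintegral_pointMeasure _ (hsec _), lintegral_compensator q _ (hsec _)]
    have hL : ∀ n ω, onJump (fun z : Time T₀ T₁ × X => W ((z.1, ω), z.2)) (mark (n + 1) ω) =
        onJump (fun z : Time T₀ T₁ × X => W ((z.1, truncate n ω), z.2)) (mark (n + 1) ω) := by
      intro n ω
      rcases hm : mark (n + 1) ω with z | a
      · exact hcut n z.1 ω z.2 (jumpTime_lt_of_mark hm) (jumpTime_eq_of_mark hm).ge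
      · rfl
    have hR : ∀ n ω, onJump (fun z => ∫⁻ s in waitInterval z.1 (jumpTime (n + 1) ω),
          ∫⁻ y, W ((s, ω), y) ∂(q.jumpMeasure z.2 s)) (mark n ω) =
        onJump (fun z => ∫⁻ s in waitInterval z.1 (jumpTime (n + 1) ω),
          ∫⁻ y, W ((s, truncate n ω), y) ∂(q.jumpMeasure z.2 s)) (mark n ω) := by
      intro n ω
      rcases hm : mark n ω with z | a
      · refine setLIntegral_congr_fun (measurableSet_waitInterval _ _) fun s hs => ?_
        refine lintegral_congr fun y => hcut n s ω y ?_ hs.2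
        rw [jumpTime_eq_of_mark hm]
        exact WithTop.coe_lt_coe.2 hs.1
      · rfl
    simp_rw [hL, hR]
    rw [lintegral_tsum, lintegral_tsum]
    · exact tsum_congr fun n => h n _ hF
    · intro n
      refine (measurable_onJump ?_ (measurable_mark n)).aemeasurable
      refine measurable_lintegral_waitInterval (by fun_prop)
        ((measurable_jumpTime (n + 1)).comp (by fun_prop)) ?_
      refine measurable_lintegral_jumpMeasure q ?_ (by fun_prop) (by fun_prop)
      exact hWm.comp (((measurable_snd.comp measurable_fst).prodMk
        ((measurable_truncate n).comp (by fun_prop))).prodMk measurable_snd)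
    · intro n
      refine (measurable_onJump ?_ (measurable_mark (n + 1))).aemeasurable
      exact hWm.comp ((measurable_fst.comp measurable_snd).prodMk
        ((measurable_truncate n).comp (by fun_prop)) |>.prodMk (by fun_prop))

end Compensator

/-! ### The law of the next jump given the past -/

/-- Both sides are integrals of `f` against the images under `φ` of measures with densities, and
those agree as soon as they agree on sets. This reduces test functions of the history to indicators,
where finiteness permits subtraction. -/
theorem lintegral_mul_comp_eq {Ω Ω' : Type*} [MeasurableSpace Ω] [MeasurableSpace Ω']
    {P : Measure Ω} {g₁ g₂ : Ω → ℝ≥0∞} (h₁ : Measurable g₁) (h₂ : Measurable g₂) {φ : Ω → Ω'}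
    (hφ : Measurable φ)
    (h : ∀ A, MeasurableSet A →
      ∫⁻ ω, g₁ ω * A.indicator 1 (φ ω) ∂P = ∫⁻ ω, g₂ ω * A.indicator 1 (φ ω) ∂P)
    {f : Ω' → ℝ≥0∞} (hf : Measurable f) :
    ∫⁻ ω, g₁ ω * f (φ ω) ∂P = ∫⁻ ω, g₂ ω * f (φ ω) ∂P := by
  have key : ∀ {g : Ω → ℝ≥0∞}, Measurable g → ∀ {f : Ω' → ℝ≥0∞}, Measurable f →
      ∫⁻ ω, f ω ∂((P.withDensity g).map φ) = ∫⁻ ω, g ω * f (φ ω) ∂P := by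
    intro g hg f hf
    rw [lintegral_map hf hφ]
    exact lintegral_withDensity_eq_lintegral_mul _ hg (hf.comp hφ)
  rw [← key h₁ hf, ← key h₂ hf]
  congr 1
  refine Measure.ext fun A hA => ?_
  rw [← lintegral_indicator_one hA, ← lintegral_indicator_one hA,
    key h₁ (measurable_one.indicator hA), key h₂ (measurable_one.indicator hA), h A hA]

theorem lintegral_eq_of_add_eq {Ω : Type*} [MeasurableSpace Ω] {P : Measure Ω}
    {a b c d : Ω → ℝ≥0∞} (hb : Measurable b) (hd : Measurable d)
    (h : ∀ ω, a ω + b ω = c ω + d ω) (hbd : ∫⁻ ω, b ω ∂P = ∫⁻ ω, d ω ∂P)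
    (hfin : ∫⁻ ω, b ω ∂P ≠ ∞) : ∫⁻ ω, a ω ∂P = ∫⁻ ω, c ω ∂P := by
  have h' := lintegral_congr (μ := P) h
  rw [lintegral_add_right _ hb, lintegral_add_right _ hd, ← hbd] at h'
  exact (ENNReal.add_left_inj hfin).1 h'

theorem lintegral_ne_top_of_le_one {Ω : Type*} [MeasurableSpace Ω] {P : Measure Ω}
    [IsProbabilityMeasure P] {f : Ω → ℝ≥0∞} (h : ∀ ω, f ω ≤ 1) : ∫⁻ ω, f ω ∂P ≠ ∞ :=
  ne_top_of_le_ne_top ENNReal.one_ne_top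
    ((lintegral_mono h).trans (by simp [lintegral_const, measure_univ]))

theorem indicator_one_le_one {Ω : Type*} (A : Set Ω) (ω : Ω) :
    A.indicator (1 : Ω → ℝ≥0∞) ω ≤ 1 := by
  by_cases h : ω ∈ A <;> simp [h]

/-! ### Surviving without a jump, given the history. -/

section

variable {X : Type*} {T₀ : ℝ} {T₁ : EReal}

/-- The indicator of the event that the time of a mark is in `S`. -/
def inTimes (S : Set (Time T₀ T₁)) (m : (Time T₀ T₁ × X) ⊕ Unit) : ℝ≥0∞ :=
  onJump (fun z => S.indicator 1 z.1) m

@[simp] theorem inTimes_inl (S : Set (Time T₀ T₁)) (z : Time T₀ T₁ × X) :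
    inTimes S (Sum.inl z) = S.indicator 1 z.1 := rfl
@[simp] theorem inTimes_inr (S : Set (Time T₀ T₁)) (a : Unit) :
    inTimes S (Sum.inr a : (Time T₀ T₁ × X) ⊕ Unit) = 0 := rfl

theorem inTimes_eq_zero_or_one (S : Set (Time T₀ T₁)) (m : (Time T₀ T₁ × X) ⊕ Unit) :
    inTimes S m = 0 ∨ inTimes S m = 1 := by
  rcases m with z | a
  · by_cases h : z.1 ∈ S <;> simp [h]
  · simp

theorem inTimes_le_one (S : Set (Time T₀ T₁)) (m : (Time T₀ T₁ × X) ⊕ Unit) :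
    inTimes S m ≤ 1 := by
  rcases inTimes_eq_zero_or_one S m with h | h <;> simp [h]

theorem measurable_inTimes [MeasurableSpace X] {S : Set (Time T₀ T₁)} (hS : MeasurableSet S) :
    Measurable (inTimes S : (Time T₀ T₁ × X) ⊕ Unit → ℝ≥0∞) :=
  ((measurable_one.indicator hS).comp measurable_fst).sumElim measurable_const

variable [Fact ((T₀ : EReal) < T₁)]

/-- The indicator of the event that `t_n ∈ S` and `t_{n+1} ∉ S`. -/
def alive (S : Set (Time T₀ T₁)) (n : ℕ) (ω : Sample X T₀ T₁) : ℝ≥0∞ :=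
  inTimes S (mark n ω) * (1 - inTimes S (mark (n + 1) ω))

theorem inTimes_mul_add_alive (S : Set (Time T₀ T₁)) (n : ℕ) (ω : Sample X T₀ T₁) :
    inTimes S (mark n ω) * inTimes S (mark (n + 1) ω) + alive S n ω = inTimes S (mark n ω) := by
  rw [alive, ← mul_add, add_tsub_cancel_of_le (inTimes_le_one _ _), mul_one]

variable [MeasurableSpace X]

theorem measurable_alive {S : Set (Time T₀ T₁)} (hS : MeasurableSet S) (n : ℕ) :
    Measurable (alive S n : Sample X T₀ T₁ → ℝ≥0∞) :=
  ((measurable_inTimes hS).comp (measurable_mark n)).mul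
    (measurable_const.sub ((measurable_inTimes hS).comp (measurable_mark (n + 1))))

theorem measurable_alive_Iio (n : ℕ) :
    Measurable fun p : Time T₀ T₁ × Sample X T₀ T₁ => alive (Set.Iio p.1) n p.2 := by
  have h : ∀ k, Measurable fun p : Time T₀ T₁ × Sample X T₀ T₁ =>
      inTimes (Set.Iio p.1) (mark k p.2) := fun k => by
    refine measurable_onJump ?_ ((measurable_mark k).comp measurable_snd)
    have hS : MeasurableSet {r : (Time T₀ T₁ × Sample X T₀ T₁) × Time T₀ T₁ × X |
        r.2.1 < r.1.1} := measurableSet_lt (by fun_prop) (by fun_prop)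
    exact (measurable_const (a := (1 : ℝ≥0∞))).indicator hS
  exact (h n).mul (measurable_const.sub (h (n + 1)))

section

variable [StandardBorelSpace X] (q : QFunction X T₀ T₁)

/-- The joint law of the history up to the `n`-th jump and of the next jump. -/
def HasJumpLaw (P : Measure (Sample X T₀ T₁)) : Prop :=
  ∀ (n : ℕ) (F : Sample X T₀ T₁ × Time T₀ T₁ × X → ℝ≥0∞), Measurable F →
    ∫⁻ ω, onJump (fun z => F (truncate n ω, z)) (mark (n + 1) ω) ∂P =
      ∫⁻ ω, onJump (fun z => ∫⁻ z', F (truncate n ω, z') ∂(q.nextJump z)) (mark n ω) ∂P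

/-- The law of the event `{t_n ∈ S, t_{n+1} ∉ S}`, where `S` is the set of times before `t`, given
the history up to the `n`-th jump. -/
def HasSurvival (P : Measure (Sample X T₀ T₁)) (S : Set (Time T₀ T₁)) (t : Time T₀ T₁) : Prop :=
  ∀ (n : ℕ) (f : Sample X T₀ T₁ → ℝ≥0∞), Measurable f →
    ∫⁻ ω, alive S n ω * f (truncate n ω) ∂P =
      ∫⁻ ω, onJump (fun z => S.indicator 1 z.1 * q.survival z.2 z.1 t) (mark n ω) *
        f (truncate n ω) ∂P

theorem measurable_onJump_survival {S : Set (Time T₀ T₁)} (hS : MeasurableSet S) (t : Time T₀ T₁)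
    (n : ℕ) : Measurable fun ω : Sample X T₀ T₁ =>
      onJump (fun z => S.indicator 1 z.1 * q.survival z.2 z.1 t) (mark n ω) := by
  refine measurable_onJump ?_ (measurable_mark n)
  exact (((measurable_one.indicator hS).comp measurable_fst).mul
    (by fun_prop : Measurable fun z : Time T₀ T₁ × X => q.survival z.2 z.1 t)).comp measurable_snd

variable {q} {P : Measure (Sample X T₀ T₁)}

theorem hasSurvival_of_indicator {S : Set (Time T₀ T₁)} (hS : MeasurableSet S) {t : Time T₀ T₁}
    (h : ∀ n (A : Set (Sample X T₀ T₁)), MeasurableSet A →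
      ∫⁻ ω, alive S n ω * A.indicator 1 (truncate n ω) ∂P =
        ∫⁻ ω, onJump (fun z => S.indicator 1 z.1 * q.survival z.2 z.1 t) (mark n ω) *
          A.indicator 1 (truncate n ω) ∂P) : HasSurvival q P S t := fun n _ hf =>
  lintegral_mul_comp_eq (measurable_alive hS n) (measurable_onJump_survival q hS t n)
    (measurable_truncate n) (h n) hf

/-- Survival is the complement of a jump in `S`. As subtraction is not available, both sides are
completed by the probability that the next jump falls in `S`; the sums agree pathwise by `hSt`. -/
theorem HasJumpLaw.hasSurvival [IsProbabilityMeasure P] (h : HasJumpLaw q P)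
    {S : Set (Time T₀ T₁)} (hS : MeasurableSet S) {t : Time T₀ T₁}
    (hSt : ∀ z : Time T₀ T₁ × X, z.1 ∈ S →
      q.nextJump z (S ×ˢ Set.univ) + q.survival z.2 z.1 t = 1) : HasSurvival q P S t := by
  refine hasSurvival_of_indicator hS fun n A hA => ?_
  have hSm : MeasurableSet (S ×ˢ (Set.univ : Set X)) := hS.prod .univ
  have hAm : Measurable (A.indicator (1 : Sample X T₀ T₁ → ℝ≥0∞)) := measurable_one.indicator hA
  set F : Sample X T₀ T₁ × Time T₀ T₁ × X → ℝ≥0∞ := fun p =>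
    A.indicator 1 p.1 * inTimes S (mark n p.1) * (S ×ˢ (Set.univ : Set X)).indicator 1 p.2 with hF
  have hFm : Measurable F :=
    ((hAm.comp measurable_fst).mul
      ((measurable_inTimes hS).comp ((measurable_mark n).comp measurable_fst))).mul
      ((measurable_one.indicator hSm).comp measurable_snd)
  have key := h n F hFm
  have e1 : ∀ ω, onJump (fun z => F (truncate n ω, z)) (mark (n + 1) ω) =
      inTimes S (mark n ω) * inTimes S (mark (n + 1) ω) * A.indicator 1 (truncate n ω) := by
    intro ω
    rcases hm : mark (n + 1) ω with z | a
    · by_cases hz : z.1 ∈ S <;> simp [hF, mark_truncate_of_le, hz, mul_comm]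
    · simp
  have e2 : ∀ ω, onJump (fun z => ∫⁻ z', F (truncate n ω, z') ∂(q.nextJump z)) (mark n ω) =
      onJump (fun z => S.indicator 1 z.1 * q.nextJump z (S ×ˢ Set.univ)) (mark n ω) *
        A.indicator 1 (truncate n ω) := by
    intro ω
    rcases hm : mark n ω with z | a
    · simp only [onJump_inl, hF, mark_truncate_of_le le_rfl, hm, inTimes_inl]
      rw [lintegral_const_mul _ (measurable_one.indicator hSm), lintegral_indicator_one hSm]
      ring
    · simp
  simp_rw [e1, e2] at key
  refine lintegral_eq_of_add_eq
    (b := fun ω => inTimes S (mark n ω) * inTimes S (mark (n + 1) ω) *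
      A.indicator 1 (truncate n ω))
    (d := fun ω => onJump (fun z => S.indicator 1 z.1 * q.nextJump z (S ×ˢ Set.univ)) (mark n ω) *
        A.indicator 1 (truncate n ω)) ?_ ?_ (fun ω => ?_) key ?_
  · exact (((measurable_inTimes hS).comp (measurable_mark n)).mul
      ((measurable_inTimes hS).comp (measurable_mark (n + 1)))).mul
      (hAm.comp (measurable_truncate n))
  · refine Measurable.mul (measurable_onJump ?_ (measurable_mark n))
      (hAm.comp (measurable_truncate n))
    exact (((measurable_one.indicator hS).comp measurable_fst).mul
      (q.nextJump.measurable_coe hSm)).comp measurable_snd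
  · rw [← add_mul, add_comm (alive S n ω), inTimes_mul_add_alive, ← add_mul]
    congr 1
    rcases hm : mark n ω with z | a
    · by_cases hz : z.1 ∈ S
      · simp [hz, (add_comm _ _).trans (hSt z hz)]
      · simp [hz]
    · simp
  · exact lintegral_ne_top_of_le_one fun ω =>
      mul_le_one' (mul_le_one' (inTimes_le_one _ _) (inTimes_le_one _ _))
        (indicator_one_le_one _ _)

theorem HasJumpLaw.hasSurvival_Iio [IsProbabilityMeasure P] (h : HasJumpLaw q P)
    (hL : q.HasLocallyIntegrableRates) (t : Time T₀ T₁) : HasSurvival q P (Set.Iio t) t :=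
  h.hasSurvival measurableSet_Iio fun z hz => q.nextJump_Iio_prod_add hL z (le_of_lt hz)

theorem HasJumpLaw.hasSurvival_Iic [IsProbabilityMeasure P] (h : HasJumpLaw q P)
    (hL : q.HasLocallyIntegrableRates) (t : Time T₀ T₁) : HasSurvival q P (Set.Iic t) t :=
  h.hasSurvival measurableSet_Iic fun z hz => q.nextJump_Iic_prod_add hL z hz

/-- With `b` the minimum of `t_{n+1}` and `t`, and `t_n < t`, the backward formula integrates
`survival(x_n, s, t) * rate(x_n, s)` over `]t_n, b]` to `survival(x_n, b, t) - survival(x_n, t_n,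
t)`. Here `survival(x_n, b, t)` is the value of the test function at the jump if that comes before
`t`, and `1` otherwise. In expectation the jump term cancels against the compensator integral, and
only the two terms of the assertion remain. -/
theorem HasIntensity.hasSurvival_Iio [IsProbabilityMeasure P] (h : HasIntensity q P)
    (hL : q.HasLocallyIntegrableRates) (t : Time T₀ T₁) : HasSurvival q P (Set.Iio t) t := by
  refine hasSurvival_of_indicator measurableSet_Iio fun n A hA => ?_
  have hAm : Measurable (A.indicator (1 : Sample X T₀ T₁ → ℝ≥0∞)) := measurable_one.indicator hA
  have hIio : Measurable ((Set.Iio t).indicator (1 : Time T₀ T₁ → ℝ≥0∞)) :=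
    measurable_one.indicator measurableSet_Iio
  -- The state in the survival factor is read off the history as its `n`-th mark; the factor runs
  -- from the variable time to the fixed `t`, which is what makes the integral telescope.
  set G : Sample X T₀ T₁ × Time T₀ T₁ → ℝ≥0∞ := fun p =>
    (Set.Iio t).indicator 1 p.2 * onJump (fun z => q.survival z.2 p.2 t) (mark n p.1) *
      A.indicator 1 p.1 with hG
  have hGm : Measurable G := by
    refine ((hIio.comp measurable_snd).mul (measurable_onJump ?_
      ((measurable_mark n).comp measurable_fst))).mul (hAm.comp measurable_fst)
    exact (by fun_prop : Measurable fun r : (Sample X T₀ T₁ × Time T₀ T₁) × Time T₀ T₁ × X =>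
      q.survival r.2.2 r.1.2 t)
  have key := h n (fun p => G (p.1, p.2.1)) (hGm.comp (by fun_prop))
  simp only [lintegral_const, q.jumpMeasure_univ] at key
  have hmL : Measurable fun ω : Sample X T₀ T₁ =>
      onJump (fun z => G (truncate n ω, z.1)) (mark (n + 1) ω) :=
    measurable_onJump (F := fun ω z => G (truncate n ω, z.1))
      (hGm.comp (((measurable_truncate n).comp measurable_fst).prodMk (by fun_prop)))
      (measurable_mark (n + 1))
  refine lintegral_eq_of_add_eq (b := fun ω => onJump (fun z => G (truncate n ω, z.1))
    (mark (n + 1) ω)) (d := fun ω => onJump (fun z =>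
      ∫⁻ s in waitInterval z.1 (jumpTime (n + 1) ω),
        G (truncate n ω, s) * ENNReal.ofReal (q.rate z.2 s)) (mark n ω)) hmL ?_ (fun ω => ?_) key ?_
  · refine measurable_onJump ?_ (measurable_mark n)
    refine measurable_lintegral_waitInterval (by fun_prop)
      ((measurable_jumpTime (n + 1)).comp (by fun_prop)) ?_
    exact (hGm.comp (((measurable_truncate n).comp
      (measurable_fst.comp measurable_fst)).prodMk measurable_snd)).mul
      (q.measurable_rate.comp ((measurable_snd.comp (measurable_snd.comp measurable_fst)).prodMk
        measurable_snd)).ennreal_ofReal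
  · rcases hm : mark n ω with z | a
    · by_cases hA' : truncate n ω ∈ A
      swap
      · have h0 : ∀ s, G (truncate n ω, s) = 0 := fun s => by simp [hG, hA']
        simp only [h0, hA', not_false_eq_true, Set.indicator_of_notMem, onJump_inl, zero_mul,
          mul_zero, lintegral_zero]
        rcases mark (n + 1) ω with z' | a' <;> simp
      have hG1 : ∀ s, G (truncate n ω, s) = (Set.Iio t).indicator 1 s * q.survival z.2 s t :=
        fun s => by simp [hG, hA', mark_truncate_of_le, hm]
      simp only [hG1, hA', Set.indicator_of_mem, Pi.one_apply, mul_one, onJump_inl, alive, hm,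
        inTimes_inl]
      have hjn : jumpTime n ω = (z.1 : WithTop _) := jumpTime_eq_of_mark hm
      by_cases hz : z.1 < t
      swap
      · have hw : ∀ s ∈ waitInterval z.1 (jumpTime (n + 1) ω),
            (Set.Iio t).indicator (1 : Time T₀ T₁ → ℝ≥0∞) s * q.survival z.2 s t *
              ENNReal.ofReal (q.rate z.2 s) = 0 := fun s hs => by
          rw [Set.indicator_of_notMem, zero_mul, zero_mul]
          exact not_lt.2 ((not_lt.1 hz).trans hs.1.le)
        rw [setLIntegral_congr_fun (measurableSet_waitInterval _ _) hw]
        simp only [Set.mem_Iio, hz, not_false_eq_true, Set.indicator_of_notMem, zero_mul,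
          lintegral_zero, zero_add, add_zero]
        rcases hm' : mark (n + 1) ω with z' | a'
        · have h1 := jumpTime_lt_of_mark hm'
          rw [hjn, WithTop.coe_lt_coe] at h1
          have : ¬ z'.1 < t := not_lt.2 ((not_lt.1 hz).trans h1.le)
          simp [this]
        · simp
      have hzI : (Set.Iio t).indicator (1 : Time T₀ T₁ → ℝ≥0∞) z.1 = 1 :=
        Set.indicator_of_mem (Set.mem_Iio.2 hz) _
      rw [hzI, one_mul, one_mul]
      -- This is used with `b = t_{n+1}` if the jump comes before `t`, and with `b = t` otherwise.
      have hge : ∀ (b : Time T₀ T₁), z.1 ≤ b → b ≤ t →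
          (waitInterval z.1 (jumpTime (n + 1) ω) ∩ Set.Iio t : Set _) =ᵐ[volume] Set.Ioc z.1 b →
          (∫⁻ s in waitInterval z.1 (jumpTime (n + 1) ω),
            (Set.Iio t).indicator 1 s * q.survival z.2 s t * ENNReal.ofReal (q.rate z.2 s)) +
              q.survival z.2 z.1 t = q.survival z.2 b t := by
        intro b hb hbt hab
        rw [← q.lintegral_survival_mul_rate_backward hL z.2 hb hbt, ← setLIntegral_congr hab,
          Set.inter_comm, ← setLIntegral_indicator measurableSet_Iio]
        congr 1
        refine lintegral_congr fun s => ?_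
        by_cases hs : s < t <;> simp [hs]
      rcases lt_or_ge (jumpTime (n + 1) ω) t with hlt | hle
      · rcases hm' : mark (n + 1) ω with z' | a'
        · have h1 := jumpTime_lt_of_mark hm'
          rw [hjn, WithTop.coe_lt_coe] at h1
          rw [jumpTime_eq_of_mark hm', WithTop.coe_lt_coe] at hlt
          rw [add_comm (q.survival _ _ _), hge z'.1 h1.le hlt.le]
          · simp [hlt]
          · refine Filter.EventuallyEq.of_eq ?_
            refine Set.ext fun s => ?_
            simp only [waitInterval, jumpTime_eq_of_mark hm', WithTop.coe_le_coe, Set.mem_inter_iff,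
              Set.mem_ofPred_eq, Set.mem_Iio, Set.mem_Ioc, and_iff_left_iff_imp]
            exact fun hs => hs.2.trans_lt hlt
        · rw [mark_eq_inr_iff.1 hm'] at hlt
          simp at hlt
      · have h1 : onJump (fun z' : Time T₀ T₁ × X => (Set.Iio t).indicator 1 z'.1 *
            q.survival z.2 z'.1 t) (mark (n + 1) ω) = 0 ∧ inTimes (Set.Iio t) (mark (n + 1) ω) = 0 := by
          rcases hm' : mark (n + 1) ω with z' | a'
          · rw [jumpTime_eq_of_mark hm', WithTop.coe_le_coe] at hle
            simp [hle]
          · simp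
        rw [h1.1, h1.2, tsub_zero, add_zero, add_comm, hge t hz.le le_rfl,
          q.survival_of_le _ le_rfl]
        refine Filter.EventuallyEq.trans (Filter.EventuallyEq.of_eq ?_) Ioo_ae_eq_Ioc
        refine Set.ext fun s => ?_
        simp only [waitInterval, Set.mem_inter_iff, Set.mem_ofPred_eq, Set.mem_Iio, Set.mem_Ioo]
        exact ⟨fun hs => ⟨hs.1.1, hs.2⟩,
          fun hs => ⟨⟨hs.1, (WithTop.coe_le_coe.2 hs.2.le).trans hle⟩, hs.2⟩⟩
    · have h0 : ∀ s, G (truncate n ω, s) = 0 := fun s => by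
        simp [hG, mark_truncate_of_le, hm]
      simp only [h0, alive, hm, inTimes_inr, onJump_inr, zero_mul, add_zero]
      rcases mark (n + 1) ω with z' | a' <;> simp
  · refine lintegral_ne_top_of_le_one fun ω => ?_
    rcases mark (n + 1) ω with z' | a'
    · refine mul_le_one' (mul_le_one' (indicator_one_le_one _ _) ?_) (indicator_one_le_one _ _)
      rcases mark n (truncate n ω) with z | a
      · exact q.survival_le_one _ _ _
      · simp
    · simp

/-- A time `s` lies in `]t_n, t_{n+1}]` exactly when `t_n < s` but not `t_{n+1} < s`. Hence the
integral over the waiting interval is an integral over all `s` of `alive (Set.Iio s)`, and for each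
fixed `s` this indicator may be replaced by its conditional survival probability, the density in
`nextJump`. -/
theorem lintegral_intensity_eq_lintegral_nextJump
    (h : ∀ t, HasSurvival q P (Set.Iio t) t) [SFinite P] (n : ℕ)
    {F : Sample X T₀ T₁ × Time T₀ T₁ × X → ℝ≥0∞} (hF : Measurable F) :
    ∫⁻ ω, onJump (fun z => ∫⁻ s in waitInterval z.1 (jumpTime (n + 1) ω),
        ∫⁻ y, F (truncate n ω, s, y) ∂(q.jumpMeasure z.2 s)) (mark n ω) ∂P =
      ∫⁻ ω, onJump (fun z => ∫⁻ z', F (truncate n ω, z') ∂(q.nextJump z)) (mark n ω) ∂P := by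
  set g : Time T₀ T₁ × Sample X T₀ T₁ → ℝ≥0∞ := fun p =>
    onJump (fun z => ∫⁻ y, F (p.2, p.1, y) ∂(q.jumpMeasure z.2 p.1)) (mark n p.2) with hg
  have hgm : Measurable g := by
    refine measurable_onJump ?_ ((measurable_mark n).comp measurable_snd)
    refine measurable_lintegral_jumpMeasure q ?_ (by fun_prop) (by fun_prop)
    exact hF.comp (by fun_prop : Measurable fun r : ((Time T₀ T₁ × Sample X T₀ T₁) ×
      Time T₀ T₁ × X) × X => (r.1.1.2, r.1.1.1, r.2))
  have e1 : ∀ ω, onJump (fun z => ∫⁻ s in waitInterval z.1 (jumpTime (n + 1) ω),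
        ∫⁻ y, F (truncate n ω, s, y) ∂(q.jumpMeasure z.2 s)) (mark n ω) =
      ∫⁻ s, alive (Set.Iio s) n ω * g (s, truncate n ω) := by
    intro ω
    rcases hm : mark n ω with z | a
    · rw [onJump_inl, ← lintegral_indicator (measurableSet_waitInterval _ _)]
      refine lintegral_congr fun s => ?_
      simp only [hg, mark_truncate_of_le le_rfl, hm, onJump_inl, alive, inTimes_inl]
      by_cases h1 : z.1 < s
      · by_cases h2 : (s : WithTop (Time T₀ T₁)) ≤ jumpTime (n + 1) ω
        · rw [Set.indicator_of_mem (show s ∈ waitInterval _ _ from ⟨h1, h2⟩)]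
          have h3 : inTimes (Set.Iio s) (mark (n + 1) ω) = 0 := by
            rcases hm' : mark (n + 1) ω with z' | a'
            · rw [jumpTime_eq_of_mark hm', WithTop.coe_le_coe] at h2
              simp [h2]
            · simp
          simp [h3, h1]
        · rw [Set.indicator_of_notMem fun hs => h2 hs.2]
          have h3 : inTimes (Set.Iio s) (mark (n + 1) ω) = 1 := by
            rcases hm' : mark (n + 1) ω with z' | a'
            · rw [jumpTime_eq_of_mark hm', WithTop.coe_le_coe, not_le] at h2
              simp [h2]
            · simp [mark_eq_inr_iff.1 hm'] at h2
          simp [h3]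
      · rw [Set.indicator_of_notMem fun hs => h1 hs.1]
        simp [h1]
    · simp [alive, hm]
  have e2 : ∀ ω, onJump (fun z => ∫⁻ z', F (truncate n ω, z') ∂(q.nextJump z)) (mark n ω) =
      ∫⁻ s, onJump (fun z => (Set.Iio s).indicator 1 z.1 * q.survival z.2 z.1 s) (mark n ω) *
        g (s, truncate n ω) := by
    intro ω
    rcases hm : mark n ω with z | a
    · rw [onJump_inl, q.lintegral_nextJump z (f := fun z' => F (truncate n ω, z')) (hF.comp measurable_prodMk_left),
        ← lintegral_indicator measurableSet_Ioi]
      refine lintegral_congr fun s => ?_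
      simp only [hg, mark_truncate_of_le le_rfl, hm, onJump_inl]
      by_cases h1 : z.1 < s <;> simp [h1]
    · simp
  simp_rw [e1, e2]
  have hT : Measurable fun p : Sample X T₀ T₁ × Time T₀ T₁ => g (p.2, truncate n p.1) :=
    hgm.comp (measurable_snd.prodMk ((measurable_truncate n).comp measurable_fst))
  rw [lintegral_lintegral_swap, lintegral_lintegral_swap (f := fun ω s => onJump
    (fun z => (Set.Iio s).indicator 1 z.1 * q.survival z.2 z.1 s) (mark n ω) *
      g (s, truncate n ω))]
  · exact lintegral_congr fun s => h s n (fun ω => g (s, ω)) (hgm.comp measurable_prodMk_left)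
  · refine (Measurable.mul (measurable_onJump ?_ ((measurable_mark n).comp measurable_fst))
      hT).aemeasurable
    have hS : MeasurableSet {r : (Sample X T₀ T₁ × Time T₀ T₁) × Time T₀ T₁ × X |
        r.2.1 < r.1.2} := measurableSet_lt (by fun_prop) (by fun_prop)
    exact ((measurable_const (a := (1 : ℝ≥0∞))).indicator hS).mul
      (by fun_prop : Measurable fun r : (Sample X T₀ T₁ × Time T₀ T₁) × Time T₀ T₁ × X =>
        q.survival r.2.2 r.2.1 r.1.2)
  · exact (((measurable_alive_Iio n).comp measurable_swap).mul hT).aemeasurable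

/-- The right-hand sides of the two notions agree whenever the survival probabilities are known, and
each notion yields them: `HasIntensity` by the telescoping argument, `HasJumpLaw` by taking
complements. -/
theorem hasIntensity_iff_hasJumpLaw [IsProbabilityMeasure P] (hL : q.HasLocallyIntegrableRates) :
    HasIntensity q P ↔ HasJumpLaw q P := by
  refine ⟨fun h n F hF => ?_, fun h n F hF => ?_⟩
  · rw [h n F hF, lintegral_intensity_eq_lintegral_nextJump (h.hasSurvival_Iio hL) n hF]
  · rw [h n F hF, lintegral_intensity_eq_lintegral_nextJump (h.hasSurvival_Iio hL) n hF]

end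

end

/-! ### Uniqueness of the law -/

theorem measurable_lintegral_nextJump {X : Type*} [MeasurableSpace X]
    [StandardBorelSpace X] {T₀ : ℝ} {T₁ : EReal} {q : QFunction X T₀ T₁} {Θ : Type*} [MeasurableSpace Θ]
    {F : Θ → Time T₀ T₁ × X → ℝ≥0∞} (hF : Measurable (Function.uncurry F)) {g : Θ → Time T₀ T₁ × X}
    (hg : Measurable g) : Measurable fun θ => ∫⁻ z, F θ z ∂(q.nextJump (g θ)) :=
  Measurable.lintegral_kernel_prod_right (κ := q.nextJump.comap g hg) hF

/-! ### Histories built one mark at a time. -/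

section Append

variable {X : Type*} {T₀ : ℝ} {T₁ : EReal} [Fact ((T₀ : EReal) < T₁)]

/-- The path without jumps that starts in `x`. -/
def start (x : X) : Sample X T₀ T₁ :=
  ofMarks (fun n => if n = 0 then Sum.inl (⊥, x) else Sum.inr ())
    ⟨⟨x, by simp⟩, fun n => Or.inr (by simp)⟩

theorem mark_start (x : X) (n : ℕ) :
    mark n (start x : Sample X T₀ T₁) = if n = 0 then Sum.inl (⊥, x) else Sum.inr () :=
  mark_ofMarks _ _ n

theorem truncate_zero_eq_start {ω : Sample X T₀ T₁} {x : X} (h : state 0 ω = Sum.inl x) :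
    truncate 0 ω = start x := by
  refine ext_mark fun k => ?_
  rw [mark_truncate, mark_start]
  rcases Nat.eq_zero_or_pos k with rfl | hk
  · obtain ⟨y, hy⟩ := exists_mark_zero ω
    have := state_eq_of_mark hy
    rw [h, Sum.inl.injEq] at this
    simp [hy, this]
  · rw [if_neg (by omega), if_neg (by omega)]

open scoped Classical in
/-- The history `ω` up to the `n`-th jump, followed by the mark `m` if this is possible, and without
further jumps. -/
def append (n : ℕ) (ω : Sample X T₀ T₁) (m : (Time T₀ T₁ × X) ⊕ Unit) : Sample X T₀ T₁ :=
  ofMarks (fun k => if k ≤ n then mark k ω else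
      if k = n + 1 ∧ jumpTime n ω < timeOf m then m else Sum.inr ()) (by
    refine ⟨by simpa using exists_mark_zero ω, fun k => ?_⟩
    rcases lt_trichotomy k n with hk | rfl | hk
    · simpa [hk.le, Nat.succ_le_of_lt hk] using (isMarkSeq_mark ω).2 k
    · by_cases h : jumpTime k ω < timeOf m
      · simp [h]
      · simp [h]
    · simp [show ¬ k + 1 ≤ n by omega, show k ≠ n by omega])

open scoped Classical in
theorem mark_append (n : ℕ) (ω : Sample X T₀ T₁) (m : (Time T₀ T₁ × X) ⊕ Unit) (k : ℕ) :
    mark k (append n ω m) = if k ≤ n then mark k ω else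
      if k = n + 1 ∧ jumpTime n ω < timeOf m then m else Sum.inr () :=
  mark_ofMarks _ _ k

theorem truncate_succ_eq_append (n : ℕ) (ω : Sample X T₀ T₁) :
    truncate (n + 1) ω = append n (truncate n ω) (mark (n + 1) ω) := by
  refine ext_mark fun k => ?_
  rw [mark_truncate, mark_append, mark_truncate]
  rcases lt_trichotomy k (n + 1) with hk | rfl | hk
  · simp [hk.le, Nat.le_of_lt_succ hk]
  · have hj : jumpTime n (truncate n ω) = jumpTime n ω := by
      rw [← timeOf_mark, mark_truncate_of_le le_rfl, timeOf_mark]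
    simp only [le_refl, if_true, show ¬ n + 1 ≤ n by omega, if_false, hj, timeOf_mark, true_and]
    split_ifs with h
    · rfl
    · exact mark_eq_inr_iff.2 ((jumpTime_lt_succ n ω).resolve_left h)
  · simp [show ¬ k ≤ n + 1 by omega, show ¬ k ≤ n by omega, show k ≠ n + 1 by omega]

variable [MeasurableSpace X]

theorem measurable_start : Measurable (start : X → Sample X T₀ T₁) := by
  refine measurable_of_measurable_mark fun k => ?_
  simp only [mark_start]
  split_ifs
  · exact measurable_inl.comp measurable_prodMk_left
  · exact measurable_const

theorem measurable_append (n : ℕ) : Measurable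
    fun p : Sample X T₀ T₁ × ((Time T₀ T₁ × X) ⊕ Unit) => append n p.1 p.2 := by
  classical
  refine measurable_of_measurable_mark fun k => ?_
  simp only [mark_append]
  by_cases hk : k ≤ n
  · simp only [hk, if_true]
    exact (measurable_mark k).comp measurable_fst
  · simp only [hk, if_false]
    refine Measurable.ite ?_ measurable_snd measurable_const
    exact (MeasurableSet.const _).inter (measurableSet_lt ((measurable_jumpTime n).comp measurable_fst)
      (measurable_timeOf.comp measurable_snd))

/-- Events that depend on finitely many marks form a π-system, since histories are nested, and they
generate because each mark is read off some history. -/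
theorem ext_of_map_truncate {P P' : Measure (Sample X T₀ T₁)} [IsFiniteMeasure P]
    (h : ∀ n, P.map (truncate n) = P'.map (truncate n)) : P = P' := by
  set C : Set (Set (Sample X T₀ T₁)) :=
    {s | ∃ n A, MeasurableSet A ∧ s = truncate n ⁻¹' A} with hC
  have key : ∀ n A, MeasurableSet A → P (truncate n ⁻¹' A) = P' (truncate n ⁻¹' A) := by
    intro n A hA
    rw [← Measure.map_apply (measurable_truncate n) hA, h n,
      Measure.map_apply (measurable_truncate n) hA]
  refine ext_of_generate_finite C ?_ ?_ ?_ ?_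
  · refine le_antisymm ?_ (MeasurableSpace.generateFrom_le ?_)
    · have : @Measurable _ _ (MeasurableSpace.generateFrom C) _
          (id : Sample X T₀ T₁ → Sample X T₀ T₁) := by
        refine measurable_of_measurable_mark fun k B hB => ?_
        refine MeasurableSpace.measurableSet_generateFrom ⟨k, mark k ⁻¹' B, measurable_mark k hB, ?_⟩
        ext ω
        simp [mark_truncate_of_le]
      exact fun s hs => this hs
    · rintro _ ⟨n, A, hA, rfl⟩
      exact measurable_truncate n hA
  · rintro _ ⟨n, A, hA, rfl⟩ _ ⟨m, B, hB, rfl⟩ -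
    refine ⟨max n m, truncate n ⁻¹' A ∩ truncate m ⁻¹' B,
      (measurable_truncate n hA).inter (measurable_truncate m hB), ?_⟩
    ext ω
    simp [truncate_truncate_of_le]
  · rintro _ ⟨n, A, hA, rfl⟩
    exact key n A hA
  · simpa using key 0 Set.univ .univ

end Append

section

variable {X : Type*} [MeasurableSpace X] [StandardBorelSpace X] {T₀ : ℝ} {T₁ : EReal}
  [Fact ((T₀ : EReal) < T₁)] {q : QFunction X T₀ T₁}

theorem HasJumpLaw.lintegral_eq {P P' : Measure (Sample X T₀ T₁)} (h : HasJumpLaw q P)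
    (h' : HasJumpLaw q P') {n : ℕ} (hn : P.map (truncate n) = P'.map (truncate n))
    {F : Sample X T₀ T₁ × Time T₀ T₁ × X → ℝ≥0∞} (hF : Measurable F) :
    ∫⁻ ω, onJump (fun z => F (truncate n ω, z)) (mark (n + 1) ω) ∂P =
      ∫⁻ ω, onJump (fun z => F (truncate n ω, z)) (mark (n + 1) ω) ∂P' := by
  set G : Sample X T₀ T₁ → ℝ≥0∞ := fun ω =>
    onJump (fun z => ∫⁻ z', F (ω, z') ∂(q.nextJump z)) (mark n ω) with hG
  have hGm : Measurable G := by
    refine measurable_onJump (measurable_lintegral_nextJump ?_ measurable_snd) (measurable_mark n)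
    exact hF.comp (by fun_prop : Measurable
      fun r : (Sample X T₀ T₁ × Time T₀ T₁ × X) × Time T₀ T₁ × X => (r.1.1, r.2))
  have key : ∀ {P : Measure (Sample X T₀ T₁)}, HasJumpLaw q P →
      ∫⁻ ω, onJump (fun z => F (truncate n ω, z)) (mark (n + 1) ω) ∂P =
        ∫⁻ ω, G ω ∂(P.map (truncate n)) := fun h => by
    rw [h n F hF, lintegral_map hGm (measurable_truncate n)]
    simp [hG, mark_truncate_of_le]
  rw [key h, key h', hn]

/-- The history up to `n + 1` is the history up to `n` with one more mark. The jump law controls it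
on the event that the jump happens; the event that it does not is reached by complement, which is
why a finite term is added and cancelled. -/
theorem HasJumpLaw.ext {P P' : Measure (Sample X T₀ T₁)} [IsProbabilityMeasure P]
    [IsProbabilityMeasure P'] (h : HasJumpLaw q P) (h' : HasJumpLaw q P')
    (h0 : ∀ B : Set X, MeasurableSet B →
      P {ω | state 0 ω ∈ Sum.inl '' B} = P' {ω | state 0 ω ∈ Sum.inl '' B}) : P = P' := by
  refine ext_of_map_truncate fun n => ?_
  induction n with
  | zero =>
    refine Measure.ext fun A hA => ?_
    have hset : (truncate 0 ⁻¹' A : Set (Sample X T₀ T₁)) =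
        {ω | state 0 ω ∈ Sum.inl '' (start ⁻¹' A)} := by
      ext ω
      obtain ⟨x, hx⟩ := exists_mark_zero ω
      have hs := state_eq_of_mark hx
      simp [truncate_zero_eq_start hs, hs]
    rw [Measure.map_apply (measurable_truncate 0) hA, Measure.map_apply (measurable_truncate 0) hA,
      hset, h0 _ (measurable_start hA)]
  | succ n ih =>
    refine Measure.ext fun A hA => ?_
    have hf : Measurable (A.indicator (1 : Sample X T₀ T₁ → ℝ≥0∞)) := measurable_one.indicator hA
    set f := A.indicator (1 : Sample X T₀ T₁ → ℝ≥0∞) with hf_def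
    set c : Sample X T₀ T₁ → ℝ≥0∞ := fun ω => f (append n ω (Sum.inr ())) with hc_def
    have hc : Measurable c := hf.comp ((measurable_append n).comp measurable_prodMk_right)
    have hJ : Measurable fun p : Sample X T₀ T₁ × Time T₀ T₁ × X =>
        f (append n p.1 (Sum.inl p.2)) :=
      hf.comp ((measurable_append n).comp
        (measurable_fst.prodMk (measurable_inl.comp measurable_snd)))
    have hb : Measurable fun p : Sample X T₀ T₁ × Time T₀ T₁ × X => c p.1 := hc.comp measurable_fst
    have eJ := h.lintegral_eq h' ih hJ
    have eb := h.lintegral_eq h' ih hb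
    have ec : ∫⁻ ω, c (truncate n ω) ∂P = ∫⁻ ω, c (truncate n ω) ∂P' := by
      rw [← lintegral_map hc (measurable_truncate n), ih, lintegral_map hc (measurable_truncate n)]
    -- If the jump happens, the terms with `c` match; if it does not, `f` is evaluated at the path
    -- without a further mark, which is `c`.
    have hpt : ∀ ω, f (truncate (n + 1) ω) +
        onJump (fun _ => c (truncate n ω)) (mark (n + 1) ω) =
        onJump (fun z => f (append n (truncate n ω) (Sum.inl z))) (mark (n + 1) ω) +
          c (truncate n ω) := by
      intro ω
      rw [truncate_succ_eq_append]
      rcases mark (n + 1) ω with z | a <;> simp [hc_def]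
    have hbm : Measurable fun ω : Sample X T₀ T₁ =>
        onJump (fun _ : Time T₀ T₁ × X => c (truncate n ω)) (mark (n + 1) ω) :=
      measurable_onJump (F := fun ω _ => c (truncate n ω))
        ((hc.comp (measurable_truncate n)).comp measurable_fst) (measurable_mark (n + 1))
    have key : ∀ P : Measure (Sample X T₀ T₁), (P.map (truncate (n + 1))) A +
        ∫⁻ ω, onJump (fun _ => c (truncate n ω)) (mark (n + 1) ω) ∂P =
        ∫⁻ ω, onJump (fun z => f (append n (truncate n ω) (Sum.inl z))) (mark (n + 1) ω) ∂P +
          ∫⁻ ω, c (truncate n ω) ∂P := by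
      intro P
      rw [← lintegral_indicator_one hA, lintegral_map hf (measurable_truncate _),
        ← lintegral_add_right _ hbm, lintegral_congr hpt,
        lintegral_add_right (g := fun ω => c (truncate n ω)) _ (hc.comp (measurable_truncate n))]
    have k1 := key P
    have hfin : ∫⁻ ω, onJump (fun _ => c (truncate n ω)) (mark (n + 1) ω) ∂P ≠ ∞ := by
      refine lintegral_ne_top_of_le_one fun ω => ?_
      rcases mark (n + 1) ω with z | a
      · exact indicator_one_le_one _ _
      · simp
    rw [eJ, ec, ← key P', ← eb] at k1
    exact (ENNReal.add_left_inj hfin).1 k1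

end

/-! ### Existence of the law -/

/-- The initial law of the Ionescu-Tulcea measure, which becomes the law of the mark with index `0`.
-/
theorem map_eval_zero_trajMeasure {E : Type*} [MeasurableSpace E] (μ₀ : Measure E)
    [IsProbabilityMeasure μ₀]
    (κ : (n : ℕ) → Kernel ((i : Finset.Iic n) → (fun _ : ℕ => E) i) E) [∀ n, IsMarkovKernel (κ n)] :
    (Kernel.trajMeasure (X := fun _ => E) μ₀ κ).map (fun m => m 0) = μ₀ := by
  have h1 : (Kernel.trajMeasure (X := fun _ => E) μ₀ κ).map (Preorder.frestrictLe 0) =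
      μ₀.map (MeasurableEquiv.piUnique (fun _ : Finset.Iic 0 => E)).symm := by
    rw [Kernel.trajMeasure, Measure.map_comp _ _ (by fun_prop), Kernel.traj_map_frestrictLe,
      Kernel.partialTraj_self, Measure.id_comp]
  have h2 : (fun m : ℕ → E => m 0) =
      (MeasurableEquiv.piUnique (fun _ : Finset.Iic 0 => E)) ∘ Preorder.frestrictLe 0 := rfl
  rw [h2, ← Measure.map_map (by fun_prop) (by fun_prop), h1,
    MeasurableEquiv.map_map_symm]

theorem measurableSet_eq_fun_inr {Z Θ : Type*} [MeasurableSpace Z] [MeasurableSpace Θ]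
    {f : Θ → Z ⊕ Unit} (hf : Measurable f) : MeasurableSet {θ | f θ = Sum.inr ()} := by
  convert! hf ((MeasurableSet.univ : MeasurableSet (Set.univ : Set Unit)).inr_image) using 1
  ext θ
  rcases h : f θ with z | a <;> simp [h]

/-! ### From arbitrary sequences of marks to paths. -/

section Marks

variable {X : Type*} {T₀ : ℝ} {T₁ : EReal} [Fact ((T₀ : EReal) < T₁)]

open scoped Classical in
/-- The point of the sample space with a given sequence of marks, with a default value for sequences
that are not sequences of marks. -/
def toSample (ω₀ : Sample X T₀ T₁) (m : ℕ → (Time T₀ T₁ × X) ⊕ Unit) : Sample X T₀ T₁ :=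
  if h : IsMarkSeq m then ofMarks m h else ω₀

theorem mark_toSample (ω₀ : Sample X T₀ T₁) {m : ℕ → (Time T₀ T₁ × X) ⊕ Unit} (h : IsMarkSeq m)
    (n : ℕ) : mark n (toSample ω₀ m) = m n := by
  rw [toSample, dif_pos h, mark_ofMarks]

variable [MeasurableSpace X]

theorem measurableSet_bot_mark :
    MeasurableSet {e : (Time T₀ T₁ × X) ⊕ Unit | ∃ x, e = Sum.inl (⊥, x)} := by
  have : MeasurableSet (Sum.inl '' (({⊥} : Set (Time T₀ T₁)) ×ˢ (Set.univ : Set X)) :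
      Set ((Time T₀ T₁ × X) ⊕ Unit)) :=
    ((measurableSet_singleton _).prod .univ).inl_image
  convert! this using 1
  ext m
  simp [eq_comm]

theorem measurableSet_isMarkSeq :
    MeasurableSet {m : ℕ → (Time T₀ T₁ × X) ⊕ Unit | IsMarkSeq m} := by
  have hn : ∀ n, MeasurableSet {m : ℕ → (Time T₀ T₁ × X) ⊕ Unit |
      timeOf (m n) < timeOf (m (n + 1)) ∨ m (n + 1) = Sum.inr ()} := fun n =>
    (measurableSet_lt (measurable_timeOf.comp (measurable_pi_apply n))
      (measurable_timeOf.comp (measurable_pi_apply (n + 1)))).union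
      (measurableSet_eq_fun_inr (measurable_pi_apply (n + 1)))
  have h := ((measurable_pi_apply 0 :
    Measurable fun m : ℕ → (Time T₀ T₁ × X) ⊕ Unit => m 0) measurableSet_bot_mark).inter
      (MeasurableSet.iInter hn)
  convert! h using 1
  ext m
  simp [IsMarkSeq]

theorem measurable_toSample (ω₀ : Sample X T₀ T₁) : Measurable (toSample ω₀) := by
  classical
  refine measurable_of_measurable_mark fun n => ?_
  have : (fun m => mark n (toSample ω₀ m)) = fun m => if IsMarkSeq m then m n else mark n ω₀ := by
    ext1 m
    by_cases h : IsMarkSeq m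
    · rw [mark_toSample ω₀ h, if_pos h]
    · rw [toSample, dif_neg h, if_neg h]
  rw [this]
  exact Measurable.ite measurableSet_isMarkSeq (measurable_pi_apply n) measurable_const

end Marks

/-! ### The Markov chain of marks and the law it induces on paths. -/

section

variable {X : Type*} [MeasurableSpace X] [StandardBorelSpace X] {T₀ : ℝ} {T₁ : EReal}
  (q : QFunction X T₀ T₁)

/-- The law of the next mark, given the present mark `z`. -/
def nextMarkOfJump : Kernel (Time T₀ T₁ × X) ((Time T₀ T₁ × X) ⊕ Unit) :=
  q.nextJump.map Sum.inl +
    (Kernel.const (Time T₀ T₁ × X) (Measure.dirac (Sum.inr ()))).withDensity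
      fun z _ => 1 - q.nextJump z Set.univ

theorem lintegral_nextMarkOfJump (z : Time T₀ T₁ × X) {f : (Time T₀ T₁ × X) ⊕ Unit → ℝ≥0∞}
    (hf : Measurable f) : ∫⁻ m, f m ∂(nextMarkOfJump q z) =
      ∫⁻ z', f (Sum.inl z') ∂(q.nextJump z) + (1 - q.nextJump z Set.univ) * f (Sum.inr ()) := by
  have hm : Measurable (Function.uncurry fun (z : Time T₀ T₁ × X)
      (_ : (Time T₀ T₁ × X) ⊕ Unit) => 1 - q.nextJump z Set.univ) :=
    measurable_const.sub ((q.nextJump.measurable_coe .univ).comp measurable_fst)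
  rw [nextMarkOfJump, add_apply, lintegral_add_measure,
    Kernel.map_apply _ measurable_inl, lintegral_map hf measurable_inl,
    Kernel.lintegral_withDensity _ hm _ hf, Kernel.const_apply,
    lintegral_dirac' _ (by fun_prop)]

/-- The transition kernel of the Markov chain of marks. -/
def nextMark : Kernel ((Time T₀ T₁ × X) ⊕ Unit) ((Time T₀ T₁ × X) ⊕ Unit) where
  toFun := Sum.elim (nextMarkOfJump q) fun _ => Measure.dirac (Sum.inr ())
  measurable' := (nextMarkOfJump q).measurable.sumElim measurable_const

variable {q}

theorem isMarkovKernel_nextMark (hL : q.HasLocallyIntegrableRates) :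
    IsMarkovKernel (nextMark q) := by
  refine ⟨fun m => ⟨?_⟩⟩
  rcases m with z | a
  · have h := lintegral_nextMarkOfJump q z (measurable_const (a := (1 : ℝ≥0∞)))
    rw [lintegral_const, one_mul, lintegral_const, one_mul, mul_one,
      add_tsub_cancel_of_le (q.nextJump_univ_le_one hL z)] at h
    exact h
  · exact measure_univ (μ := Measure.dirac (Sum.inr ()))

theorem lintegral_nextMark_onJump (m : (Time T₀ T₁ × X) ⊕ Unit) {f : Time T₀ T₁ × X → ℝ≥0∞}
    (hf : Measurable f) : ∫⁻ m', onJump f m' ∂(nextMark q m) =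
      onJump (fun z => ∫⁻ z', f z' ∂(q.nextJump z)) m := by
  have hf' : Measurable (onJump f) := hf.sumElim measurable_const
  rcases m with z | a
  · refine (lintegral_nextMarkOfJump q z hf').trans ?_
    simp
  · refine (lintegral_dirac' (Sum.inr ()) hf').trans ?_
    simp

/-- `nextJump` has no mass up to its starting time, and a missing jump is absorbing. This makes
almost every trajectory of the chain a sequence of marks of a path. -/
theorem ae_nextMark (m : (Time T₀ T₁ × X) ⊕ Unit) :
    ∀ᵐ m' ∂(nextMark q m), timeOf m < timeOf m' ∨ m' = Sum.inr () := by
  have hS : MeasurableSet {z' : Time T₀ T₁ × X | ¬ timeOf m < (z'.1 : WithTop (Time T₀ T₁))} :=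
    (measurableSet_lt measurable_const (WithTop.measurable_coe.comp measurable_fst)).compl
  have h := lintegral_nextMark_onJump (q := q) m (measurable_one.indicator hS)
  have h0 : onJump (fun z => ∫⁻ z', Set.indicator {z' : Time T₀ T₁ × X |
      ¬ timeOf m < (z'.1 : WithTop (Time T₀ T₁))} 1 z' ∂(q.nextJump z)) m = 0 := by
    rcases m with z | a
    · rw [onJump_inl, lintegral_indicator_one hS, ← q.nextJump_Iic_fst z]
      congr 1
      ext z'
      simp
    · rfl
  have hm : Measurable (onJump (Set.indicator {z' : Time T₀ T₁ × X |
      ¬ timeOf m < (z'.1 : WithTop (Time T₀ T₁))} (1 : Time T₀ T₁ × X → ℝ≥0∞))) :=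
    (measurable_one.indicator hS).sumElim measurable_const
  rw [h0, lintegral_eq_zero_iff hm] at h
  filter_upwards [h] with m' hm'
  rcases m' with z' | a'
  · left
    by_contra hlt
    rw [timeOf_inl] at hlt
    simp [hlt] at hm'
  · exact Or.inr rfl

variable [Fact ((T₀ : EReal) < T₁)]

/-- There is a law on sequences of marks whose next mark has the transition kernel `nextMark`. -/
theorem exists_markLaw (hL : q.HasLocallyIntegrableRates) (γ : Measure X)
    [IsProbabilityMeasure γ] :
    ∃ Q : Measure (ℕ → (Time T₀ T₁ × X) ⊕ Unit), IsProbabilityMeasure Q ∧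
      Q.map (fun m => m 0) = γ.map (fun x => Sum.inl (⊥, x)) ∧
      ∀ (n : ℕ) (G : ((Finset.Iic n → (Time T₀ T₁ × X) ⊕ Unit) ×
        ((Time T₀ T₁ × X) ⊕ Unit)) → ℝ≥0∞), Measurable G →
        ∫⁻ m, G (Preorder.frestrictLe (π := fun _ => (Time T₀ T₁ × X) ⊕ Unit) n m, m (n + 1)) ∂Q =
          ∫⁻ m, ∫⁻ e, G (Preorder.frestrictLe (π := fun _ => (Time T₀ T₁ × X) ⊕ Unit) n m, e)
            ∂(nextMark q (m n)) ∂Q := by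
  have hM := isMarkovKernel_nextMark hL
  have hi : Measurable fun x : X => (Sum.inl (⊥, x) : (Time T₀ T₁ × X) ⊕ Unit) :=
    measurable_inl.comp measurable_prodMk_left
  have hμ : IsProbabilityMeasure (γ.map fun x => (Sum.inl (⊥, x) : (Time T₀ T₁ × X) ⊕ Unit)) :=
    Measure.isProbabilityMeasure_map hi.aemeasurable
  set κ : (n : ℕ) → Kernel ((i : Finset.Iic n) → (fun _ : ℕ => (Time T₀ T₁ × X) ⊕ Unit) i)
    ((Time T₀ T₁ × X) ⊕ Unit) := fun n =>
      (nextMark q).comap (fun h => h ⟨n, Finset.mem_Iic.2 le_rfl⟩) (measurable_pi_apply _) with hκ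
  refine ⟨Kernel.trajMeasure (X := fun _ => (Time T₀ T₁ × X) ⊕ Unit)
    (γ.map fun x => Sum.inl (⊥, x)) κ, inferInstance, map_eval_zero_trajMeasure _ κ, ?_⟩
  intro n G hG
  have key := Kernel.map_frestrictLe_trajMeasure_compProd_eq_map_trajMeasure
    (X := fun _ => (Time T₀ T₁ × X) ⊕ Unit) (μ₀ := γ.map fun x => Sum.inl (⊥, x)) (κ := κ) (a := n)
  have e1 := lintegral_map (μ := Kernel.trajMeasure (X := fun _ => (Time T₀ T₁ × X) ⊕ Unit)
    (γ.map fun x => Sum.inl (⊥, x)) κ) hG (g := fun m =>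
      (Preorder.frestrictLe (π := fun _ => (Time T₀ T₁ × X) ⊕ Unit) n m, m (n + 1))) (by fun_prop)
  rw [← e1, ← key, Measure.lintegral_compProd hG, lintegral_map _ (by fun_prop)]
  · rfl
  · exact hG.lintegral_kernel_prod_right'

/-- The law of the chain is transported by `toSample`. Its default value is taken only on a null
set, and the one-step transition of the chain is the jump law once histories of paths are expressed
by finitely many coordinates of the chain. -/
theorem exists_hasJumpLaw (hL : q.HasLocallyIntegrableRates) (γ : Measure X)
    [IsProbabilityMeasure γ] :
    ∃ P : Measure (Sample X T₀ T₁), IsProbabilityMeasure P ∧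
      (∀ B : Set X, MeasurableSet B → P {ω | state 0 ω ∈ Sum.inl '' B} = γ B) ∧
      HasJumpLaw q P := by
  classical
  obtain ⟨Q, hQ, hQ0, hQn⟩ := exists_markLaw (T₀ := T₀) (T₁ := T₁) hL γ
  obtain ⟨x₀⟩ : Nonempty X := nonempty_of_isProbabilityMeasure γ
  set ω₀ : Sample X T₀ T₁ := start x₀
  have hae : ∀ᵐ m ∂Q, IsMarkSeq m := by
    refine Filter.Eventually.and ?_ (ae_all_iff.2 fun n => ?_)
    · have hi : Measurable fun x : X => (Sum.inl (⊥, x) : (Time T₀ T₁ × X) ⊕ Unit) :=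
        measurable_inl.comp measurable_prodMk_left
      have h1 : ∀ᵐ e ∂(Q.map fun m => m 0), ∃ x, e = Sum.inl (⊥, x) := by
        rw [hQ0, ae_map_iff hi.aemeasurable measurableSet_bot_mark]
        exact Filter.Eventually.of_forall fun x => ⟨x, rfl⟩
      exact ae_of_ae_map (measurable_pi_apply 0).aemeasurable h1
    · set S : Set ((Finset.Iic n → (Time T₀ T₁ × X) ⊕ Unit) × ((Time T₀ T₁ × X) ⊕ Unit)) :=
        {p | timeOf (p.1 ⟨n, Finset.mem_Iic.2 le_rfl⟩) < timeOf p.2 ∨ p.2 = Sum.inr ()} with hS_def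
      have hS : MeasurableSet S :=
        (measurableSet_lt (measurable_timeOf.comp (by fun_prop))
          (measurable_timeOf.comp measurable_snd)).union (measurableSet_eq_fun_inr measurable_snd)
      have hg : Measurable (Sᶜ.indicator fun _ => (1 : ℝ≥0∞)) :=
        measurable_const.indicator hS.compl
      set g := Sᶜ.indicator fun _ => (1 : ℝ≥0∞)
      have h1 := hQn n g hg
      have h2 : ∀ m : ℕ → (Time T₀ T₁ × X) ⊕ Unit, ∫⁻ e,
          g (Preorder.frestrictLe (π := fun _ => (Time T₀ T₁ × X) ⊕ Unit) n m, e)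
          ∂(nextMark q (m n)) = 0 := fun m => by
        refine lintegral_eq_zero_of_ae_eq_zero ?_
        filter_upwards [ae_nextMark (q := q) (m n)] with e he
        exact Set.indicator_of_notMem (s := Sᶜ) (fun h => h he) fun _ => (1 : ℝ≥0∞)
      have hgm : Measurable fun m : ℕ → (Time T₀ T₁ × X) ⊕ Unit =>
          g (Preorder.frestrictLe (π := fun _ => (Time T₀ T₁ × X) ⊕ Unit) n m, m (n + 1)) :=
        hg.comp (by fun_prop)
      rw [lintegral_congr h2, lintegral_zero, lintegral_eq_zero_iff hgm] at h1
      filter_upwards [h1] with m hm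
      by_contra hm'
      exact one_ne_zero ((Set.indicator_of_mem (s := Sᶜ) hm' fun _ => (1 : ℝ≥0∞)).symm.trans hm)
  have hΦ := measurable_toSample ω₀
  refine ⟨Q.map (toSample ω₀), Measure.isProbabilityMeasure_map hΦ.aemeasurable, ?_, ?_⟩
  · intro B hB
    have hBm : MeasurableSet (Sum.inl '' (Set.univ ×ˢ B) : Set ((Time T₀ T₁ × X) ⊕ Unit)) :=
      (MeasurableSet.univ.prod hB).inl_image
    have hA : MeasurableSet {ω : Sample X T₀ T₁ | state 0 ω ∈ Sum.inl '' B} :=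
      measurable_state 0 hB.inl_image
    rw [Measure.map_apply hΦ hA]
    have h1 : Q.map (fun m => m 0) (Sum.inl '' (Set.univ ×ˢ B)) = γ B := by
      have hi : Measurable fun x : X => (Sum.inl (⊥, x) : (Time T₀ T₁ × X) ⊕ Unit) :=
        measurable_inl.comp measurable_prodMk_left
      rw [hQ0, Measure.map_apply hi hBm]
      congr 1
      ext x
      simp
    rw [← h1, Measure.map_apply (measurable_pi_apply 0) hBm]
    refine measure_congr ?_
    filter_upwards [hae] with m hm
    refine propext ?_
    change state 0 (toSample ω₀ m) ∈ Sum.inl '' B ↔ m 0 ∈ Sum.inl '' (Set.univ ×ˢ B)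
    rw [← stateOf_mark, mark_toSample ω₀ hm]
    rcases m 0 with z | a <;> simp [xInfty]
  · intro n F hF
    set E := (Time T₀ T₁ × X) ⊕ Unit
    -- Padding with missing jumps reproduces `truncate n`, so the history becomes a function of the
    -- first `n + 1` coordinates.
    set ext : (Finset.Iic n → E) → ℕ → E := fun h k =>
      if hk : k ≤ n then h ⟨k, Finset.mem_Iic.2 hk⟩ else Sum.inr () with hext
    have hextm : Measurable ext := by
      refine measurable_pi_lambda _ fun k => ?_
      by_cases hk : k ≤ n
      · simp only [hext, hk, dif_pos]
        fun_prop
      · simp only [hext, hk, dif_neg, not_false_eq_true]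
        fun_prop
    have htr : ∀ m, IsMarkSeq m → truncate n (toSample ω₀ m) =
        toSample ω₀ (ext (Preorder.frestrictLe (π := fun _ => E) n m)) := by
      intro m hm
      have h1 : ext (Preorder.frestrictLe (π := fun _ => E) n m) =
          fun k => mark k (truncate n (toSample ω₀ m)) := by
        ext1 k
        rw [mark_truncate, mark_toSample ω₀ hm]
        by_cases hk : k ≤ n <;> simp [hext, hk]
      refine ext_mark fun k => ?_
      rw [mark_toSample ω₀ (h1 ▸ isMarkSeq_mark _), h1]
    set G : (Finset.Iic n → E) × E → ℝ≥0∞ := fun p =>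
      onJump (fun z => F (toSample ω₀ (ext p.1), z)) p.2 with hG
    have hGm : Measurable G := by
      refine measurable_onJump ?_ measurable_snd
      exact hF.comp ((hΦ.comp (hextm.comp (measurable_fst.comp measurable_fst))).prodMk
        measurable_snd)
    have hLm : Measurable fun ω : Sample X T₀ T₁ =>
        onJump (fun z => F (truncate n ω, z)) (mark (n + 1) ω) :=
      measurable_onJump (F := fun ω z => F (truncate n ω, z))
        (hF.comp (((measurable_truncate n).comp measurable_fst).prodMk measurable_snd))
        (measurable_mark (n + 1))
    have hRm : Measurable fun ω : Sample X T₀ T₁ =>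
        onJump (fun z => ∫⁻ z', F (truncate n ω, z') ∂(q.nextJump z)) (mark n ω) := by
      refine measurable_onJump (F := fun ω z => ∫⁻ z', F (truncate n ω, z') ∂(q.nextJump z))
        (measurable_lintegral_nextJump ?_ measurable_snd) (measurable_mark n)
      exact hF.comp (((measurable_truncate n).comp (measurable_fst.comp measurable_fst)).prodMk
        measurable_snd)
    rw [lintegral_map hLm hΦ, lintegral_map hRm hΦ]
    refine (lintegral_congr_ae ?_).trans ((hQn n G hGm).trans (lintegral_congr_ae ?_))
    · filter_upwards [hae] with m hm
      rw [htr m hm, mark_toSample ω₀ hm]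
    · filter_upwards [hae] with m hm
      rw [htr m hm, mark_toSample ω₀ hm]
      exact lintegral_nextMark_onJump (m n) (f := fun z => F (toSample ω₀ (ext _), z))
        (hF.comp measurable_prodMk_left)

/-- The compensator determines the law. -/
theorem existsUnique_isCanonicalLaw (hL : q.HasLocallyIntegrableRates) (γ : Measure X)
    [IsProbabilityMeasure γ] : ∃! P : Measure (Sample X T₀ T₁), IsCanonicalLaw q γ P := by
  obtain ⟨P, hP, h0, hJ⟩ := exists_hasJumpLaw (T₀ := T₀) (T₁ := T₁) hL γ
  refine ⟨P, ⟨hP, h0, ((hasIntensity_iff_hasJumpLaw hL).2 hJ).isCompensator⟩, ?_⟩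
  rintro P' ⟨hP', h0', hC⟩
  refine HasJumpLaw.ext ((hasIntensity_iff_hasJumpLaw hL).1 (.of_isCompensator hC)) hJ ?_
  intro B hB
  rw [h0 B hB, h0' B hB]

end

/-! ### The Markov property -/

section

variable {X : Type*} {T₀ : ℝ} {T₁ : EReal} [Fact ((T₀ : EReal) < T₁)]

open scoped Classical in
theorem alive_Iic (t : Time T₀ T₁) (n : ℕ) (ω : Sample X T₀ T₁) :
    alive (Set.Iic t) n ω = if jumpTime n ω ≤ t ∧ t < jumpTime (n + 1) ω then 1 else 0 := by
  have h : ∀ k, inTimes (Set.Iic t) (mark k ω) = if jumpTime k ω ≤ t then 1 else 0 := by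
    intro k
    rw [← timeOf_mark]
    rcases mark k ω with z | a
    · simp [Set.indicator_apply]
    · simp
  rw [alive, h, h]
  by_cases h1 : jumpTime n ω ≤ t <;> by_cases h2 : jumpTime (n + 1) ω ≤ t <;> simp [h1, h2, not_lt.2, not_le.1]

theorem alive_Iic_eq_one {t : Time T₀ T₁} {n : ℕ} {ω : Sample X T₀ T₁} (h1 : jumpTime n ω ≤ t)
    (h2 : t < jumpTime (n + 1) ω) : alive (Set.Iic t) n ω = 1 := by
  rw [alive_Iic, if_pos ⟨h1, h2⟩]

theorem alive_Iic_eq_zero_of_ne {t : Time T₀ T₁} {m n : ℕ} {ω : Sample X T₀ T₁}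
    (h1 : jumpTime n ω ≤ t) (h2 : t < jumpTime (n + 1) ω) (hmn : m ≠ n) :
    alive (Set.Iic t) m ω = 0 := by
  rw [alive_Iic, if_neg fun h => hmn (jumpTime_interval_unique h.1 h.2 h1 h2)]

theorem alive_Iic_eq_zero_of_forall {t : Time T₀ T₁} {ω : Sample X T₀ T₁}
    (h : ∀ n, jumpTime n ω ≤ t) (n : ℕ) : alive (Set.Iic t) n ω = 0 := by
  rw [alive_Iic, if_neg fun h' => absurd (h (n + 1)) (not_le.2 h'.2)]

/-- At most one index is alive at time `t`, and it carries the present state. After an explosion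
none is, which matches the value `0` at `x_∞`. -/
theorem tsum_alive_mul_onJump (t : Time T₀ T₁) (ω : Sample X T₀ T₁) (h : X → ℝ≥0∞) :
    ∑' n, alive (Set.Iic t) n ω * onJump (fun z => h z.2) (mark n ω) =
      Sum.elim h (fun _ => 0) (jumpProcess t ω) := by
  rcases exists_jumpTime_le_lt_or t ω with ⟨n, h1, h2⟩ | h'
  · rw [tsum_eq_single n fun m hm => by rw [alive_Iic_eq_zero_of_ne h1 h2 hm, zero_mul],
      alive_Iic_eq_one h1 h2, jumpProcess_eq_state h1 h2, ← stateOf_mark, one_mul]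
    rcases mark n ω with z | a <;> simp [xInfty]
  · rw [jumpProcess_eq_xInfty h']
    simp [alive_Iic_eq_zero_of_forall h', xInfty]

/-- A path that has not exploded by `t` has not exploded by `u` either, and the index alive at `t`
is that at `u` plus the number `k` of jumps in between. -/
theorem tsum_alive_mul_eq_tsum_tsum {u t : Time T₀ T₁} (hut : u ≤ t) (ω : Sample X T₀ T₁)
    (b : ℕ → ℝ≥0∞) :
    ∑' n, alive (Set.Iic t) n ω * b n = ∑' n, ∑' k, alive (Set.Iic u) n ω *
      (alive (Set.Iic t) (n + k) ω * b (n + k)) := by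
  rcases exists_jumpTime_le_lt_or t ω with ⟨N, h1, h2⟩ | h'
  · rcases exists_jumpTime_le_lt_or u ω with ⟨n, h3, h4⟩ | h'
    · have hnN : n ≤ N := by
        by_contra! h
        exact absurd (h2.trans_le ((monotone_jumpTime ω h).trans h3))
          (not_lt.2 (WithTop.coe_le_coe.2 hut))
      rw [tsum_eq_single N fun m hm => by rw [alive_Iic_eq_zero_of_ne h1 h2 hm, zero_mul],
        tsum_eq_single n fun m hm => by simp [alive_Iic_eq_zero_of_ne h3 h4 hm],
        tsum_eq_single (N - n) fun k hk => by
          rw [alive_Iic_eq_zero_of_ne h1 h2 (by omega), zero_mul, mul_zero],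
        alive_Iic_eq_one h3 h4, one_mul, Nat.add_sub_cancel' hnN]
    · exact absurd ((h' (N + 1)).trans (WithTop.coe_le_coe.2 hut)) (not_le.2 h2)
  · simp [alive_Iic_eq_zero_of_forall h']

end

variable {X : Type*} [MeasurableSpace X] [StandardBorelSpace X] {T₀ : ℝ} {T₁ : EReal}
  {q : QFunction X T₀ T₁}

/-- The jump time has no atom at `t`, and a jump after a starting time beyond `t` is never in `]-∞,
t]`. The indicator covers both cases in one formula. -/
theorem setLIntegral_nextJump_Iic (hL : q.HasLocallyIntegrableRates) (z : Time T₀ T₁ × X)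
    (t : Time T₀ T₁) (f : Time T₀ T₁ × X → ℝ≥0∞) :
    ∫⁻ z' in Set.Iic t ×ˢ Set.univ, f z' ∂(q.nextJump z) =
      (Set.Iic t).indicator 1 z.1 * ∫⁻ z' in Set.Iio t ×ˢ Set.univ, f z' ∂(q.nextJump z) := by
  by_cases h : z.1 ≤ t
  · rw [Set.indicator_of_mem (Set.mem_Iic.2 h), Pi.one_apply, one_mul]
    refine setLIntegral_congr (ae_eq_of_subset_of_measure_ge
      (Set.prod_mono_left Set.Iio_subset_Iic_self) ?_
      (measurableSet_Iio.prod .univ).nullMeasurableSet ?_).symm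
    · refine le_of_eq ((ENNReal.add_left_inj (q.survival_ne_top z.2 z.1 t)).1 ?_)
      rw [q.nextJump_Iic_prod_add hL z h, q.nextJump_Iio_prod_add hL z h]
    · exact ne_top_of_le_ne_top ENNReal.one_ne_top
        ((measure_mono (Set.subset_univ _)).trans (q.nextJump_univ_le_one hL z))
  · rw [Set.indicator_of_notMem (by simpa using h), zero_mul, Measure.restrict_eq_zero.2,
      lintegral_zero_measure]
    refine measure_mono_null (Set.prod_mono_left (Set.Iic_subset_Iic.2 (not_le.1 h).le))
      (q.nextJump_Iic_fst z)

variable [Fact ((T₀ : EReal) < T₁)] {P : Measure (Sample X T₀ T₁)} [IsProbabilityMeasure P]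

/-- Given the first `m` jumps, exactly `k` more up to `t` have the probability of Feller's term
started at `t_m`. For `k = 0` this is survival; for the step, the induction hypothesis is used after
the jump `m + 1`, and the jump law integrates that jump out. -/
theorem HasJumpLaw.lintegral_alive_add (h : HasJumpLaw q P) (hL : q.HasLocallyIntegrableRates)
    (t : Time T₀ T₁) {B : Set X} (hB : MeasurableSet B) (k m : ℕ)
    {f : Sample X T₀ T₁ → ℝ≥0∞} (hf : Measurable f) :
    ∫⁻ ω, f (truncate m ω) * (alive (Set.Iic t) (m + k) ω *
        onJump (fun z => B.indicator 1 z.2) (mark (m + k) ω)) ∂P =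
      ∫⁻ ω, f (truncate m ω) * onJump (fun z => (Set.Iic t).indicator 1 z.1 *
        q.fellerTerm k z.1 z.2 t B) (mark m ω) ∂P := by
  have hB1 : Measurable (B.indicator (1 : X → ℝ≥0∞)) := measurable_one.indicator hB
  have ht1 : Measurable ((Set.Iic t).indicator (1 : Time T₀ T₁ → ℝ≥0∞)) :=
    measurable_one.indicator measurableSet_Iic
  induction k generalizing m f with
  | zero =>
    set f' : Sample X T₀ T₁ → ℝ≥0∞ := fun ω =>
      f ω * onJump (fun z => B.indicator 1 z.2) (mark m ω) with hf'
    have hfm : Measurable f' := hf.mul (measurable_onJump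
      (F := fun (_ : Sample X T₀ T₁) (z : Time T₀ T₁ × X) => B.indicator (1 : X → ℝ≥0∞) z.2)
      (hB1.comp (measurable_snd.comp measurable_snd)) (measurable_mark m))
    refine (lintegral_congr fun ω => ?_).trans ((h.hasSurvival_Iic hL t m f' hfm).trans
      (lintegral_congr fun ω => ?_))
    · simp only [hf', mark_truncate_of_le le_rfl, add_zero]
      ring
    · simp only [hf', mark_truncate_of_le le_rfl]
      rcases mark m ω with z | a
      · simp only [onJump_inl, QFunction.fellerTerm_zero]
        ring
      · simp
  | succ k ih =>
    have e1 := ih (m + 1) (hf.comp (measurable_truncate m))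
    simp only [Function.comp_apply, truncate_truncate_of_le (Nat.le_succ m)] at e1
    have hT := QFunction.measurable_fellerTerm_left (q := q) k t hB
    have hTt : Measurable fun z : Time T₀ T₁ × X =>
        (Set.Iic t).indicator 1 z.1 * q.fellerTerm k z.1 z.2 t B := (ht1.comp measurable_fst).mul hT
    set F : Sample X T₀ T₁ × Time T₀ T₁ × X → ℝ≥0∞ := fun p =>
      f p.1 * ((Set.Iic t).indicator 1 p.2.1 * q.fellerTerm k p.2.1 p.2.2 t B) with hF
    have hFm : Measurable F := (hf.comp measurable_fst).mul
      (hTt.comp measurable_snd)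
    rw [show m + (k + 1) = m + 1 + k by omega, e1]
    refine (lintegral_congr fun ω => ?_).trans ((h m F hFm).trans (lintegral_congr fun ω => ?_))
    · rcases mark (m + 1) ω with z | a <;> simp [hF]
    · rcases mark m ω with z | a
      · simp only [onJump_inl, hF]
        rw [lintegral_const_mul _ hTt,
          QFunction.fellerTerm_succ _ _ _ _ hB, ← setLIntegral_nextJump_Iic hL,
          ← lintegral_indicator (measurableSet_Iic.prod .univ)]
        congr 1
        refine lintegral_congr fun z' => ?_
        by_cases hz : z'.1 ≤ t <;> simp [hz]
      · simp

/-- The core of the Markov property: if `n` jumps have happened by `u`, Feller's term may be started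
at `u` instead of `t_n`. Both sides carry the factor `survival(x_n, t_n, u)`. On the left it splits
off by multiplicativity of survival for `k = 0`, and by memorylessness of `nextJump` when a further
jump follows; on the right it is the conditional probability of no jump in `]t_n, u]`. -/
theorem HasJumpLaw.lintegral_alive_mul_alive_add (h : HasJumpLaw q P)
    (hL : q.HasLocallyIntegrableRates) {u t : Time T₀ T₁} (hut : u ≤ t) {B : Set X}
    (hB : MeasurableSet B) (k n : ℕ) {f : Sample X T₀ T₁ → ℝ≥0∞} (hf : Measurable f) :
    ∫⁻ ω, f (truncate n ω) * (alive (Set.Iic u) n ω * (alive (Set.Iic t) (n + k) ω *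
        onJump (fun z => B.indicator 1 z.2) (mark (n + k) ω))) ∂P =
      ∫⁻ ω, f (truncate n ω) * (alive (Set.Iic u) n ω *
        onJump (fun z => q.fellerTerm k u z.2 t B) (mark n ω)) ∂P := by
  have ht1 : Measurable ((Set.Iic t).indicator (1 : Time T₀ T₁ → ℝ≥0∞)) :=
    measurable_one.indicator measurableSet_Iic
  have hu1 : Measurable ((Set.Ioi u).indicator (1 : Time T₀ T₁ → ℝ≥0∞)) :=
    measurable_one.indicator measurableSet_Ioi
  have hin : Measurable fun ω : Sample X T₀ T₁ => inTimes (Set.Iic u) (mark n ω) :=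
    (measurable_inTimes measurableSet_Iic).comp (measurable_mark n)
  have hfT : ∀ k, Measurable fun p : Sample X T₀ T₁ × Time T₀ T₁ × X =>
      q.fellerTerm k u p.2.2 t B := fun k =>
    (QFunction.measurable_fellerTerm_left k t hB).comp
      (measurable_const.prodMk (measurable_snd.comp measurable_snd))
  set f' : Sample X T₀ T₁ → ℝ≥0∞ := fun ω =>
    f ω * onJump (fun z => q.fellerTerm k u z.2 t B) (mark n ω) with hf'
  have hfm : Measurable f' := hf.mul (measurable_onJump (hfT k) (measurable_mark n))
  have eR := h.hasSurvival_Iic hL u n f' hfm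
  simp only [hf', mark_truncate_of_le le_rfl] at eR
  refine Eq.trans ?_ (eR.symm.trans (lintegral_congr fun ω => by ring))
  cases k with
  | zero =>
    have e1 := h.lintegral_alive_add hL t hB 0 n (hf.mul hin)
    simp only [Pi.mul_apply, mark_truncate_of_le le_rfl, add_zero] at e1
    simp only [add_zero]
    refine (lintegral_congr fun ω => ?_).trans (e1.trans (lintegral_congr fun ω => ?_))
    · rw [mul_assoc, ← mul_assoc (alive _ _ _), ← mul_assoc (inTimes _ _)]
      congr 2
      simp only [alive]
      -- A path without a jump up to `t` has none up to `u`.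
      have hle : 1 - inTimes (Set.Iic t) (mark (n + 1) ω) = 
          (1 - inTimes (Set.Iic u) (mark (n + 1) ω)) *
            (1 - inTimes (Set.Iic t) (mark (n + 1) ω)) := by
        rcases mark (n + 1) ω with z | a
        · by_cases h1 : z.1 ≤ u
          · simp [h1, h1.trans hut]
          · simp [h1]
        · simp
      rw [hle]
      rcases inTimes_eq_zero_or_one (Set.Iic u) (mark (n + 1) ω) with h1 | h1 <;> simp [h1]
    · rcases mark n ω with z | a
      · simp only [onJump_inl, inTimes_inl, QFunction.fellerTerm_zero]
        by_cases h1 : z.1 ≤ u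
        · simp only [Set.mem_Iic, h1, h1.trans hut, Set.indicator_of_mem, Pi.one_apply, one_mul,
            mul_one]
          rw [← q.survival_mul_survival hL z.2 h1 hut]
          ring
        · simp [h1]
      · simp
  | succ k =>
    set g : Sample X T₀ T₁ → ℝ≥0∞ := fun ω =>
      f (truncate n ω) * (inTimes (Set.Iic u) (mark n ω) *
        (1 - inTimes (Set.Iic u) (mark (n + 1) ω))) with hg
    have hgm : Measurable g := (hf.comp (measurable_truncate n)).mul
      (measurable_alive measurableSet_Iic n)
    have e1 := h.lintegral_alive_add hL t hB k (n + 1) hgm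
    simp only [hg, truncate_truncate_of_le (Nat.le_succ n), mark_truncate_of_le (Nat.le_succ n),
      mark_truncate_of_le le_rfl] at e1
    have hT := QFunction.measurable_fellerTerm_left (q := q) k t hB
    have hTt : Measurable fun z : Time T₀ T₁ × X =>
        (Set.Iic t).indicator 1 z.1 * q.fellerTerm k z.1 z.2 t B := (ht1.comp measurable_fst).mul hT
    -- The indicator of `]u, ∞[` records that the jump `n + 1` is after `u`, so that being alive at
    -- `u` becomes a condition on the history and the next jump alone.
    set F : Sample X T₀ T₁ × Time T₀ T₁ × X → ℝ≥0∞ := fun p =>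
      f p.1 * (inTimes (Set.Iic u) (mark n p.1) * ((Set.Ioi u).indicator 1 p.2.1 *
        ((Set.Iic t).indicator 1 p.2.1 * q.fellerTerm k p.2.1 p.2.2 t B))) with hF
    have hTu : Measurable fun z : Time T₀ T₁ × X => (Set.Ioi u).indicator 1 z.1 *
        ((Set.Iic t).indicator 1 z.1 * q.fellerTerm k z.1 z.2 t B) :=
      (hu1.comp measurable_fst).mul hTt
    have hFm : Measurable F := (hf.comp measurable_fst).mul ((hin.comp measurable_fst).mul
      (hTu.comp measurable_snd))
    rw [show n + (k + 1) = n + 1 + k by omega]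
    refine (lintegral_congr fun ω => ?_).trans (e1.trans ((lintegral_congr fun ω => ?_).trans
      ((h n F hFm).trans (lintegral_congr fun ω => ?_))))
    · simp only [alive]
      ring
    · rcases mark (n + 1) ω with z | a
      · by_cases h1 : z.1 ≤ u
        · simp [hF, h1, mark_truncate_of_le]
        · simp [hF, h1, mark_truncate_of_le, not_le.1 h1, mul_assoc]
      · simp
    · rcases hm : mark n ω with z | a
      · simp only [onJump_inl, hF, hm, inTimes_inl, mark_truncate_of_le le_rfl]
        rw [lintegral_const_mul _ (hTu.const_mul _), lintegral_const_mul _ hTu]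
        by_cases h1 : z.1 ≤ u
        · have h2 : ∫⁻ z' : Time T₀ T₁ × X, (Set.Ioi u).indicator 1 z'.1 *
              ((Set.Iic t).indicator 1 z'.1 * q.fellerTerm k z'.1 z'.2 t B) ∂(q.nextJump z) =
              q.survival z.2 z.1 u * q.fellerTerm (k + 1) u z.2 t B := by
            have e2 := QFunction.setLIntegral_nextJump_Ioi hL z.2 h1 hTt
            have e3 := setLIntegral_nextJump_Iic hL (u, z.2) t fun z =>
              q.fellerTerm k z.1 z.2 t B
            rw [← QFunction.fellerTerm_succ _ _ _ _ hB, Set.indicator_of_mem (Set.mem_Iic.2 hut),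
              Pi.one_apply, one_mul, ← lintegral_indicator (measurableSet_Iic.prod .univ)] at e3
            rw [← e3, ← lintegral_indicator (measurableSet_Ioi.prod .univ)] at *
            refine (lintegral_congr fun z' => ?_).trans (e2.trans (congrArg _
              (lintegral_congr fun z' => ?_)))
            · by_cases hz : u < z'.1 <;> simp [hz]
            · by_cases hz : z'.1 ≤ t <;> simp [hz]
          rw [h2]
          ring
        · simp [h1]
      · simp

/-- The event is decomposed by the number `n` of jumps up to `u` and the number `k` in `]u, t]`.
Each piece is evaluated by the restart at `u`, and the sum over `k` assembles Feller's function at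
the present state. -/
theorem HasJumpLaw.measure_inter_jumpProcess (h : HasJumpLaw q P)
    (hL : q.HasLocallyIntegrableRates) {u t : Time T₀ T₁} (hut : u ≤ t) {B : Set X}
    (hB : MeasurableSet B) {A : Set (Sample X T₀ T₁)}
    (hA : MeasurableSet[canonicalFiltration u] A) :
    P (A ∩ jumpProcess t ⁻¹' (Sum.inl '' B)) =
      ∫⁻ ω in A, Sum.elim (fun x => q.feller u x t B) (fun _ => 0) (jumpProcess u ω) ∂P := by
  obtain ⟨hAm, hAu⟩ := measurableSet_canonicalFiltration_iff.1 hA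
  have hA1 : Measurable (A.indicator (1 : Sample X T₀ T₁ → ℝ≥0∞)) := measurable_one.indicator hAm
  have hY : MeasurableSet (jumpProcess t ⁻¹' (Sum.inl '' B) : Set (Sample X T₀ T₁)) :=
    measurable_jumpProcess t hB.inl_image
  have hB1 : Measurable (B.indicator (1 : X → ℝ≥0∞)) := measurable_one.indicator hB
  -- Between `t_n` and `t_{n+1}` the path stopped at `u` is `truncate n ω`, so an event of `𝓕_u` is
  -- decided by that history.
  have hAn : ∀ n ω (b : ℝ≥0∞), A.indicator 1 ω * (alive (Set.Iic u) n ω * b) =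
      A.indicator 1 (truncate n ω) * (alive (Set.Iic u) n ω * b) := by
    intro n ω b
    rw [alive_Iic]
    split_ifs with hc
    · congr 1
      have : ω ∈ A ↔ truncate n ω ∈ A := by
        rw [← stopAt_eq_truncate hc.1 hc.2]
        exact (Set.ext_iff.1 hAu ω).symm
      by_cases hω : ω ∈ A
      · rw [Set.indicator_of_mem hω, Set.indicator_of_mem (this.1 hω)]; rfl
      · rw [Set.indicator_of_notMem hω, Set.indicator_of_notMem fun h' => hω (this.2 h')]
    · simp
  have hmark : ∀ (g : Time T₀ T₁ × X → ℝ≥0∞) (k : ℕ), Measurable g →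
      Measurable fun ω : Sample X T₀ T₁ => onJump g (mark k ω) := fun g k hg =>
    measurable_onJump (F := fun _ => g) (hg.comp measurable_snd) (measurable_mark k)
  calc P (A ∩ jumpProcess t ⁻¹' (Sum.inl '' B))
      = ∫⁻ ω, A.indicator 1 ω *
          Sum.elim (B.indicator 1) (fun _ => 0) (jumpProcess t ω) ∂P := by
        rw [← lintegral_indicator_one (hAm.inter hY)]
        refine lintegral_congr fun ω => ?_
        rw [Set.inter_indicator_one, Pi.mul_apply]
        congr 1
        rcases hj : jumpProcess t ω with x | a
        · by_cases hx : x ∈ B <;> simp [hj, hx]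
        · simp [hj]
    _ = ∫⁻ ω, ∑' n, ∑' k, A.indicator 1 (truncate n ω) * (alive (Set.Iic u) n ω *
          (alive (Set.Iic t) (n + k) ω *
            onJump (fun z => B.indicator 1 z.2) (mark (n + k) ω))) ∂P := by
        refine lintegral_congr fun ω => ?_
        rw [← tsum_alive_mul_onJump, tsum_alive_mul_eq_tsum_tsum hut, ← ENNReal.tsum_mul_left]
        refine tsum_congr fun n => ?_
        rw [← ENNReal.tsum_mul_left]
        exact tsum_congr fun k => hAn _ _ _
    _ = ∑' n, ∑' k, ∫⁻ ω, A.indicator 1 (truncate n ω) * (alive (Set.Iic u) n ω *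
          onJump (fun z => q.fellerTerm k u z.2 t B) (mark n ω)) ∂P := by
        have hm : ∀ n k, Measurable fun ω : Sample X T₀ T₁ =>
            A.indicator (1 : Sample X T₀ T₁ → ℝ≥0∞) (truncate n ω) * (alive (Set.Iic u) n ω *
              (alive (Set.Iic t) (n + k) ω *
                onJump (fun z => B.indicator 1 z.2) (mark (n + k) ω))) := fun n k =>
          (hA1.comp (measurable_truncate n)).mul ((measurable_alive measurableSet_Iic n).mul
            ((measurable_alive measurableSet_Iic (n + k)).mul
              (hmark _ _ (hB1.comp measurable_snd))))
        rw [lintegral_tsum fun n => (Measurable.tsum fun k => hm n k).aemeasurable]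
        refine tsum_congr fun n => ?_
        rw [lintegral_tsum fun k => (hm n k).aemeasurable]
        exact tsum_congr fun k => h.lintegral_alive_mul_alive_add hL hut hB k n hA1
    _ = ∫⁻ ω, ∑' n, ∑' k, A.indicator 1 (truncate n ω) * (alive (Set.Iic u) n ω *
          onJump (fun z => q.fellerTerm k u z.2 t B) (mark n ω)) ∂P := by
        have hm : ∀ n k, Measurable fun ω : Sample X T₀ T₁ =>
            A.indicator (1 : Sample X T₀ T₁ → ℝ≥0∞) (truncate n ω) * (alive (Set.Iic u) n ω *
              onJump (fun z => q.fellerTerm k u z.2 t B) (mark n ω)) := fun n k =>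
          (hA1.comp (measurable_truncate n)).mul ((measurable_alive measurableSet_Iic n).mul
            (hmark _ _ ((QFunction.measurable_fellerTerm_left k t hB).comp
              (measurable_const.prodMk measurable_snd))))
        rw [lintegral_tsum fun n => (Measurable.tsum fun k => hm n k).aemeasurable]
        exact tsum_congr fun n => (lintegral_tsum fun k => (hm n k).aemeasurable).symm
    _ = ∫⁻ ω, A.indicator 1 ω *
          Sum.elim (fun x => q.feller u x t B) (fun _ => 0) (jumpProcess u ω) ∂P := by
        refine lintegral_congr fun ω => ?_
        rw [← tsum_alive_mul_onJump, ← ENNReal.tsum_mul_left]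
        refine tsum_congr fun n => ?_
        rw [hAn, ENNReal.tsum_mul_left, ENNReal.tsum_mul_left]
        congr 2
        rcases mark n ω with z | a
        · rfl
        · simp
    _ = _ := by
        rw [← lintegral_indicator hAm]
        refine lintegral_congr fun ω => ?_
        by_cases hω : ω ∈ A <;> simp [hω]

/-- Stated for every σ-algebra `m` between that of the present state and `𝓕_u`: the answer does not
depend on `m`, so comparing the two extremes is the Markov property, and the smaller extreme gives
the transition function. -/
theorem HasJumpLaw.condExp_indicator_jumpProcess (law : HasJumpLaw q P)
    (hL : q.HasLocallyIntegrableRates) {u t : Time T₀ T₁} (hut : u < t) {B : Set X}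
    (hB : MeasurableSet B) : ∀ {m : MeasurableSpace (Sample X T₀ T₁)},
    m ≤ canonicalFiltration u → Measurable[m] (jumpProcess u : Sample X T₀ T₁ → Ext X) →
    P⟦ jumpProcess t ⁻¹' (Sum.inl '' B) | m⟧ =ᵐ[P]
      fun ω => Sum.elim (fun x => (q.feller u x t B).toReal) (fun _ => 0) (jumpProcess u ω) := by
  have hY : MeasurableSet (jumpProcess t ⁻¹' (Sum.inl '' B) : Set (Sample X T₀ T₁)) :=
    measurable_jumpProcess t hB.inl_image
  set G : Ext X → ℝ≥0∞ := Sum.elim (fun x => q.feller u x t B) fun _ => 0 with hG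
  have hGm : Measurable G :=
    ((QFunction.measurable_feller hB).comp
      (by fun_prop : Measurable fun x : X => (u, x, t))).sumElim measurable_const
  have hG1 : ∀ y, G y ≤ 1 := by
    rintro (x | a)
    · exact (QFunction.isTransitionFunction_feller hL).le_one u x t hut B hB
    · exact zero_le_one
  have hGr : (fun ω : Sample X T₀ T₁ => Sum.elim (fun x => (q.feller u x t B).toReal) (fun _ => 0)
      (jumpProcess u ω)) = fun ω => (G (jumpProcess u ω)).toReal := by
    ext ω
    rcases jumpProcess u ω with x | a <;> simp [hG]
  have hGi : Integrable (fun ω => (G (jumpProcess u ω)).toReal) P := by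
    refine integrable_toReal_of_lintegral_ne_top
      (hGm.comp (measurable_jumpProcess u)).aemeasurable ?_
    exact lintegral_ne_top_of_le_one fun ω => hG1 _
  have hYi : Integrable ((jumpProcess t ⁻¹' (Sum.inl '' B)).indicator fun _ => (1 : ℝ)) P :=
    (integrable_const 1).indicator hY
  have hA : ∀ A, MeasurableSet[canonicalFiltration u] A →
      ∫ ω in A, (G (jumpProcess u ω)).toReal ∂P =
        ∫ ω in A, (jumpProcess t ⁻¹' (Sum.inl '' B)).indicator (fun _ => (1 : ℝ)) ω ∂P := by
    intro A hA
    rw [integral_toReal (f := fun ω => G (jumpProcess u ω))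
      (hGm.comp (measurable_jumpProcess u)).aemeasurable
      (Filter.Eventually.of_forall fun ω => (hG1 _).trans_lt ENNReal.one_lt_top),
      ← law.measure_inter_jumpProcess hL hut.le hB hA, setIntegral_indicator hY,
      setIntegral_const, smul_eq_mul, mul_one]
    rfl
  intro m hm hYm
  rw [hGr]
  refine (ae_eq_condExp_of_forall_setIntegral_eq (hm.trans (canonicalFiltration.le u)) hYi
    (fun _ _ _ => hGi.integrableOn) (fun A hAm _ => hA A (hm A hAm)) ?_).symm
  exact (((ENNReal.measurable_toReal.comp hGm).comp hYm).stronglyMeasurable).aestronglyMeasurable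

theorem condExp_indicator_compl {Ω : Type*} {m mΩ : MeasurableSpace Ω} {μ : Measure Ω}
    [IsProbabilityMeasure μ] (hm : m ≤ mΩ) {s : Set Ω} (hs : MeasurableSet s) :
    μ⟦sᶜ | m⟧ =ᵐ[μ] fun ω => 1 - (μ⟦s | m⟧) ω := by
  have h : (sᶜ.indicator fun _ => (1 : ℝ)) = (fun _ => (1 : ℝ)) - s.indicator fun _ => (1 : ℝ) :=
    Set.indicator_compl s _
  rw [h]
  refine (condExp_sub (integrable_const 1) ((integrable_const (1 : ℝ)).indicator hs) m).trans ?_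
  rw [condExp_const hm]
  exact Filter.EventuallyEq.rfl

theorem HasJumpLaw.isMarkovProcess (law : HasJumpLaw q P) (hL : q.HasLocallyIntegrableRates) :
    IsMarkovProcess P canonicalFiltration
      (jumpProcess : Time T₀ T₁ → Sample X T₀ T₁ → Ext X) where
  rightContinuous := isRightContinuous_canonicalFiltration
  adapted := adapted_jumpProcess
  markov u t hut C hC := by
    have hle : MeasurableSpace.comap (jumpProcess u : Sample X T₀ T₁ → Ext X) inferInstance ≤
        canonicalFiltration u := (adapted_jumpProcess u).comap_le
    have key : ∀ B : Set X, MeasurableSet B →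
        P⟦ jumpProcess t ⁻¹' (Sum.inl '' B) | canonicalFiltration u⟧ =ᵐ[P]
          P⟦ jumpProcess t ⁻¹' (Sum.inl '' B) |
            MeasurableSpace.comap (jumpProcess u) inferInstance⟧ := fun B hB =>
      (law.condExp_indicator_jumpProcess hL hut hB le_rfl (adapted_jumpProcess u)).trans
        (law.condExp_indicator_jumpProcess hL hut hB hle (comap_measurable _)).symm
    -- A set that contains `x_∞` is the complement of a measurable subset of `X`, so the probability
    -- of explosion need not be computed.
    by_cases hc : Sum.inr () ∈ C
    · have hC' : C = (Sum.inl '' (Sum.inl ⁻¹' Cᶜ))ᶜ := by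
        ext y
        rcases y with x | ⟨⟩ <;> simp [hc]
      have hB : MeasurableSet (Sum.inl ⁻¹' Cᶜ : Set X) := measurable_inl hC.compl
      have hY : MeasurableSet (jumpProcess t ⁻¹' (Sum.inl '' (Sum.inl ⁻¹' Cᶜ : Set X)) :
          Set (Sample X T₀ T₁)) := measurable_jumpProcess t hB.inl_image
      rw [hC', Set.preimage_compl]
      refine (condExp_indicator_compl (canonicalFiltration.le u) hY).trans
        (Filter.EventuallyEq.trans ?_
          (condExp_indicator_compl (hle.trans (canonicalFiltration.le u)) hY).symm)
      filter_upwards [key _ hB] with ω hω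
      rw [hω]
    · have hC' : C = Sum.inl '' (Sum.inl ⁻¹' C) := by
        ext y
        rcases y with x | ⟨⟩ <;> simp [hc]
      rw [hC']
      exact key _ (measurable_inl hC)

theorem HasJumpLaw.hasTransitionFunction (law : HasJumpLaw q P)
    (hL : q.HasLocallyIntegrableRates) :
    HasTransitionFunction P (jumpProcess : Time T₀ T₁ → Sample X T₀ T₁ → Ext X) q.feller where
  isTransitionFunction := QFunction.isTransitionFunction_feller hL
  condProb_eq u _ hut _ hB := law.condExp_indicator_jumpProcess hL hut hB
    (adapted_jumpProcess u).comap_le (comap_measurable _)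

end

end JumpMarkov

theorem theorem2p1 {X : Type*} [MeasurableSpace X] [StandardBorelSpace X]
    {T₀ : ℝ} {T₁ : EReal} [Fact ((T₀ : EReal) < T₁)]
    (q : JumpMarkov.QFunction X T₀ T₁) (hq : q.IsConservative)
    (hL : q.HasLocallyIntegrableRates)
    (γ : MeasureTheory.Measure X) [MeasureTheory.IsProbabilityMeasure γ] :
    (∃! P : MeasureTheory.Measure (JumpMarkov.Sample X T₀ T₁), JumpMarkov.IsCanonicalLaw q γ P) ∧
    ∀ P : MeasureTheory.Measure (JumpMarkov.Sample X T₀ T₁), JumpMarkov.IsCanonicalLaw q γ P →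
      JumpMarkov.IsJumpMarkovProcess P JumpMarkov.canonicalFiltration JumpMarkov.jumpTime
        JumpMarkov.state JumpMarkov.jumpProcess ∧
      JumpMarkov.HasTransitionFunction P JumpMarkov.jumpProcess q.feller := by
  refine ⟨JumpMarkov.existsUnique_isCanonicalLaw hL γ, fun P ⟨hP, _, hC⟩ => ?_⟩
  have law := (JumpMarkov.hasIntensity_iff_hasJumpLaw hL).1 (.of_isCompensator hC)
  exact ⟨⟨law.isMarkovProcess hL, JumpMarkov.isJumpProcess_jumpProcess⟩, law.hasTransitionFunction hL⟩
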